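/- \textbf{Setting.} Let $\Lambda$ be the Grassmann algebra (formal sums) on countably many odd generators $\eta_1,\eta_2,\dots$ over $\mathbb R$. A superfield is $F(x,\theta)=F_0(x)+\theta F_1(x)$, $x\in\mathbb R$, $\theta$ an odd variable, with $F_0,F_1$ taking values in $\Lambda$; it is bosonic (fermionic) if it is even (odd) in $\theta,\eta_1,\eta_2,\dots$ jointly. Smoothness, derivatives and integrals are taken coefficient by coefficient. Put $\mathcal D=\partial_\theta+\theta\partial_x$, so $\mathcal D^2=\partial_x$. On smooth superfields vanishing near $x=-\infty$, $\mathcal D$ is invertible, with $\mathcal D^{-1}=\mathcal D\,\partial_x^{-1}$ and $\partial_x^{-1}F=\int_{-\infty}^xF$. Let $\langle F,G\rangle=\int dx\,d\theta\,FG$, with $\int d\theta\,(f_0+\theta f_1)=f_1$. Let $U$ be a smooth bosonic superfield whose body (the real-valued part free of $\theta,\eta_1,\eta_2,\dots$) is everywhere positive, so that the real powers $U^s$ are defined by Taylor expansion in the nilpotent part. For an operator $T(U)$ that is a product of powers of $U$, of $\mathcal D$ and of $\mathcal D^{-1}$, let $T'_W(F)=\frac{d}{d\epsilon}\big|_{\epsilon=0}T(U+\epsilon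 W)F$. A testing function of $T(U)$ is a smooth superfield that, together with all the intermediate results in the evaluation of the product $T(U)$ on it (in particular all the potentials $\mathcal D^{-1}(\cdot)$), has compact support in $x$. $T$ is called Hamiltonian if for all $U$ it is skew-symmetric, $\langle\alpha,T\beta\rangle=-\langle\beta,T\alpha\rangle$, and satisfies the Jacobi identity $$\langle\alpha,T'_{T(\beta)}(\gamma)\rangle+\langle\beta,T'_{T(\gamma)}(\alpha)\rangle+\langle\gamma,T'_{T(\alpha)}(\beta)\rangle=0$$ for all fermionic testing functions $\alpha,\beta,\gamma$. $T$ is called symplectic if for all $U$ it is skew-symmetric on bosonic testing functions and $\langle V_1,T'_{V_2}(V_3)\rangle+\langle V_2,T'_{V_3}(V_1)\rangle+\langle V_3,T'_{V_1}(V_2)\rangle=0$ for all bosonic testing functions $V_1,V_2,V_3$. \textbf{Statement.} Let $$Q=U^{3/2}\mathcal DU^{1/2}\mathcal DU^{-1}\mathcal D^{-5}U^{-1}\mathcal DU^{1/2}\mathcal DU^{3/2},\qquad J=U^{-3/2}\mathcal D^{-1}U^{-1/2}\mathcal D^{-1}U\mathcal D^5U\mathcal D^{-1}U^{-1/2}\mathcal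 D^{-1}U^{-3/2},$$ $$P=U^2\mathcal D^3U^2,$$ $$\begin{aligned}R={}&U^{3/2}\mathcal DU^{1/2}\mathcal DU^{-1}\partial_x^{-1}U\mathcal DU\mathcal DU^{-1}\mathcal D^{-1}U^{-1/2}\mathcal D^{-1}U^{-1/2}\mathcal DU\mathcal DU\mathcal DU^{-1/2}\\&\cdot\mathcal D^{-1}U^{-1/2}\mathcal D^{-1}U^{-1}\mathcal DU\mathcal DU\mathcal D^3U\mathcal D^{-1}U^{-1/2}\mathcal D^{-1}U^{-3/2}.\end{aligned}$$ 1. $Q$ satisfies the Jacobi identity (the derivatives $Q'$ in it exist), and $Q$ is a Hamiltonian operator. 2. On smooth superfields vanishing near $x=-\infty$: $QJ=JQ=1$, so $Q=J^{-1}$; $P$ is invertible with inverse $U^{-2}\mathcal D^{-3}U^{-2}$; and $J=P^{-1}R$. 3. $J$ is a symplectic operator and $P$ is a Hamiltonian operator. 4. They give a bi-Hamiltonian structure for the supersymmetric Harry Dym equation $$U_t=\tfrac14U_{xxx}U^3-\tfrac38(\mathcal DU_{xx})(\mathcal DU)U^2 ,$$ in the following sense. For every $U$ with $\mathcal DU$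 compactly supported, the variational derivatives at $U$ of $$H_1=\int dx\,d\theta\,\Big(-\tfrac18U^{-1}U_x(\mathcal DU)\Big),$$ $$\begin{aligned}H_2=\int dx\,d\theta\,\Big(&-\tfrac1{16}(\mathcal DU_x)U_x^2-\tfrac1{16}(\mathcal DU)U_{xx}U_x+\tfrac1{12}(\mathcal DU_{xxx})U^2+\tfrac18(\mathcal DU_{xx})U_xU\\&+\tfrac18(\mathcal DU_x)U_{xx}U+\tfrac1{24}(\mathcal DU)U_{xxx}U+\tfrac1{32}(\mathcal DU)U_x^3U^{-1}\Big)\end{aligned}$$ exist, and the right-hand side $X(U)$ of the equation satisfies $$X(U)=P(U)\frac{\delta H_1}{\delta U},\qquad J(U)X(U)=\frac{\delta H_2}{\delta U},\qquad X(U)=Q(U)\frac{\delta H_2}{\delta U}.$$ -/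

import Mathlib

open scoped ContDiff

noncomputable section

namespace SuperHD

/-- Superfields on the superline with even coordinate `x` and odd coordinate `θ`, with coefficients
in the Grassmann algebra on countably many odd generators `η₁, η₂, …`.
With `η₀ := θ`, the superfield `F` is `∑_S F_S(x) η_S`, where `S` runs over the finite subsets of `ℕ`
and `η_S` is the product of the `η_i`, `i ∈ S`, in increasing order. -/
abbrev Superfield : Type := Finset ℕ → ℝ → ℝ

/-- The sign in `η_S η_T = ± η_{S ∪ T}` for disjoint `S`, `T`: the parity of the number of pairs
`i ∈ S`, `j ∈ T` with `j < i`. -/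
def grassmannSign (S T : Finset ℕ) : ℝ :=
  (-1) ^ ((S ×ˢ T).filter fun p => p.2 < p.1).card

/-- The Grassmann product of superfields (not the coefficientwise product). -/
def gmul (F G : Superfield) : Superfield :=
  fun S x => ∑ T ∈ S.powerset, grassmannSign T (S \ T) * F T x * G (S \ T) x

infixl:72 " ⋆ " => SuperHD.gmul

/-- The unit superfield. -/
def gunit : Superfield := fun S _ => if S = ∅ then 1 else 0

/-- Smoothness of all coefficients. -/
def Smooth (F : Superfield) : Prop := ∀ S, ContDiff ℝ ∞ (F S)

/-- Bosonic (even) superfields. -/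
def Bosonic (F : Superfield) : Prop := ∀ S : Finset ℕ, Odd S.card → F S = 0

/-- Fermionic (odd) superfields. -/
def Fermionic (F : Superfield) : Prop := ∀ S : Finset ℕ, Even S.card → F S = 0

/-- Compact support in `x`. -/
def CompactSupp (F : Superfield) : Prop := ∃ r : ℝ, ∀ S x, r < |x| → F S x = 0

/-- Smooth superfields that vanish near `x = -∞`. On this space `D` is bijective. -/
def LeftBounded (F : Superfield) : Prop := Smooth F ∧ ∃ r : ℝ, ∀ S x, x < r → F S x = 0

/-- The derivative `∂ₓ`. -/
def dx (F : Superfield) : Superfield := fun S => deriv (F S)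

/-- The superderivative `D = ∂_θ + θ ∂ₓ`. -/
def D (F : Superfield) : Superfield :=
  fun S x => if 0 ∈ S then deriv (F (S.erase 0)) x else F (insert 0 S) x

/-- The antiderivative `(∂ₓ⁻¹ F)(x) = ∫_{-∞}^x F`. -/
def dxInv (F : Superfield) : Superfield := fun S x => ∫ t in Set.Iic x, F S t

/-- `D⁻¹ = D ∂ₓ⁻¹`. -/
def DInv (F : Superfield) : Superfield := D (dxInv F)

/-- The Berezin integral `∫ dx dθ F`, an element of the Grassmann algebra on `η₁, η₂, …`;
`∫ dθ θ = 1`, `∫ dθ 1 = 0`. -/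
def superIntegral (F : Superfield) : Finset ℕ → ℝ :=
  fun S => if 0 ∈ S then 0 else ∫ x, F (insert 0 S) x

/-- The pairing `⟨F, G⟩ = ∫ dx dθ F G`. -/
def pairing (F G : Superfield) : Finset ℕ → ℝ := superIntegral (F ⋆ G)

/-- The soul (nilpotent part) of a superfield; the body is the coefficient `F ∅`. -/
def soul (F : Superfield) : Superfield := fun S x => if S = ∅ then 0 else F S x

/-- Powers with natural exponent. -/
def npow (F : Superfield) : ℕ → Superfield
  | 0 => gunit
  | k + 1 => npow F k ⋆ F

/-- The real power `U ^ s` of a bosonic superfield with positive body `u`, by Taylor expansion in the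
soul `N`: `U ^ s = ∑ₖ s (s - 1) ⋯ (s - k + 1) / k! * u ^ (s - k) * N ^ k`. In the coefficient of `η_S`
only the terms with `k ≤ |S|` can be nonzero. -/
def fpow (U : Superfield) (s : ℝ) : Superfield :=
  fun S x => ∑ k ∈ Finset.range (S.card + 1),
    (∏ i ∈ Finset.range k, (s - i)) / (k.factorial : ℝ) * (U ∅ x) ^ (s - k) * npow (soul U) k S x

/-- The bosonic fields `U`: smooth, even, with positive body. -/
structure IsPositiveField (U : Superfield) : Prop where
  smooth : Smooth U
  bosonic : Bosonic U
  pos : ∀ x, 0 < U ∅ x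

/-! ### Operators that are products of `U ^ s`, `D` and `D⁻¹` -/

/-- The factors: multiplication by `U ^ s`, the superderivative, and its inverse. -/
inductive Factor : Type
  | pow (s : ℝ)
  | der
  | inv

/-- The action of a factor. -/
def Factor.act (U : Superfield) : Factor → Superfield → Superfield
  | .pow s, F => fpow U s ⋆ F
  | .der, F => D F
  | .inv, F => DInv F

/-- The operator given by a product of factors (the last factor of the list acts first). -/
def op : List Factor → Superfield → Superfield → Superfield
  | [], _, F => F
  | f :: w, U, F => f.act U (op w U F)

/-- A product with factors `D⁻¹` is nonlocal, and integration by parts needs that no boundary terms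
occur at infinity. `Admissible w U F`: all the intermediate results in the evaluation of the product `w` on `F` are
compactly supported, starting with `F` and ending with `op w U F`. -/
def Admissible : List Factor → Superfield → Superfield → Prop
  | [], _, F => CompactSupp F
  | f :: w, U, F => Admissible w U F ∧ CompactSupp (op (f :: w) U F)

/-- Fermionic testing functions of the operator `w` at `U`. -/
structure FermionicTest (w : List Factor) (U α : Superfield) : Prop where
  smooth : Smooth α
  fermionic : Fermionic α
  admissible : Admissible w U α

/-- Bosonic testing functions of the operator `w` at `U`. -/
structure BosonicTest (w : List Factor) (U V : Superfield) : Prop where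
  smooth : Smooth V
  bosonic : Bosonic V
  admissible : Admissible w U V

/-- `G = w'_W (F)` at `U`: the derivative of `w(U + ε W) F` with respect to `ε` at `ε = 0`. -/
def HasFrechetDeriv (w : List Factor) (U W F G : Superfield) : Prop :=
  Smooth G ∧ ∀ S x, HasDerivAt (fun ε : ℝ => op w (U + ε • W) F S x) (G S x) 0

/-- The Jacobi identity
`⟨α, w'_{w(β)}(γ)⟩ + ⟨β, w'_{w(γ)}(α)⟩ + ⟨γ, w'_{w(α)}(β)⟩ = 0` at `U` for fermionic
testing functions; the derivatives exist. -/
def JacobiIdentity (w : List Factor) (U : Superfield) : Prop :=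
  ∀ α β γ : Superfield, FermionicTest w U α → FermionicTest w U β → FermionicTest w U γ →
    ∃ G₁ G₂ G₃ : Superfield,
      HasFrechetDeriv w U (op w U β) γ G₁ ∧
      HasFrechetDeriv w U (op w U γ) α G₂ ∧
      HasFrechetDeriv w U (op w U α) β G₃ ∧
      pairing α G₁ + pairing β G₂ + pairing γ G₃ = 0

/-- Hamiltonian operators: skew-symmetric, with the Jacobi identity, at all fields `U`. -/
structure IsHamiltonian (w : List Factor) : Prop where
  skew : ∀ U, IsPositiveField U → ∀ α β, FermionicTest w U α → FermionicTest w U β →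
    pairing α (op w U β) = -pairing β (op w U α)
  jacobi : ∀ U, IsPositiveField U → JacobiIdentity w U

/-- Symplectic operators: skew-symmetric, and the 2-form `⟨V₁, w(U) V₂⟩` is closed. -/
structure IsSymplectic (w : List Factor) : Prop where
  skew : ∀ U, IsPositiveField U → ∀ V₁ V₂, BosonicTest w U V₁ → BosonicTest w U V₂ →
    pairing V₁ (op w U V₂) = -pairing V₂ (op w U V₁)
  closed : ∀ U, IsPositiveField U → ∀ V₁ V₂ V₃,
    BosonicTest w U V₁ → BosonicTest w U V₂ → BosonicTest w U V₃ →
    ∃ G₁ G₂ G₃ : Superfield,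
      HasFrechetDeriv w U V₂ V₃ G₁ ∧
      HasFrechetDeriv w U V₃ V₁ G₂ ∧
      HasFrechetDeriv w U V₁ V₂ G₃ ∧
      pairing V₁ G₁ + pairing V₂ G₂ + pairing V₃ G₃ = 0

/-- `w₁` and `w₂` are mutually inverse on the smooth superfields that vanish near `-∞`. -/
def AreInverse (w₁ w₂ : List Factor) : Prop :=
  ∀ U, IsPositiveField U → ∀ F, LeftBounded F →
    op w₁ U (op w₂ U F) = F ∧ op w₂ U (op w₁ U F) = F

/-- `E = δH/δU` for `H(U) = ∫ dx dθ h(U)`: the derivative of `H` at `U` in the direction `W` is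
`⟨W, E⟩`, for all bosonic `W` with compact support. -/
def HasVariationalDeriv (h : Superfield → Superfield) (U E : Superfield) : Prop :=
  Smooth E ∧ Fermionic E ∧ ∀ W, Smooth W → Bosonic W → CompactSupp W → ∀ S,
    HasDerivAt (fun ε : ℝ => superIntegral (h (U + ε • W)) S) (pairing W E S) 0

/-- The evolution equation `U_t = X(U)` is bi-Hamiltonian: `P` is a Hamiltonian operator, `J` is a
symplectic operator, and the equation reads `U_t = P(U) δH₁/δU` as well as `J(U) U_t = δH₂/δU`,
where `H₁ = ∫ dx dθ h₁` and `H₂ = ∫ dx dθ h₂`. The fields are constant near `-∞` and near `+∞`. -/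
structure IsBiHamiltonian (X : Superfield → Superfield) (P J : List Factor)
    (h₁ h₂ : Superfield → Superfield) : Prop where
  hamiltonian : IsHamiltonian P
  symplectic : IsSymplectic J
  flow : ∀ U, IsPositiveField U → CompactSupp (D U) →
    LeftBounded (X U) ∧
    (∃ E₁, HasVariationalDeriv h₁ U E₁ ∧ X U = op P U E₁) ∧
    (∃ E₂, HasVariationalDeriv h₂ U E₂ ∧ op J U (X U) = E₂)

/-! ### The supersymmetric Harry Dym equation -/

/-- The right-hand side of `U_t = 1/4 U_{xxx} U³ - 3/8 (D U_{xx}) (D U) U²`. -/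
def shd (U : Superfield) : Superfield :=
  (1 / 4 : ℝ) • (dx (dx (dx U)) ⋆ fpow U 3)
    - (3 / 8 : ℝ) • (D (dx (dx U)) ⋆ D U ⋆ fpow U 2)

open Factor in
/-- `P = U² D³ U²`. -/
def opP : List Factor := [pow 2, der, der, der, pow 2]

open Factor in
/-- `P⁻¹ = U⁻² D⁻³ U⁻²`. -/
def opPInv : List Factor := [pow (-2), inv, inv, inv, pow (-2)]

open Factor in
/-- `Q = U^{3/2} D U^{1/2} D U⁻¹ D⁻⁵ U⁻¹ D U^{1/2} D U^{3/2}`. -/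
def opQ : List Factor :=
  [pow (3 / 2), der, pow (1 / 2), der, pow (-1),
    inv, inv, inv, inv, inv,
    pow (-1), der, pow (1 / 2), der, pow (3 / 2)]

open Factor in
/-- `J = U^{-3/2} D⁻¹ U^{-1/2} D⁻¹ U D⁵ U D⁻¹ U^{-1/2} D⁻¹ U^{-3/2}`. -/
def opJ : List Factor :=
  [pow (-3 / 2), inv, pow (-1 / 2), inv, pow 1,
    der, der, der, der, der,
    pow 1, inv, pow (-1 / 2), inv, pow (-3 / 2)]

open Factor in
/-- The recursion operator
`R = U^{3/2} D U^{1/2} D U⁻¹ ∂ₓ⁻¹ U D U D U⁻¹ D⁻¹ U^{-1/2} D⁻¹ U^{-1/2} D U D U D U^{-1/2}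
D⁻¹ U^{-1/2} D⁻¹ U⁻¹ D U D U D³ U D⁻¹ U^{-1/2} D⁻¹ U^{-3/2}`, with `∂ₓ⁻¹ = D⁻²`. -/
def opR : List Factor :=
  [pow (3 / 2), der, pow (1 / 2), der, pow (-1), inv, inv,
    pow 1, der, pow 1, der, pow (-1), inv, pow (-1 / 2), inv, pow (-1 / 2),
    der, pow 1, der, pow 1, der, pow (-1 / 2),
    inv, pow (-1 / 2), inv, pow (-1), der, pow 1, der, pow 1, der, der, der,
    pow 1, inv, pow (-1 / 2), inv, pow (-3 / 2)]

/-- The density `-1/8 U⁻¹ Uₓ (D U)` of the first Hamiltonian. -/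
def density₁ (U : Superfield) : Superfield :=
  (-1 / 8 : ℝ) • (fpow U (-1) ⋆ dx U ⋆ D U)

/-- The density of the second Hamiltonian,
`-1/16 (D Uₓ) Uₓ² - 1/16 (D U) Uₓₓ Uₓ + 1/12 (D Uₓₓₓ) U² + 1/8 (D Uₓₓ) Uₓ U
+ 1/8 (D Uₓ) Uₓₓ U + 1/24 (D U) Uₓₓₓ U + 1/32 (D U) Uₓ³ U⁻¹`. -/
def density₂ (U : Superfield) : Superfield :=
  (-1 / 16 : ℝ) • (D (dx U) ⋆ dx U ⋆ dx U)
    - (1 / 16 : ℝ) • (D U ⋆ dx (dx U) ⋆ dx U)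
    + (1 / 12 : ℝ) • (D (dx (dx (dx U))) ⋆ fpow U 2)
    + (1 / 8 : ℝ) • (D (dx (dx U)) ⋆ dx U ⋆ U)
    + (1 / 8 : ℝ) • (D (dx U) ⋆ dx (dx U) ⋆ U)
    + (1 / 24 : ℝ) • (D U ⋆ dx (dx (dx U)) ⋆ U)
    + (1 / 32 : ℝ) • (D U ⋆ dx U ⋆ dx U ⋆ dx U ⋆ fpow U (-1))

end SuperHD

end

open SuperHD

/-!
The bilinear forms, Jacobi expressions and first variations of the statement are Berezin integrals,
and all integral identities are proved by exhibiting the integrand as a total derivative. To make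
the derivatives in the field algebraic, superfields are replaced by smooth families with a
parameter `ε`, that is by elements of the Grassmann algebra `Gr Sm` over the smooth functions of
`(ε, x)`. Its even part is a commutative ring, its odd part a module over it, and `D` an odd
derivation (`SuperDiff`); the derivatives `T'_W` and the variational derivatives are obtained by
applying `∂_ε` to a family and freezing `ε = 0` (`IsPerturbation.hasFrechetDeriv`,
`hasVariationalDeriv_of_total`). Since `∂_ε` is an even derivation commuting with `D`, everything
is a computation in a superalgebra.

*The operator `J`.* On left-bounded superfields `D` is bijective, so a product of factors is
inverted by the reversed product of the inverse factors; this gives `J = Q⁻¹`. In terms of the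
potentials `a = D⁻¹ U^{-3/2} V` and `b = D⁻¹ U^{-1/2} a`, integration by parts turns `⟨V₁, J V₂⟩`
into `-⟨c₁, D⁵ c₂⟩` with `c = U b`, which is skew-symmetric. The point is that the antisymmetrized
variation of `c` is local: it is the super Witt bracket `c₁ c₂' - c₁' c₂ + (1/2) (D c₁) (D c₂)` of
the vector fields `c₁`, `c₂` (`Super.dot_bracket`, `PosField.Tangent.bracket`). Hence the form is
closed because the pairing with `D⁵` is a 2-cocycle, the superanalogue of the Gelfand–Fuchs cocycle
(`Super.cocycle`, `valJ_closed`).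

*The operators `Q` and `P`.* As `Q` is the inverse of `J`, its skew-symmetry is that of `J`, and
differentiating `J Q γ = γ` identifies its Jacobi expression with the closedness of the form of `J`
(`dEps_valQ`, `valQ_jacobi`). For `P = U² D³ U²` three integrations by parts give both properties
(`Super.DIdeal.jacobi_cubic_mem`).

*The factorization `J = P⁻¹ R`.* It holds in every ring with invertible `φ` (here `U^{1/2}`) and
`D` such that `h = [D, φ]` commutes with `φ` and has square zero. The conjugates of `φ D` by powers
of `φ` are `φ D + k h`, and what remains is that a certain product of such factors and of `(φ D)⁻¹`
is even in `h` (`recursion_identity`, `even_product`).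

*The equation.* The variational derivatives `E₁`, `E₂` are computed by integration by parts, and
`X = P E₁` by expanding. For `X = Q E₂` the potential `D⁻⁵` occurring in `Q E₂` is local: up to a
factor it is `U g` with `g = 2 U U_xx - U_x² + 2 (D U) (D U_x)` (`PosField.valQ_grad₂`). Finally
`J X = E₂`, as `J Q = 1`.
-/

set_option linter.unusedSectionVars false
set_option linter.unusedSimpArgs false

noncomputable section

namespace SuperHD

/-! ### Grassmann algebras -/

/-- The number of inversions, whose parity gives the sign in `η_S η_T = ± η_{S ∪ T}`. -/
def inversions (S T : Finset ℕ) : ℕ := ((S ×ˢ T).filter fun p => p.2 < p.1).card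

lemma inversions_union_left {S T : Finset ℕ} (h : Disjoint S T) (R : Finset ℕ) :
    inversions (S ∪ T) R = inversions S R + inversions T R := by
  unfold inversions
  rw [Finset.union_product, Finset.filter_union, Finset.card_union_of_disjoint]
  apply Finset.disjoint_filter_filter
  rw [Finset.disjoint_product]
  exact Or.inl h

lemma inversions_union_right {S T : Finset ℕ} (h : Disjoint S T) (R : Finset ℕ) :
    inversions R (S ∪ T) = inversions R S + inversions R T := by
  unfold inversions
  rw [Finset.product_union, Finset.filter_union, Finset.card_union_of_disjoint]
  apply Finset.disjoint_filter_filter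
  rw [Finset.disjoint_product]
  exact Or.inr h

lemma inversions_add_swap {S T : Finset ℕ} (h : Disjoint S T) :
    inversions S T + inversions T S = S.card * T.card := by
  have hswap : inversions T S = ((S ×ˢ T).filter fun p => ¬ p.2 < p.1).card := by
    unfold inversions
    refine Finset.card_bij' (fun p _ => (p.2, p.1)) (fun p _ => (p.2, p.1)) ?_ ?_ ?_ ?_
    · rintro ⟨a, b⟩ hp
      simp only [Finset.mem_filter, Finset.mem_product] at hp ⊢
      exact ⟨⟨hp.1.2, hp.1.1⟩, by omega⟩
    · rintro ⟨a, b⟩ hp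
      simp only [Finset.mem_filter, Finset.mem_product] at hp ⊢
      refine ⟨⟨hp.1.2, hp.1.1⟩, ?_⟩
      have : a ≠ b := fun hab => (Finset.disjoint_left.mp h) hp.1.1 (hab ▸ hp.1.2)
      omega
    · rintro ⟨a, b⟩ _; rfl
    · rintro ⟨a, b⟩ _; rfl
  rw [hswap, ← Finset.card_product]
  exact Finset.card_filter_add_card_filter_not _

@[simp] lemma inversions_empty_left (S : Finset ℕ) : inversions ∅ S = 0 := by simp [inversions]
@[simp] lemma inversions_empty_right (S : Finset ℕ) : inversions S ∅ = 0 := by simp [inversions]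

/-- The Grassmann algebra (formal sums) on the generators `η₀, η₁, …` over `K`, where `η₀ = θ`.
The value at `S` is the coefficient of the product of the `η_i`, `i ∈ S`, in increasing order. -/
def Gr (K : Type*) : Type _ := Finset ℕ → K

namespace Gr

variable {K : Type*} [CommRing K]

instance : AddCommGroup (Gr K) := inferInstanceAs (AddCommGroup (Finset ℕ → K))

instance {R : Type*} [Semiring R] [Module R K] : Module R (Gr K) :=
  inferInstanceAs (Module R (Finset ℕ → K))

@[ext] lemma ext {F G : Gr K} (h : ∀ S, F S = G S) : F = G := funext h

@[simp] lemma add_apply (F G : Gr K) (S : Finset ℕ) : (F + G) S = F S + G S := rfl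
@[simp] lemma neg_apply (F : Gr K) (S : Finset ℕ) : (-F) S = -F S := rfl
@[simp] lemma zero_apply (S : Finset ℕ) : (0 : Gr K) S = 0 := rfl
@[simp] lemma smul_apply {R : Type*} [Semiring R] [Module R K] (c : R) (F : Gr K) (S : Finset ℕ) :
    (c • F) S = c • F S := rfl

@[simp] lemma sum_apply {ι : Type*} (s : Finset ι) (F : ι → Gr K) (S : Finset ℕ) :
    (∑ i ∈ s, F i) S = ∑ i ∈ s, F i S := Finset.sum_apply S s F

instance : One (Gr K) := ⟨fun S => if S = ∅ then 1 else 0⟩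

instance : Mul (Gr K) :=
  ⟨fun F G S => ∑ T ∈ S.powerset, (-1) ^ inversions T (S \ T) * F T * G (S \ T)⟩

lemma one_apply (S : Finset ℕ) : (1 : Gr K) S = if S = ∅ then 1 else 0 := rfl

lemma mul_apply (F G : Gr K) (S : Finset ℕ) :
    (F * G) S = ∑ T ∈ S.powerset, (-1) ^ inversions T (S \ T) * F T * G (S \ T) := rfl

protected lemma mul_assoc' (F G H : Gr K) : F * G * H = F * (G * H) := by
  ext S
  simp only [mul_apply, Finset.mul_sum, Finset.sum_mul]
  rw [Finset.sum_sigma', Finset.sum_sigma']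
  refine Finset.sum_bij' (fun p _ => ⟨p.2, p.1 \ p.2⟩) (fun p _ => ⟨p.1 ∪ p.2, p.1⟩) ?_ ?_ ?_ ?_ ?_
  · rintro ⟨T, A⟩ h
    simp only [Finset.mem_sigma, Finset.mem_powerset] at h ⊢
    exact ⟨h.2.trans h.1, Finset.sdiff_subset_sdiff h.1 subset_rfl⟩
  · rintro ⟨A, B⟩ h
    simp only [Finset.mem_sigma, Finset.mem_powerset] at h ⊢
    exact ⟨Finset.union_subset h.1 (h.2.trans Finset.sdiff_subset), Finset.subset_union_left⟩
  · rintro ⟨T, A⟩ h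
    simp only [Finset.mem_sigma, Finset.mem_powerset] at h ⊢
    rw [Finset.union_sdiff_of_subset h.2]
  · rintro ⟨A, B⟩ h
    simp only [Finset.mem_sigma, Finset.mem_powerset] at h ⊢
    have hd : Disjoint B A := Finset.disjoint_of_subset_left h.2 Finset.sdiff_disjoint
    rw [Finset.union_sdiff_cancel_left hd.symm]
  · rintro ⟨T, A⟩ h
    simp only [Finset.mem_sigma, Finset.mem_powerset] at h ⊢
    have h1 : (S \ A) \ (T \ A) = S \ T := by
      ext x; simp only [Finset.mem_sdiff]
      have := @h.2 x; tauto
    have h2 : inversions T (S \ T) = inversions A (S \ T) + inversions (T \ A) (S \ T) := by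
      rw [← inversions_union_left Finset.disjoint_sdiff, Finset.union_sdiff_of_subset h.2]
    have h3 : inversions A (S \ A) = inversions A (T \ A) + inversions A (S \ T) := by
      rw [← inversions_union_right]
      · congr 1
        ext x; simp only [Finset.mem_sdiff, Finset.mem_union]
        have := @h.2 x; have := @h.1 x; tauto
      · exact Finset.disjoint_of_subset_left Finset.sdiff_subset Finset.disjoint_sdiff
    rw [h1, h2, h3]
    ring

instance : Ring (Gr K) :=
  { (inferInstance : AddCommGroup (Gr K)) with
    mul_assoc := Gr.mul_assoc'
    one_mul F := by
      ext S
      rw [mul_apply, Finset.sum_eq_single ∅]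
      · simp [one_apply]
      · intro T _ hT; simp [one_apply, hT]
      · simp
    mul_one F := by
      ext S
      rw [mul_apply, Finset.sum_eq_single S]
      · simp [one_apply]
      · intro T hT hTS
        have : S \ T ≠ ∅ := fun h =>
          hTS (Finset.Subset.antisymm (Finset.mem_powerset.mp hT)
            (Finset.sdiff_eq_empty_iff_subset.mp h))
        simp [one_apply, this]
      · simp
    left_distrib F G H := by ext S; simp [mul_apply, mul_add, Finset.sum_add_distrib]
    right_distrib F G H := by ext S; simp [mul_apply, mul_add, add_mul, Finset.sum_add_distrib]
    zero_mul F := by ext S; simp [mul_apply]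
    mul_zero F := by ext S; simp [mul_apply] }

instance {R : Type*} [CommSemiring R] [Algebra R K] : Algebra R (Gr K) := Algebra.ofModule
  (fun c F G => by ext S; simp [mul_apply, Finset.smul_sum])
  (fun c F G => by ext S; simp [mul_apply, Finset.smul_sum])

variable [Algebra ℝ K]

/-- Only products of an even number of generators occur. -/
def IsEven (F : Gr K) : Prop := ∀ S : Finset ℕ, Odd S.card → F S = 0

/-- Only products of an odd number of generators occur. -/
def IsOdd (F : Gr K) : Prop := ∀ S : Finset ℕ, Even S.card → F S = 0

/-- Elements of pure parity commute up to the sign given by `inversions_add_swap`. -/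
lemma mul_comm_sign {F G : Gr K} (n : ℕ)
    (h : ∀ S T, F S ≠ 0 → G T ≠ 0 → (Even (S.card * T.card) ↔ Even n)) :
    F * G = (-1) ^ n * (G * F) := by
  have hn : ∀ m : ℕ, ∀ X : Gr K, ∀ S, ((-1) ^ m * X) S = (-1) ^ m * X S := by
    intro m X S
    rcases Nat.even_or_odd m with hm | hm <;> simp [hm.neg_one_pow]
  ext S
  rw [hn, mul_apply, mul_apply, Finset.mul_sum]
  refine Finset.sum_bij' (fun T _ => S \ T) (fun T _ => S \ T) ?_ ?_ ?_ ?_ ?_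
  · simp
  · simp
  · intro T hT; simpa using Finset.mem_powerset.mp hT
  · intro T hT; simpa using Finset.mem_powerset.mp hT
  · intro T hT
    have hTS : T ⊆ S := Finset.mem_powerset.mp hT
    rw [Finset.sdiff_sdiff_eq_self hTS]
    by_cases h1 : F T = 0
    · simp [h1]
    by_cases h2 : G (S \ T) = 0
    · simp [h2]
    have := inversions_add_swap (Finset.disjoint_sdiff (s := T) (t := S))
    have h3 := h _ _ h1 h2
    rw [← this] at h3
    have h4 : (-1 : K) ^ inversions T (S \ T) = (-1) ^ n * (-1) ^ inversions (S \ T) T := by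
      rw [← pow_add]
      rw [Nat.even_add] at h3
      rcases Nat.even_or_odd n with hn | hn <;>
      rcases Nat.even_or_odd (inversions T (S \ T)) with ha | ha <;>
      rcases Nat.even_or_odd (inversions (S \ T) T) with hb | hb <;>
      simp_all [Odd.neg_one_pow, pow_add, ← Nat.not_even_iff_odd]
    rw [h4]; ring

lemma IsEven.mul_comm {F : Gr K} (hF : IsEven F) (G : Gr K) :
    F * G = G * F := by
  have := mul_comm_sign (F := F) (G := G) 0 (fun S T hS hT => by
    have : Even S.card := by
      by_contra h; exact hS (hF S (Nat.not_even_iff_odd.mp h))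
    simp [this])
  simpa using this

lemma IsOdd.mul_comm {F : Gr K} (hF : IsOdd F) {G : Gr K} (hG : IsOdd G) : F * G = -(G * F) := by
  have := mul_comm_sign (F := F) (G := G) 1 (fun S T hS hT => by
    have h1 : ¬ Even S.card := fun h => hS (hF S h)
    have h2 : ¬ Even T.card := fun h => hT (hG T h)
    simp [Nat.even_mul, h1, h2])
  simpa using this

lemma mul_parity {F G : Gr K} {S : Finset ℕ}
    (h : ∀ T, T ⊆ S → F T ≠ 0 → G (S \ T) ≠ 0 → False) : (F * G) S = 0 := by
  rw [mul_apply]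
  refine Finset.sum_eq_zero fun T hT => ?_
  by_cases h1 : F T = 0
  · simp [h1]
  by_cases h2 : G (S \ T) = 0
  · simp [h2]
  exact (h T (Finset.mem_powerset.mp hT) h1 h2).elim

lemma card_parity {T S : Finset ℕ} (h : T ⊆ S) :
    Even S.card ↔ (Even T.card ↔ Even (S \ T).card) := by
  rw [← Finset.card_sdiff_add_card_eq_card h, Nat.even_add]; tauto

lemma IsEven.mul {F G : Gr K} (hF : IsEven F) (hG : IsEven G) : IsEven (F * G) := fun S hS =>
  mul_parity fun T hT h1 h2 => by
    have a := mt (hF T) h1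
    have b := mt (hG _) h2
    rw [Nat.not_odd_iff_even] at a b
    rw [← Nat.not_even_iff_odd, card_parity hT] at hS
    tauto

lemma IsEven.mul_odd {F G : Gr K} (hF : IsEven F) (hG : IsOdd G) : IsOdd (F * G) := fun S hS =>
  mul_parity fun T hT h1 h2 => by
    have a := mt (hF T) h1
    have b := mt (hG _) h2
    rw [Nat.not_odd_iff_even] at a
    rw [card_parity hT] at hS
    tauto

lemma IsOdd.mul {F G : Gr K} (hF : IsOdd F) (hG : IsOdd G) : IsEven (F * G) := fun S hS =>
  mul_parity fun T hT h1 h2 => by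
    have a := mt (hF T) h1
    have b := mt (hG _) h2
    rw [← Nat.not_even_iff_odd, card_parity hT] at hS
    tauto

variable (K) in
/-- The even part, a commutative algebra. -/
def Ev : Subalgebra ℝ (Gr K) where
  carrier := {F | IsEven F}
  mul_mem' := IsEven.mul
  add_mem' := fun ha hb S hS => by simp [ha S hS, hb S hS]
  algebraMap_mem' := fun r S hS => by
    have : S ≠ ∅ := by rintro rfl; simp at hS
    rw [Algebra.algebraMap_eq_smul_one]; simp [one_apply, this]

variable (K) in
/-- The odd part, a module over the even part. -/
def Od : Submodule ℝ (Gr K) where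
  carrier := {F | IsOdd F}
  zero_mem' := fun S _ => rfl
  add_mem' := fun ha hb S hS => by simp [ha S hS, hb S hS]
  smul_mem' := fun r F hF S hS => by simp [hF S hS]

instance : CommRing (Ev K) :=
  { (inferInstance : Ring (Ev K)) with mul_comm := fun a b => Subtype.ext (a.2.mul_comm b) }

instance : Module (Ev K) (Od K) where
  smul a x := ⟨a * x, IsEven.mul_odd a.2 x.2⟩
  one_smul x := Subtype.ext (one_mul (x : Gr K))
  mul_smul a b x := Subtype.ext (mul_assoc (a : Gr K) b x)
  smul_zero a := Subtype.ext (mul_zero (a : Gr K))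
  smul_add a x y := Subtype.ext (mul_add (a : Gr K) x y)
  add_smul a b x := Subtype.ext (add_mul (a : Gr K) b x)
  zero_smul x := Subtype.ext (zero_mul (x : Gr K))

@[simp] lemma coe_smul (a : Ev K) (x : Od K) : ((a • x : Od K) : Gr K) = a * x := rfl

instance : IsScalarTower ℝ (Ev K) (Od K) where
  smul_assoc c a x := Subtype.ext (smul_mul_assoc c (a : Gr K) (x : Gr K))

end Gr

/-! ### Supercommutative differential algebras -/

/-- A supercommutative algebra with an odd derivation, presented by its even part `A` and its odd
part `M`, so that `A` is an ordinary commutative ring and `M` a module over it. -/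
class SuperDiff (A M : Type*) [CommRing A] [Algebra ℝ A] [AddCommGroup M] [Module ℝ M]
    [Module A M] where
  /-- The product of two odd elements. -/
  pr : M →ₗ[A] M →ₗ[A] A
  pr_swap : ∀ x y, pr x y = -pr y x
  pr_smul : ∀ x y z, pr x y • z = pr y z • x
  /-- The odd derivation on even elements. -/
  d : A →ₗ[ℝ] M
  /-- The odd derivation on odd elements. -/
  δ : M →ₗ[ℝ] A
  d_mul : ∀ a b, d (a * b) = a • d b + b • d a
  δ_smul : ∀ a x, δ (a • x) = pr (d a) x + a * δ x
  d_pr : ∀ x y, d (pr x y) = δ x • y - δ y • x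

namespace Super

variable {A M : Type*} [CommRing A] [Algebra ℝ A] [AddCommGroup M] [Module ℝ M]
    [Module A M] [IsScalarTower ℝ A M] [SuperDiff A M]

local notation "d" => SuperDiff.d (A := A) (M := M)
local notation "δ" => SuperDiff.δ (A := A) (M := M)
local notation "pr" => SuperDiff.pr (A := A) (M := M)

open SuperDiff

lemma pr_self (x : M) : pr x x = 0 := by
  have h : pr x x + pr x x = 0 := add_eq_zero_iff_eq_neg.mpr (pr_swap x x)
  have h2 : pr x x = (1 / 2 : ℝ) • (pr x x + pr x x) := by module
  rw [h2, h, smul_zero]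

lemma d_one : d 1 = 0 := by
  have := d_mul (A := A) (M := M) 1 1
  simpa using this

lemma d_natCast (n : ℕ) : d (n : A) = 0 := by
  rw [← nsmul_one, map_nsmul, d_one, smul_zero]

lemma d_ofNat (n : ℕ) [n.AtLeastTwo] : d (ofNat(n) : A) = 0 := d_natCast n

lemma right_swap (x y z : M) : pr x y • z = -(pr x z • y) := by
  rw [pr_smul, pr_swap y z, neg_smul, ← pr_smul]

lemma rot (x y z : M) : pr x y • z = pr z x • y := (pr_smul z x y).symm

/-- The pairing with `D⁵` is a 2-cocycle for the super Witt bracket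
`[c₁, c₂] = c₁ c₂' - c₁' c₂ + (1/2) (D c₁) (D c₂)`, where `' = D²`: the cyclic sum is an explicit
total derivative. This is the superanalogue of the Gelfand–Fuchs cocycle. -/
lemma cocycle (c₁ c₂ c₃ : A) :
    (2 * (c₁ * δ (d c₃) - c₃ * δ (d c₁)) - pr (d c₃) (d c₁)) • d (δ (d (δ (d c₂))))
    + (2 * (c₂ * δ (d c₁) - c₁ * δ (d c₂)) - pr (d c₁) (d c₂)) • d (δ (d (δ (d c₃))))
    + (2 * (c₃ * δ (d c₂) - c₂ * δ (d c₃)) - pr (d c₂) (d c₃)) • d (δ (d (δ (d c₁))))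
    = d (2 * (- (c₁ * δ (d c₂) * δ (d (δ (d c₃)))) - c₁ * pr (d (δ (d c₂))) (d (δ (d c₃)))
      + c₁ * δ (d (δ (d c₂))) * δ (d c₃) + δ (d c₁) * c₂ * δ (d (δ (d c₃)))
      - δ (d c₁) * δ (d (δ (d c₂))) * c₃ + c₂ * pr (d (δ (d c₁))) (d (δ (d c₃)))
      - c₃ * pr (d (δ (d c₁))) (d (δ (d c₂))) - δ (d (δ (d c₁))) * c₂ * δ (d c₃)
      + δ (d (δ (d c₁))) * δ (d c₂) * c₃)
      - δ (d (δ (d c₃))) * pr (d c₁) (d c₂) - δ (d c₂) * pr (d c₁) (d (δ (d c₃)))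
      + δ (d c₃) * pr (d c₁) (d (δ (d c₂))) + δ (d (δ (d c₂))) * pr (d c₁) (d c₃)
      + δ (d c₁) * pr (d c₂) (d (δ (d c₃))) + δ (d c₁) * pr (d (δ (d c₂))) (d c₃)
      + δ (d c₃) * pr (d (δ (d c₁))) (d c₂) - δ (d c₂) * pr (d (δ (d c₁))) (d c₃)
      - δ (d (δ (d c₁))) * pr (d c₂) (d c₃)) := by
  simp only [map_add, map_sub, map_neg, d_mul, d_pr, d_ofNat, smul_zero, add_zero]
  generalize d (δ (d (δ (d c₁)))) = z₁, d (δ (d (δ (d c₂)))) = z₂, d (δ (d (δ (d c₃)))) = z₃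
  generalize δ (d (δ (d c₁))) = v₁, δ (d (δ (d c₂))) = v₂, δ (d (δ (d c₃))) = v₃
  generalize d (δ (d c₁)) = y₁, d (δ (d c₂)) = y₂, d (δ (d c₃)) = y₃
  generalize δ (d c₁) = u₁, δ (d c₂) = u₂, δ (d c₃) = u₃
  generalize d c₁ = x₁, d c₂ = x₂, d c₃ = x₃
  simp only [pr_swap x₃ x₁, neg_smul, smul_neg, sub_smul, smul_add, smul_sub, mul_smul]
  -- The products `pr x y • z` of three odd elements are alternating; they are brought to one order.
  simp only [
    right_swap x₁ x₃ z₂, right_swap x₁ y₃ y₂, right_swap y₁ x₃ y₂, right_swap y₁ y₃ x₂,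
    rot x₂ x₃ z₁, rot x₂ y₃ y₁, rot y₂ x₃ y₁, rot y₂ y₃ x₁]
  module

lemma d_inv {φ ψ : A} (h : φ * ψ = 1) : d ψ = -(ψ ^ 2) • d φ := by
  have h1 := congrArg d h
  rw [d_mul, d_one] at h1
  linear_combination (norm := module) ψ • h1 - h • d ψ

lemma d_sq (a : A) : d (a ^ 2) = (2 * a) • d a := by
  rw [pow_two, d_mul]; module

lemma d_cube (a : A) : d (a ^ 3) = (3 * a ^ 2) • d a := by
  rw [pow_succ, d_mul, d_sq]; module

/-- `D⁵` is skew-symmetric on even elements, up to a total derivative. -/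
lemma quint_parts (a b : A) :
    a • d (δ (d (δ (d b)))) + b • d (δ (d (δ (d a)))) =
      d (a * δ (d (δ (d b))) - pr (d (δ (d b))) (d a) - δ (d a) * δ (d b)
        + pr (d b) (d (δ (d a))) + b * δ (d (δ (d a)))) := by
  simp only [map_add, map_sub, d_mul, d_pr]
  module

/-- `D³` is skew-symmetric on odd elements, up to a total derivative. -/
lemma cubic_parts (x y : M) :
    δ (d (δ y)) • x + δ (d (δ x)) • y =
      d (pr (d (δ y)) x + δ x * δ y + pr (d (δ x)) y) := by
  simp only [map_add, d_mul, d_pr]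
  module

section Symplectic

variable {φ ψ : A}

/-- The potentials that occur in the evaluation of `J V = U^{-3/2} q`, where `U = φ²`, `ψ = φ⁻¹` and
`a = D⁻¹ U^{-3/2} V`, `b = D⁻¹ U^{-1/2} a`, `p = D⁻¹ U D⁵ U b`, `q = D⁻¹ U^{-1/2} p`. They are
characterized by their derivatives, which avoids `D⁻¹`. -/
structure Chain (φ ψ V : A) (a : M) (b p : A) (q : M) : Prop where
  ha : δ a = ψ ^ 3 * V
  hb : d b = ψ • a
  hp : d p = φ ^ 2 • d (δ (d (δ (d (φ ^ 2 * b)))))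
  hq : δ q = ψ * p

/-- The equations obtained from those of `Chain` by varying `φ` by `w`, hence `U = φ²` by `2 φ w`,
at constant `V`; the variations of the potentials are `a'`, `b'`, `p'`, `q'`. -/
structure DotChain (φ ψ V : A) (a : M) (b p : A) (q : M) (w : A) (a' : M) (b' p' : A) (q' : M) :
    Prop where
  ha : δ a' = -(3 * ψ ^ 4 * w * V)
  hb : d b' = ψ • a' - (ψ ^ 2 * w) • a
  hp : d p' = (2 * φ * w) • d (δ (d (δ (d (φ ^ 2 * b)))))
    + φ ^ 2 • d (δ (d (δ (d (2 * φ * w * b + φ ^ 2 * b')))))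
  hq : δ q' = ψ * p' - ψ ^ 2 * w * p

/-- Integration by parts writes `⟨V₁, J V₂⟩` as `-⟨c₁, D⁵ c₂⟩`, where `cᵢ = U bᵢ`. -/
lemma Chain.pair {V₁ : A} {a₁ : M} {b₁ p₁ : A} {q₁ : M} (h₁ : Chain φ ψ V₁ a₁ b₁ p₁ q₁)
    {V₂ : A} {a₂ : M} {b₂ p₂ : A} {q₂ : M} (h₂ : Chain φ ψ V₂ a₂ b₂ p₂ q₂) :
    V₁ • ψ ^ 3 • q₂ = d (pr a₁ q₂ + b₁ * p₂)
      - (φ ^ 2 * b₁) • d (δ (d (δ (d (φ ^ 2 * b₂))))) := by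
  rw [map_add, d_pr, d_mul, h₁.ha, h₁.hb, h₂.hp, h₂.hq]
  module

lemma Chain.dot_pair {V₁ : A} {a₁ : M} {b₁ p₁ : A} {q₁ : M} (h₁ : Chain φ ψ V₁ a₁ b₁ p₁ q₁)
    {V₃ : A} {a₃ : M} {b₃ p₃ : A} {q₃ : M} (h₃ : Chain φ ψ V₃ a₃ b₃ p₃ q₃) {w₂ : A}
    {a₁₂ : M} {b₁₂ p₁₂ : A} {q₁₂ : M} (h₁₂ : DotChain φ ψ V₁ a₁ b₁ p₁ q₁ w₂ a₁₂ b₁₂ p₁₂ q₁₂)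
    {a₃₂ : M} {b₃₂ p₃₂ : A} {q₃₂ : M} (h₃₂ : DotChain φ ψ V₃ a₃ b₃ p₃ q₃ w₂ a₃₂ b₃₂ p₃₂ q₃₂) :
    V₁ • (ψ ^ 3 • q₃₂ - (3 * ψ ^ 4 * w₂) • q₃) =
      d (pr a₁ q₃₂ + pr a₁₂ q₃ + b₁ * p₃₂ + b₁₂ * p₃)
      - (2 * φ * w₂ * b₁ + φ ^ 2 * b₁₂) • d (δ (d (δ (d (φ ^ 2 * b₃)))))
      - (φ ^ 2 * b₁) • d (δ (d (δ (d (2 * φ * w₂ * b₃ + φ ^ 2 * b₃₂))))) := by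
  simp only [map_add d (_ + _) (_), map_add d (pr _ _), d_pr, d_mul b₁, d_mul b₁₂,
    h₁.ha, h₁.hb, h₃.hp, h₃.hq, h₁₂.ha, h₁₂.hb, h₃₂.hp, h₃₂.hq]
  module

end Symplectic

end Super

/-! ### Forms modulo total derivatives -/

namespace Super

variable {A M : Type*} [CommRing A] [Algebra ℝ A] [AddCommGroup M] [Module ℝ M]
    [Module A M] [IsScalarTower ℝ A M] [SuperDiff A M]

local notation "d" => SuperDiff.d (A := A) (M := M)
local notation "δ" => SuperDiff.δ (A := A) (M := M)
local notation "pr" => SuperDiff.pr (A := A) (M := M)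

open SuperDiff

section Symplectic

variable {φ ψ : A} (hφ : φ * ψ = 1)

include hφ in
/-- The variation of `a₁` along `V₃` and that of `a₃` along `V₁` agree up to a constant. -/
lemma dot_first_symm {V₁ V₃ w₁ w₃ : A} (hV₁ : V₁ = 2 * φ * w₁) (hV₃ : V₃ = 2 * φ * w₃)
    {a₁ a₃ a₁₃ a₃₁ : M} {b₁ b₃ p₁ p₃ b₁₃ b₃₁ p₁₃ p₃₁ : A} {q₁ q₃ q₁₃ q₃₁ : M}
    (h₁₃ : DotChain φ ψ V₁ a₁ b₁ p₁ q₁ w₃ a₁₃ b₁₃ p₁₃ q₁₃)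
    (h₃₁ : DotChain φ ψ V₃ a₃ b₃ p₃ q₃ w₁ a₃₁ b₃₁ p₃₁ q₃₁) : δ (a₁₃ - a₃₁) = 0 := by
  rw [map_sub, h₁₃.ha, h₃₁.ha, hV₁, hV₃]
  ring

include hφ in
lemma dot_second_symm {V₁ V₃ w₁ w₃ : A} (hV₁ : V₁ = 2 * φ * w₁) (hV₃ : V₃ = 2 * φ * w₃)
    {a₁ a₃ a₁₃ : M} {b₁ b₃ p₁ p₃ b₁₃ b₃₁ p₁₃ p₃₁ : A} {q₁ q₃ q₁₃ q₃₁ : M}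
    (h₁ : Chain φ ψ V₁ a₁ b₁ p₁ q₁) (h₃ : Chain φ ψ V₃ a₃ b₃ p₃ q₃)
    (h₁₃ : DotChain φ ψ V₁ a₁ b₁ p₁ q₁ w₃ a₁₃ b₁₃ p₁₃ q₁₃)
    (h₃₁ : DotChain φ ψ V₃ a₃ b₃ p₃ q₃ w₁ a₁₃ b₃₁ p₃₁ q₃₁) :
    d (2 * (b₁₃ - b₃₁) + pr a₃ a₁) = 0 := by
  simp only [map_add, map_sub, d_mul, d_ofNat, d_pr, h₁₃.hb, h₃₁.hb, h₁.ha, h₃.ha, hV₁, hV₃]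
  linear_combination (norm := module) (2 * ψ ^ 2) • hφ • (w₃ • a₁ - w₁ • a₃)

include hφ in
/-- The variation of `c₁ = U b₁` along `V₃` minus that of `c₃` along `V₁` is the super Witt bracket
of `c₁` and `c₃`. -/
lemma dot_bracket {V₁ V₃ w₁ w₃ : A} (hV₁ : V₁ = 2 * φ * w₁) (hV₃ : V₃ = 2 * φ * w₃)
    {a₁ a₃ : M} {b₁ b₃ p₁ p₃ b₁₃ b₃₁ : A} {q₁ q₃ : M}
    (h₁ : Chain φ ψ V₁ a₁ b₁ p₁ q₁) (h₃ : Chain φ ψ V₃ a₃ b₃ p₃ q₃)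
    (hb : 2 * (b₁₃ - b₃₁) + pr a₃ a₁ = 0) :
    2 * ((2 * φ * w₃ * b₁ + φ ^ 2 * b₁₃) - (2 * φ * w₁ * b₃ + φ ^ 2 * b₃₁)) =
      2 * ((φ ^ 2 * b₁) * δ (d (φ ^ 2 * b₃)) - (φ ^ 2 * b₃) * δ (d (φ ^ 2 * b₁)))
        - pr (d (φ ^ 2 * b₃)) (d (φ ^ 2 * b₁)) := by
  have e : ∀ {V w : A} {a : M} {b p : A} {q : M}, V = 2 * φ * w → Chain φ ψ V a b p q →
      a = φ • d b ∧ 2 * w = φ ^ 2 * (pr (d φ) (d b) + φ * δ (d b)) := by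
    intro V w a b p q hV h
    have h1 : a = φ • d b := by
      rw [h.hb]; linear_combination (norm := module) -hφ • a
    refine ⟨h1, ?_⟩
    have h2 := h.ha
    rw [h1, δ_smul, hV] at h2
    rw [h2]
    linear_combination (-(2 * w) * ((φ * ψ) ^ 2 + φ * ψ + 1)) * hφ
  obtain ⟨ha₁, hw₁⟩ := e hV₁ h₁
  obtain ⟨ha₃, hw₃⟩ := e hV₃ h₃
  rw [ha₁, ha₃] at hb
  simp only [map_smul, LinearMap.smul_apply, smul_eq_mul] at hb
  simp only [d_mul, d_sq, map_add, δ_smul, map_smul, LinearMap.add_apply, LinearMap.smul_apply,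
    smul_eq_mul, pr_self, d_ofNat, smul_zero]
  rw [pr_swap (d b₁) (d φ), pr_swap (d b₃) (d φ)]
  linear_combination (2 * φ * b₁) * hw₃ - (2 * φ * b₃) * hw₁ + φ ^ 2 * hb

end Symplectic

variable (A M) in
/-- A differential ideal, with even part `I` and odd part `J`. In the application it consists of the
elements with compact support. -/
structure DIdeal where
  /-- The even part. -/
  I : Ideal A
  /-- The odd part. -/
  J : Submodule A M
  d_mem : ∀ {a}, a ∈ I → d a ∈ J
  δ_mem : ∀ {x}, x ∈ J → δ x ∈ I
  pr_mem : ∀ {x} (y), x ∈ J → pr x y ∈ I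
  smul_mem : ∀ {a} (x : M), a ∈ I → a • x ∈ J

namespace DIdeal

variable (S : DIdeal A M)

lemma pr_mem' (x : M) {y : M} (h : y ∈ S.J) : pr x y ∈ S.I := by
  rw [pr_swap]; exact S.I.neg_mem (S.pr_mem x h)

/-- The derivatives of even elements of the ideal; their Berezin integrals vanish. -/
def total : Submodule ℝ M := (S.I.restrictScalars ℝ).map d

variable {S}

lemma d_mem_total {a : A} (h : a ∈ S.I) : d a ∈ S.total := ⟨a, h, rfl⟩

lemma mem_total_of_two_nsmul {x : M} (h : (2 : A) • x ∈ S.total) : x ∈ S.total := by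
  have := S.total.smul_mem (1 / 2 : ℝ) h
  convert this using 1
  rw [ofNat_smul_eq_nsmul]
  module

lemma smul_d_mem {a : A} (h : a ∈ S.I) (b : A) : b • d a + a • d b ∈ S.total := by
  have := d_mem_total (S.I.mul_mem_right b h)
  rw [d_mul] at this
  rwa [add_comm]

lemma δ_smul_mem {x : M} (h : x ∈ S.J) (y : M) : δ x • y - δ y • x ∈ S.total := by
  have := d_mem_total (S.pr_mem y h)
  rwa [d_pr] at this

lemma quint_mem {a : A} (h : a ∈ S.I) (b : A) :
    a • d (δ (d (δ (d b)))) + b • d (δ (d (δ (d a)))) ∈ S.total := by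
  rw [quint_parts]
  have h1 := S.d_mem h
  have h2 := S.δ_mem h1
  have h3 := S.d_mem h2
  have h4 := S.δ_mem h3
  have e1 := S.pr_mem' (d (δ (d b))) h1
  have e2 := S.pr_mem' (d b) h3
  apply d_mem_total
  rw [← Ideal.Quotient.eq_zero_iff_mem] at *
  simp [*]

lemma cubic_mem {x : M} (h : x ∈ S.J) (y : M) :
    δ (d (δ y)) • x + δ (d (δ x)) • y ∈ S.total := by
  rw [cubic_parts]
  have h1 := S.δ_mem h
  have h2 := S.d_mem h1
  exact d_mem_total (S.I.add_mem (S.I.add_mem (S.pr_mem' _ h) (S.I.mul_mem_right _ h1))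
    (S.pr_mem _ h2))

lemma cocycle_mem {c₁ c₂ c₃ : A} (h₁ : c₁ ∈ S.I) (h₂ : c₂ ∈ S.I) (h₃ : c₃ ∈ S.I) :
    (2 * (c₁ * δ (d c₃) - c₃ * δ (d c₁)) - pr (d c₃) (d c₁)) • d (δ (d (δ (d c₂))))
    + (2 * (c₂ * δ (d c₁) - c₁ * δ (d c₂)) - pr (d c₁) (d c₂)) • d (δ (d (δ (d c₃))))
    + (2 * (c₃ * δ (d c₂) - c₂ * δ (d c₃)) - pr (d c₂) (d c₃)) • d (δ (d (δ (d c₁))))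
      ∈ S.total := by
  rw [cocycle]
  have p₁ : ∀ y, pr (d c₁) y ∈ S.I := fun y => S.pr_mem y (S.d_mem h₁)
  have p₂ : ∀ y, pr (d c₂) y ∈ S.I := fun y => S.pr_mem y (S.d_mem h₂)
  have q₁ : ∀ y, pr (d (δ (d c₁))) y ∈ S.I := fun y => S.pr_mem y (S.d_mem (S.δ_mem (S.d_mem h₁)))
  have q₂ : ∀ y, pr (d (δ (d c₂))) y ∈ S.I := fun y => S.pr_mem y (S.d_mem (S.δ_mem (S.d_mem h₂)))
  have r₁ := S.δ_mem (S.d_mem h₁)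
  have r₂ := S.δ_mem (S.d_mem h₂)
  have r₃ := S.δ_mem (S.d_mem h₃)
  apply d_mem_total
  simp only [← Ideal.Quotient.eq_zero_iff_mem] at *
  simp [*]

section Symplectic

variable {φ ψ : A}

lemma chain_pair {V₁ : A} {a₁ : M} {b₁ p₁ : A} {q₁ : M} (h₁ : Chain φ ψ V₁ a₁ b₁ p₁ q₁)
    {V₂ : A} {a₂ : M} {b₂ p₂ : A} {q₂ : M} (h₂ : Chain φ ψ V₂ a₂ b₂ p₂ q₂)
    (h : a₁ ∈ S.J ∧ b₁ ∈ S.I ∨ p₂ ∈ S.I ∧ q₂ ∈ S.J) :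
    V₁ • ψ ^ 3 • q₂ + (φ ^ 2 * b₁) • d (δ (d (δ (d (φ ^ 2 * b₂))))) ∈ S.total := by
  rw [h₁.pair h₂, sub_add_cancel]
  apply d_mem_total
  rcases h with ⟨ha, hb⟩ | ⟨hp, hq⟩
  · exact S.I.add_mem (S.pr_mem _ ha) (S.I.mul_mem_right _ hb)
  · exact S.I.add_mem (S.pr_mem' _ hq) (S.I.mul_mem_left _ hp)

/-- Skew-symmetry of `J`. Only the potentials of `V₁` need to lie in the ideal. -/
lemma skew_mem {V₁ : A} {a₁ : M} {b₁ p₁ : A} {q₁ : M} (h₁ : Chain φ ψ V₁ a₁ b₁ p₁ q₁)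
    {V₂ : A} {a₂ : M} {b₂ p₂ : A} {q₂ : M} (h₂ : Chain φ ψ V₂ a₂ b₂ p₂ q₂)
    (ha : a₁ ∈ S.J) (hb : b₁ ∈ S.I) (hp : p₁ ∈ S.I) (hq : q₁ ∈ S.J) :
    V₁ • ψ ^ 3 • q₂ + V₂ • ψ ^ 3 • q₁ ∈ S.total := by
  have e1 := chain_pair h₁ h₂ (Or.inl ⟨ha, hb⟩)
  have e2 := chain_pair h₂ h₁ (Or.inr ⟨hp, hq⟩)
  have e3 := quint_mem (S.I.mul_mem_left (φ ^ 2) hb) (φ ^ 2 * b₂)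
  convert S.total.sub_mem (S.total.add_mem e1 e2) e3 using 1
  module

lemma dot_pair_mem {V₁ : A} {a₁ : M} {b₁ p₁ : A} {q₁ : M} (h₁ : Chain φ ψ V₁ a₁ b₁ p₁ q₁)
    {V₃ : A} {a₃ : M} {b₃ p₃ : A} {q₃ : M} (h₃ : Chain φ ψ V₃ a₃ b₃ p₃ q₃) {w₂ : A}
    {a₁₂ : M} {b₁₂ p₁₂ : A} {q₁₂ : M} (h₁₂ : DotChain φ ψ V₁ a₁ b₁ p₁ q₁ w₂ a₁₂ b₁₂ p₁₂ q₁₂)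
    {a₃₂ : M} {b₃₂ p₃₂ : A} {q₃₂ : M} (h₃₂ : DotChain φ ψ V₃ a₃ b₃ p₃ q₃ w₂ a₃₂ b₃₂ p₃₂ q₃₂)
    (ha : a₁ ∈ S.J) (hb : b₁ ∈ S.I) (hp : p₃ ∈ S.I) (hq : q₃ ∈ S.J) :
    V₁ • (ψ ^ 3 • q₃₂ - (3 * ψ ^ 4 * w₂) • q₃)
      + (2 * φ * w₂ * b₁ + φ ^ 2 * b₁₂) • d (δ (d (δ (d (φ ^ 2 * b₃)))))
      - (2 * φ * w₂ * b₃ + φ ^ 2 * b₃₂) • d (δ (d (δ (d (φ ^ 2 * b₁))))) ∈ S.total := by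
  have e := quint_mem (S.I.mul_mem_left (φ ^ 2) hb) (2 * φ * w₂ * b₃ + φ ^ 2 * b₃₂)
  have e2 : d (pr a₁ q₃₂ + pr a₁₂ q₃ + b₁ * p₃₂ + b₁₂ * p₃) ∈ S.total :=
    d_mem_total (S.I.add_mem (S.I.add_mem (S.I.add_mem (S.pr_mem _ ha) (S.pr_mem' _ hq))
      (S.I.mul_mem_right _ hb)) (S.I.mul_mem_left _ hp))
  convert S.total.sub_mem e2 e using 1
  rw [h₁.dot_pair h₃ h₁₂ h₃₂]
  module

end Symplectic

/-- Closedness of the 2-form `⟨c₁, D⁵ c₂⟩`, where `c_{ij}` is the variation of `cᵢ` along the `j`-th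
direction: the terms with `D⁵` combine into the Witt brackets, and the cocycle identity applies. -/
lemma closed_sum_mem {c₁ c₂ c₃ c₁₂ c₁₃ c₂₁ c₂₃ c₃₁ c₃₂ : A} {g₁ g₂ g₃ : M}
    (h₁ : c₁ ∈ S.I) (h₂ : c₂ ∈ S.I) (h₃ : c₃ ∈ S.I)
    (hg₁ : g₁ + c₁₂ • d (δ (d (δ (d c₃)))) - c₃₂ • d (δ (d (δ (d c₁)))) ∈ S.total)
    (hg₂ : g₂ + c₂₃ • d (δ (d (δ (d c₁)))) - c₁₃ • d (δ (d (δ (d c₂)))) ∈ S.total)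
    (hg₃ : g₃ + c₃₁ • d (δ (d (δ (d c₂)))) - c₂₁ • d (δ (d (δ (d c₃)))) ∈ S.total)
    (h₁₃ : 2 * (c₁₃ - c₃₁) = 2 * (c₁ * δ (d c₃) - c₃ * δ (d c₁)) - pr (d c₃) (d c₁))
    (h₂₁ : 2 * (c₂₁ - c₁₂) = 2 * (c₂ * δ (d c₁) - c₁ * δ (d c₂)) - pr (d c₁) (d c₂))
    (h₃₂ : 2 * (c₃₂ - c₂₃) = 2 * (c₃ * δ (d c₂) - c₂ * δ (d c₃)) - pr (d c₂) (d c₃)) :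
    g₁ + g₂ + g₃ ∈ S.total := by
  have h := cocycle_mem h₁ h₂ h₃
  rw [← h₁₃, ← h₂₁, ← h₃₂] at h
  have k := S.total.add_mem (S.total.add_mem hg₁ hg₂) hg₃
  apply mem_total_of_two_nsmul
  convert S.total.add_mem (S.total.add_mem k k) h using 1
  module

/-- The Jacobi identity for `P = U² D³ U²`, with `wᵢ = P αᵢ`. -/
lemma jacobi_cubic_mem {u : A} {α₁ α₂ α₃ : M} (h₁ : α₁ ∈ S.J) (h₂ : α₂ ∈ S.J) (h₃ : α₃ ∈ S.J)
    {w₁ w₂ w₃ : A} (e₁ : w₁ = u ^ 2 * δ (d (δ (u ^ 2 • α₁))))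
    (e₂ : w₂ = u ^ 2 * δ (d (δ (u ^ 2 • α₂)))) (e₃ : w₃ = u ^ 2 * δ (d (δ (u ^ 2 • α₃)))) :
    (2 * u * w₂ * δ (d (δ (u ^ 2 • α₃))) + u ^ 2 * δ (d (δ ((2 * u * w₂) • α₃)))) • α₁
    + (2 * u * w₃ * δ (d (δ (u ^ 2 • α₁))) + u ^ 2 * δ (d (δ ((2 * u * w₃) • α₁)))) • α₂
    + (2 * u * w₁ * δ (d (δ (u ^ 2 • α₂))) + u ^ 2 * δ (d (δ ((2 * u * w₁) • α₂)))) • α₃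
      ∈ S.total := by
  have k₁ := cubic_mem (S.J.smul_mem (u ^ 2) h₁) ((2 * u * w₂) • α₃)
  have k₂ := cubic_mem (S.J.smul_mem (u ^ 2) h₂) ((2 * u * w₃) • α₁)
  have k₃ := cubic_mem (S.J.smul_mem (u ^ 2) h₃) ((2 * u * w₁) • α₂)
  convert S.total.add_mem (S.total.add_mem k₁ k₂) k₃ using 1
  generalize δ (d (δ (u ^ 2 • α₁))) = A₁, δ (d (δ (u ^ 2 • α₂))) = A₂,
    δ (d (δ (u ^ 2 • α₃))) = A₃ at *
  subst e₁ e₂ e₃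
  module

/-- `∂ₓ = D²` is skew-symmetric up to a total derivative. -/
lemma parts_even {w : A} (h : w ∈ S.I) (x : M) : δ (d w) • x + w • d (δ x) ∈ S.total := by
  convert S.total.add_mem (δ_smul_mem (S.d_mem h) x) (smul_d_mem h (δ x)) using 1
  module

end DIdeal

section Variations

/-- A pair of maps acting on even and odd elements as an even derivation of the superalgebra that
commutes with `d` and `δ`: an infinitesimal variation of the field. -/
structure Variation (T : A →ₗ[ℝ] A) (T' : M →ₗ[ℝ] M) : Prop where
  mul : ∀ a b, T (a * b) = a * T b + b * T a
  smul : ∀ a x, T' (a • x) = a • T' x + T a • x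
  map_d : ∀ a, T' (d a) = d (T a)
  map_δ : ∀ x, T (δ x) = δ (T' x)

variable {T : A →ₗ[ℝ] A} {T' : M →ₗ[ℝ] M}

lemma Variation.map_one (hT : Variation T T') : T 1 = 0 := by simpa using hT.mul 1 1

lemma Variation.inv (hT : Variation T T') {φ ψ : A} (h : φ * ψ = 1) : T ψ = -(ψ ^ 2 * T φ) := by
  have h2 := congrArg T h
  rw [hT.mul, hT.map_one] at h2
  linear_combination ψ * h2 - T ψ * h

lemma Variation.sq (hT : Variation T T') (a : A) : T (a ^ 2) = 2 * a * T a := by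
  rw [pow_two, hT.mul]; ring

lemma Variation.cube (hT : Variation T T') (a : A) : T (a ^ 3) = 3 * a ^ 2 * T a := by
  rw [pow_succ, hT.mul, hT.sq]; ring

/-- Differentiating the chain of potentials of a constant `V`. -/
lemma Chain.dot {φ ψ V : A} {a : M} {b p : A} {q : M} (h : Chain φ ψ V a b p q)
    (hT : Variation T T') (hφ : φ * ψ = 1) (hV : T V = 0) :
    DotChain φ ψ V a b p q (T φ) (T' a) (T b) (T p) (T' q) where
  ha := by
    rw [← hT.map_δ, h.ha, hT.mul, hT.cube, hT.inv hφ, hV]; ring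
  hb := by
    rw [← hT.map_d, h.hb, hT.smul, hT.inv hφ]; module
  hp := by
    rw [← hT.map_d, h.hp, hT.smul, hT.sq, hT.map_d, hT.map_δ, hT.map_d, hT.map_δ, hT.map_d,
      hT.mul, hT.sq]
    simp only [map_add]
    rw [show b * (2 * φ * T φ) = 2 * φ * T φ * b by ring]
    module
  hq := by
    rw [← hT.map_δ, h.hq, hT.mul, hT.inv hφ]; ring

end Variations

/-- An endomorphism of the superalgebra that commutes with `d` and `δ`. -/
structure Endo (ρ : A →ₐ[ℝ] A) (ρ' : M →ₗ[ℝ] M) : Prop where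
  smul : ∀ a x, ρ' (a • x) = ρ a • ρ' x
  map_d : ∀ a, ρ' (d a) = d (ρ a)
  map_δ : ∀ x, ρ (δ x) = δ (ρ' x)

lemma DotChain.map {ρ : A →ₐ[ℝ] A} {ρ' : M →ₗ[ℝ] M} (hρ : Endo ρ ρ')
    {φ ψ V : A} {a : M} {b p : A} {q : M} {w : A} {a' : M} {b' p' : A} {q' : M}
    (h : DotChain φ ψ V a b p q w a' b' p' q') :
    DotChain (ρ φ) (ρ ψ) (ρ V) (ρ' a) (ρ b) (ρ p) (ρ' q) (ρ w) (ρ' a') (ρ b') (ρ p') (ρ' q') where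
  ha := by
    rw [← hρ.map_δ, h.ha]; simp only [map_neg, map_mul, map_pow, map_ofNat]
  hb := by
    rw [← hρ.map_d, h.hb]; simp only [map_sub, hρ.smul, map_mul, map_pow]
  hp := by
    rw [← hρ.map_d, h.hp]
    simp only [map_add, hρ.smul, map_mul, map_pow, hρ.map_d, hρ.map_δ, map_ofNat]
  hq := by
    rw [← hρ.map_δ, h.hq]; simp only [map_sub, map_mul, map_pow]

end Super

/-! ### The flow and the variations of the densities -/

namespace Super

variable {A M : Type*} [CommRing A] [Algebra ℝ A] [AddCommGroup M] [Module ℝ M]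
    [Module A M] [IsScalarTower ℝ A M] [SuperDiff A M]

local notation "d" => SuperDiff.d (A := A) (M := M)
local notation "δ" => SuperDiff.δ (A := A) (M := M)
local notation "pr" => SuperDiff.pr (A := A) (M := M)

open SuperDiff

section Flow

variable {φ ψ u r : A}

/-- The outer factors `U^{3/2} D U^{1/2} D` of `Q`. -/
lemma flow_outer (hu : u = φ ^ 2) (g : A) :
    2 * (φ ^ 3 * δ (φ • d g)) = 2 * u ^ 2 * δ (d g) + u * pr (d u) (d g) := by
  subst hu
  rw [d_sq, δ_smul]
  simp only [map_smul, LinearMap.smul_apply, smul_eq_mul]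
  ring

/-- The inner factors `U^{1/2} D U^{3/2}` of `Q`. -/
lemma flow_inner (hu : u = φ ^ 2) (E : M) :
    2 * (φ * δ (φ ^ 3 • E)) = 2 * u ^ 2 * δ E + 3 * u * pr (d u) E := by
  subst hu
  rw [d_sq, δ_smul, d_cube]
  simp only [map_smul, LinearMap.smul_apply, smul_eq_mul]
  ring

lemma pr_smul_left (x y : M) : pr x y • x = 0 := by
  rw [right_swap, pr_self, zero_smul, neg_zero]

lemma pr_smul_right (x y : M) : pr x y • y = 0 := by rw [pr_smul, pr_self, zero_smul]

/-- The derivatives `uₖ = ∂ₓᵏ u` and `xₖ = D uₖ`. -/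
structure Jet (u u₁ u₂ u₃ u₄ : A) (x₀ x₁ x₂ x₃ x₄ : M) : Prop where
  f0 : d u = x₀
  f1 : d u₁ = x₁
  f2 : d u₂ = x₂
  f3 : d u₃ = x₃
  f4 : d u₄ = x₄
  e0 : δ x₀ = u₁
  e1 : δ x₁ = u₂
  e2 : δ x₂ = u₃
  e3 : δ x₃ = u₄

variable {u₁ u₂ u₃ u₄ : A} {x₀ x₁ x₂ x₃ x₄ : M} (h : Jet u u₁ u₂ u₃ u₄ x₀ x₁ x₂ x₃ x₄)

include h

/-- With `c = g / 8` and `g = 2 u u₂ - u₁² + 2 (D u) (D u₁)`, the outer factors of `Q` map the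
potential `c` to the right-hand side of the equation. -/
lemma flow_potential :
    2 * u ^ 2 * δ (d (2 * u * u₂ - u₁ ^ 2 + 2 * pr x₀ x₁)) +
      u * pr x₀ (d (2 * u * u₂ - u₁ ^ 2 + 2 * pr x₀ x₁)) =
      2 * (2 * u ^ 3 * u₃ - 3 * u ^ 2 * pr x₂ x₀) := by
  simp only [map_add, map_sub, map_neg, map_zero, d_mul, d_sq, d_cube, d_pr, d_ofNat, smul_zero,
    zero_smul, δ_smul, map_smul, smul_eq_mul, pr_self, add_zero, zero_add, LinearMap.add_apply,
    LinearMap.sub_apply, LinearMap.neg_apply, LinearMap.zero_apply, LinearMap.smul_apply,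
    h.e0, h.e1, h.e2, h.e3, h.f0, h.f1, h.f2, h.f3, h.f4]
  rw [pr_swap x₂ x₀]
  ring

/-- `P` maps the variational derivative of the first Hamiltonian to the right-hand side of the
equation, up to the factor `8`. -/
lemma flow_cubic (hr : u * r = 1) :
    u ^ 2 * δ (d (δ (u ^ 2 • ((2 * r) • x₁ - (r ^ 2 * u₁) • x₀)))) =
      2 * (u₃ * u ^ 3) - 3 * (pr x₂ x₀ * u ^ 2) := by
  have e : u ^ 2 • ((2 * r) • x₁ - (r ^ 2 * u₁) • x₀) = (2 * u) • x₁ - u₁ • x₀ := by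
    linear_combination (norm := module) (2 * u) • hr • x₁ - (u * r + 1) • hr • u₁ • x₀
  rw [e]
  simp only [map_add, map_sub, map_neg, map_zero, d_mul, d_sq, d_cube, d_pr, d_ofNat, smul_zero,
    zero_smul, δ_smul, map_smul, smul_eq_mul, pr_self, add_zero, zero_add, LinearMap.add_apply,
    LinearMap.sub_apply, LinearMap.neg_apply, LinearMap.zero_apply, LinearMap.smul_apply,
    h.e0, h.e1, h.e2, h.e3, h.f0, h.f1, h.f2, h.f3, h.f4]
  rw [pr_swap x₂ x₀]
  ring

lemma flow_inner_explicit (hr : u * r = 1) (E : M)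
    (hE : E = (3 * r ^ 2 * u₁ ^ 3) • x₀ - (6 * r * u₁ * u₂) • x₀ - (6 * r * u₁ ^ 2) • x₁
      + (4 * u₃) • x₀ + (12 * u₂) • x₁ + (12 * u₁) • x₂ + (8 * u) • x₃) :
    2 * u ^ 2 * δ E + 3 * u * pr x₀ E =
      -(24 * u₁ ^ 2 * pr x₀ x₁) + 6 * u₁ ^ 4 + 48 * u * u₂ * pr x₀ x₁ + 48 * u * u₁ * pr x₀ x₂
      - 24 * u * u₁ ^ 2 * u₂ + 32 * u ^ 2 * pr x₀ x₃ + 24 * u ^ 2 * u₂ ^ 2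
      + 32 * u ^ 2 * u₁ * u₃ + 16 * u ^ 3 * u₄ := by
  have fr : d r = -(r ^ 2) • x₀ := by rw [d_inv hr, h.f0]
  subst hE
  simp only [map_add, map_sub, map_neg, map_zero, d_mul, d_sq, d_cube, d_pr, d_ofNat, smul_zero,
    zero_smul, δ_smul, map_smul, smul_eq_mul, pr_self, add_zero, zero_add, LinearMap.add_apply,
    LinearMap.sub_apply, LinearMap.neg_apply, LinearMap.zero_apply, LinearMap.smul_apply,
    h.e0, h.e1, h.e2, h.e3, h.f0, h.f1, h.f2, h.f3, h.f4, fr]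
  rw [pr_swap x₁ x₀, pr_swap x₂ x₀, pr_swap x₃ x₀, pr_swap x₂ x₁]
  linear_combination ((6 * u₁ ^ 4 - 6 * u₁ ^ 2 * pr x₀ x₁) * (u * r + 1)
    + u * (12 * u₂ * pr x₀ x₁ + 12 * u₁ * pr x₀ x₂ - 24 * u₁ ^ 2 * u₂)
    - 18 * u₁ ^ 2 * pr x₀ x₁) * hr

lemma flow_quint :
    δ (d (δ (d (u * (2 * u * u₂ - u₁ ^ 2 + 2 * pr x₀ x₁))))) =
      2 * u₂ * pr x₀ x₁ + 4 * u₁ * pr x₀ x₂ - u₁ ^ 2 * u₂ + 2 * u * pr x₀ x₃ + 2 * u * pr x₁ x₂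
      + 2 * u * u₂ ^ 2 + 6 * u * u₁ * u₃ + 2 * u ^ 2 * u₄ := by
  have h' : δ (d (u * (2 * u * u₂ - u₁ ^ 2 + 2 * pr x₀ x₁))) =
      2 * u₁ * pr x₀ x₁ - u₁ ^ 3 + 2 * u * pr x₀ x₂ + 2 * u * u₁ * u₂ + 2 * u ^ 2 * u₃ := by
    simp only [map_add, map_sub, map_neg, map_zero, d_mul, d_sq, d_cube, d_pr, d_ofNat, smul_zero,
      zero_smul, δ_smul, map_smul, smul_eq_mul, pr_self, add_zero, zero_add, LinearMap.add_apply,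
      LinearMap.sub_apply, LinearMap.neg_apply, LinearMap.zero_apply, LinearMap.smul_apply,
      h.e0, h.e1, h.e2, h.e3, h.f0, h.f1, h.f2, h.f3, h.f4]
    rw [pr_swap x₁ x₀, pr_swap x₂ x₀]
    ring
  rw [h']
  simp only [map_add, map_sub, map_neg, map_zero, d_mul, d_sq, d_cube, d_pr, d_ofNat, smul_zero,
    zero_smul, δ_smul, map_smul, smul_eq_mul, pr_self, add_zero, zero_add, LinearMap.add_apply,
    LinearMap.sub_apply, LinearMap.neg_apply, LinearMap.zero_apply, LinearMap.smul_apply,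
    h.e0, h.e1, h.e2, h.e3, h.f0, h.f1, h.f2, h.f3, h.f4]
  rw [pr_swap x₁ x₀, pr_swap x₂ x₀, pr_swap x₃ x₀, pr_swap x₂ x₁]
  ring

/-- Comparing `flow_inner_explicit` and `flow_quint`: the inner factors of `Q` map the variational
derivative of the second Hamiltonian to `D⁵ (u g)`, up to a numerical factor. -/
lemma flow_quint_eq :
    d (-(24 * u₁ ^ 2 * pr x₀ x₁) + 6 * u₁ ^ 4 + 48 * u * u₂ * pr x₀ x₁ + 48 * u * u₁ * pr x₀ x₂
      - 24 * u * u₁ ^ 2 * u₂ + 32 * u ^ 2 * pr x₀ x₃ + 24 * u ^ 2 * u₂ ^ 2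
      + 32 * u ^ 2 * u₁ * u₃ + 16 * u ^ 3 * u₄) =
    (8 * u) • d (2 * u₂ * pr x₀ x₁ + 4 * u₁ * pr x₀ x₂ - u₁ ^ 2 * u₂ + 2 * u * pr x₀ x₃
      + 2 * u * pr x₁ x₂ + 2 * u * u₂ ^ 2 + 6 * u * u₁ * u₃ + 2 * u ^ 2 * u₄) := by
  rw [show u₁ ^ 4 = u₁ ^ 2 * u₁ ^ 2 by ring]
  simp only [map_add, map_sub, map_neg, map_zero, d_mul, d_sq, d_cube, d_pr, d_ofNat, smul_zero,
    zero_smul, δ_smul, map_smul, smul_eq_mul, pr_self, add_zero, zero_add, LinearMap.add_apply,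
    LinearMap.sub_apply, LinearMap.neg_apply, LinearMap.zero_apply, LinearMap.smul_apply,
    h.e0, h.e1, h.e2, h.e3, h.f0, h.f1, h.f2, h.f3, h.f4]
  linear_combination (norm := module) (48 * u₂) • pr_smul_left (A := A) x₀ x₁
    - (48 * u₁) • pr_smul_right (A := A) x₀ x₁
    + (48 * u₁) • pr_smul_left (A := A) x₀ x₂ + (16 * u) • right_swap (A := A) x₀ x₂ x₁
    + (48 * u) • pr_smul_left (A := A) x₀ x₃ + (16 * u) • pr_smul (A := A) x₀ x₁ x₂

variable {S : DIdeal A M} {T : A →ₗ[ℝ] A} {T' : M →ₗ[ℝ] M} (hT : Variation T T')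

include hT

/-- The first variation of the density `u⁻¹ u₁ D u`. -/
lemma variation_density₁ (hr : u * r = 1) (hw : T u ∈ S.I) :
    T' ((r * u₁) • x₀) + T u • ((2 * r) • x₁ - (r ^ 2 * u₁) • x₀) ∈ S.total := by
  obtain ⟨w, hu⟩ : ∃ w, w = T u := ⟨_, rfl⟩
  rw [← hu] at hw ⊢
  have fr : d r = -(r ^ 2) • x₀ := by rw [d_inv hr, h.f0]
  have hr' : T r = -(r ^ 2 * w) := by rw [hu]; exact hT.inv hr
  have hx0 : T' x₀ = d w := by rw [← h.f0, hT.map_d, hu]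
  have hT1 : T u₁ = δ (d w) := by rw [← h.e0, hT.map_δ, hx0]
  have k1 := DIdeal.parts_even hw (r • x₀)
  have k2 := DIdeal.smul_d_mem (M := M) hw (r * u₁)
  convert S.total.add_mem k1 k2 using 1
  simp only [hT.smul, hT.mul, ← hu, hr', hx0, hT1, d_mul, δ_smul, map_add, map_smul,
    LinearMap.smul_apply, pr_self, fr, h.e0, h.f1, smul_zero, zero_add]
  module

/-- The first variation of the second density. The numerical factors `96` for the density and `32`
for its variational derivative make all coefficients integers. -/
lemma variation_density₂ (hr : u * r = 1) (hw : T u ∈ S.I) :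
    T' (-((6 * u₁ * u₁) • x₁) - (6 * u₂ * u₁) • x₀ + (8 * (u * u)) • x₃ + (12 * u₁ * u) • x₂
      + (12 * u₂ * u) • x₁ + (4 * u₃ * u) • x₀ + (3 * u₁ * u₁ * u₁ * r) • x₀)
    - T u • (3 : A) • ((3 * r ^ 2 * u₁ ^ 3) • x₀ - (6 * r * u₁ * u₂) • x₀ - (6 * r * u₁ ^ 2) • x₁
      + (4 * u₃) • x₀ + (12 * u₂) • x₁ + (12 * u₁) • x₂ + (8 * u) • x₃) ∈ S.total := by
  obtain ⟨w, hu⟩ : ∃ w, w = T u := ⟨_, rfl⟩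
  rw [← hu] at hw ⊢
  have fr : d r = -(r ^ 2) • x₀ := by rw [d_inv hr, h.f0]
  have hr' : T r = -(r ^ 2 * w) := by rw [hu]; exact hT.inv hr
  have hx0 : T' x₀ = d w := by rw [← h.f0, hT.map_d, hu]
  have hT1 : T u₁ = δ (d w) := by rw [← h.e0, hT.map_δ, hx0]
  have hx1 : T' x₁ = d (δ (d w)) := by rw [← h.f1, hT.map_d, hT1]
  have hT2 : T u₂ = δ (d (δ (d w))) := by rw [← h.e1, hT.map_δ, hx1]
  have hx2 : T' x₂ = d (δ (d (δ (d w)))) := by rw [← h.f2, hT.map_d, hT2]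
  have hT3 : T u₃ = δ (d (δ (d (δ (d w))))) := by rw [← h.e2, hT.map_δ, hx2]
  have hx3 : T' x₃ = d (δ (d (δ (d (δ (d w)))))) := by rw [← h.f3, hT.map_d, hT3]
  have hw1 := S.δ_mem (S.d_mem hw)
  have hw2 := S.δ_mem (S.d_mem hw1)
  have hw3 := S.δ_mem (S.d_mem hw2)
  -- `b0`, …, `b3` move one derivative off the variation `D ∂ₓᵏ w` in the terms with the factor
  -- `xₖ`, and `k1`, `k2`, `k3` move one `∂ₓ` off `∂ₓᵏ w` at a time until only `w` is left
  have b0 := DIdeal.smul_d_mem (M := M) hw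
    (-(6 * u₂ * u₁) + 4 * u₃ * u + 3 * u₁ * u₁ * u₁ * r)
  have b1 := DIdeal.smul_d_mem (M := M) hw1 (-(6 * u₁ * u₁) + 12 * u₂ * u)
  have b2 := DIdeal.smul_d_mem (M := M) hw2 (12 * u₁ * u)
  have b3 := DIdeal.smul_d_mem (M := M) hw3 (8 * (u * u))
  have k3 := DIdeal.parts_even hw2 (-((12 * u) • x₀))
  have k2 := DIdeal.parts_even hw1 (-((6 * u₁) • x₀) + (12 * u) • x₁)
  have k1 := DIdeal.parts_even hw ((9 * r * u₁ ^ 2) • x₀ - (12 * u₂) • x₀ - (6 * u₁) • x₁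
    - (12 * u) • x₂)
  have tT : ∀ n : ℕ, [n.AtLeastTwo] → T (ofNat(n) : A) = 0 := fun n _ => by
    have : (OfNat.ofNat n : A) = n • (1 : A) := (nsmul_one n).symm
    rw [this, map_nsmul, hT.map_one, smul_zero]
  simp only [map_add, map_sub, map_neg, map_zero, d_mul, d_sq, d_cube, d_pr, d_ofNat, smul_zero,
    zero_smul, δ_smul, map_smul, smul_eq_mul, pr_self, add_zero, zero_add, LinearMap.add_apply,
    LinearMap.sub_apply, LinearMap.neg_apply, LinearMap.zero_apply, LinearMap.smul_apply,
    h.e0, h.e1, h.e2, h.e3, h.f0, h.f1, h.f2, h.f3, h.f4, fr] at b0 b1 b2 b3 k1 k2 k3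
  simp only [hT.smul, hT.mul, ← hu, hr', hx0, hT1, hx1, hT2, hx2, hT3, hx3, map_add, map_sub,
    map_neg, tT, mul_zero, add_zero]
  convert S.total.add_mem (S.total.add_mem (S.total.add_mem (S.total.add_mem b0 b1)
    (S.total.add_mem b2 b3)) (S.total.add_mem k1 k2)) k3 using 1
  linear_combination (norm := module) (18 * w * u₁ * r ^ 2) • pr_smul_right (A := A) x₁ x₀
    - (18 * w * r) • pr_smul_left (A := A) x₁ x₀

end Flow

end Super

/-! ### The superderivative on a Grassmann algebra -/

/-- A commutative algebra with a derivation. -/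
class DiffAlg (K : Type*) [CommRing K] [Algebra ℝ K] where
  /-- The derivation. -/
  der : Derivation ℝ K K

namespace Gr

variable {K : Type*} [CommRing K] [Algebra ℝ K]

section SuperDerivation

variable [DiffAlg K]

/-- The function underlying `superD`. -/
def superDFun (F : Gr K) : Gr K :=
  fun S => if 0 ∈ S then DiffAlg.der (F (S.erase 0)) else F (insert 0 S)

/-- The superderivative `D = ∂_θ + θ ∂ₓ`, where `θ = η₀` and `∂ₓ` is the derivation of the
coefficients. -/
def superD : Gr K →ₗ[ℝ] Gr K where
  toFun := superDFun
  map_add' F G := by ext S; by_cases h : 0 ∈ S <;> simp [superDFun, h]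
  map_smul' c F := by ext S; by_cases h : 0 ∈ S <;> simp [superDFun, h]

lemma superD_apply (F : Gr K) (S : Finset ℕ) :
    superD F S = if 0 ∈ S then DiffAlg.der (F (S.erase 0)) else F (insert 0 S) := rfl

lemma superD_of_notMem (F : Gr K) {S : Finset ℕ} (h : 0 ∉ S) : superD F S = F (insert 0 S) := by
  simp [superD_apply, h]

lemma superD_insert (F : Gr K) {S : Finset ℕ} (h : 0 ∉ S) :
    superD F (insert 0 S) = DiffAlg.der (F S) := by
  simp [superD_apply, h]

lemma superD_superD (F : Gr K) (S : Finset ℕ) : superD (superD F) S = DiffAlg.der (F S) := by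
  by_cases h : 0 ∈ S
  · rw [← Finset.insert_erase h, superD_insert _ (Finset.notMem_erase _ _),
      superD_of_notMem _ (Finset.notMem_erase _ _)]
  · rw [superD_of_notMem _ h, superD_insert _ h]

lemma inversions_insert_left (T R : Finset ℕ) (h : 0 ∉ T) :
    inversions (insert 0 T) R = inversions T R := by
  rw [Finset.insert_eq, inversions_union_left (by simpa using h)]
  simp [inversions]

lemma inversions_insert_right (T R : Finset ℕ) (hT : 0 ∉ T) (hR : 0 ∉ R) :
    inversions T (insert 0 R) = T.card + inversions T R := by
  rw [Finset.insert_eq, inversions_union_right (by simpa using hR)]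
  congr 1
  have : (T ×ˢ ({0} : Finset ℕ)).filter (fun p => p.2 < p.1) = T ×ˢ {0} := by
    apply Finset.filter_true_of_mem
    rintro ⟨a, b⟩ hab
    simp only [Finset.mem_product, Finset.mem_singleton] at hab
    have : a ≠ 0 := fun h => hT (h ▸ hab.1)
    simp only [hab.2]; omega
  rw [inversions, this]; simp

/-- The Leibniz rule, for a left factor whose parity is that of `n`. -/
lemma superD_mul_sign {F : Gr K} (n : ℕ) (h : ∀ S, F S ≠ 0 → (Even S.card ↔ Even n)) (G : Gr K) :
    superD (F * G) = superD F * G + (-1) ^ n * (F * superD G) := by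
  have hn : ∀ m : ℕ, ∀ X : Gr K, ∀ S, ((-1) ^ m * X) S = (-1) ^ m * X S := by
    intro m X S
    rcases Nat.even_or_odd m with hm | hm <;> simp [hm.neg_one_pow]
  have hsgn : ∀ T, F T ≠ 0 → (-1 : K) ^ T.card = (-1) ^ n := by
    intro T hT
    have := h T hT
    rcases Nat.even_or_odd n with hn | hn
    · rw [hn.neg_one_pow, (this.mpr hn).neg_one_pow]
    · rw [hn.neg_one_pow, Odd.neg_one_pow]
      rw [← Nat.not_even_iff_odd] at hn ⊢
      tauto
  have hsq : ((-1 : K) ^ n) * (-1) ^ n = 1 := by rw [← pow_add, Even.neg_one_pow ⟨n, rfl⟩]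
  have ins : ∀ {S T : Finset ℕ}, 0 ∉ S → T ∈ S.powerset → 0 ∉ T ∧ 0 ∉ S \ T ∧
      insert 0 S \ T = insert 0 (S \ T) ∧ insert 0 S \ insert 0 T = S \ T := by
    intro S T hS hT
    rw [Finset.mem_powerset] at hT
    have h0 : 0 ∉ T := fun h => hS (hT h)
    refine ⟨h0, fun h => hS (Finset.sdiff_subset h), Finset.insert_sdiff_of_notMem _ h0, ?_⟩
    rw [Finset.insert_sdiff_insert, Finset.sdiff_insert_of_notMem hS]
  ext S
  rw [add_apply, hn]
  -- Subsets of `insert 0 R` come in pairs `T`, `insert 0 T`, without and with the variable `θ`.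
  by_cases h0 : 0 ∈ S
  · obtain ⟨R, hR, rfl⟩ : ∃ R, 0 ∉ R ∧ S = insert 0 R :=
      ⟨S.erase 0, Finset.notMem_erase _ _, (Finset.insert_erase h0).symm⟩
    rw [superD_insert _ hR, mul_apply, mul_apply, mul_apply, Finset.sum_powerset_insert hR,
      Finset.sum_powerset_insert hR, map_sum, mul_add, Finset.mul_sum, Finset.mul_sum,
      ← Finset.sum_add_distrib, ← Finset.sum_add_distrib, ← Finset.sum_add_distrib]
    refine Finset.sum_congr rfl fun T hT => ?_
    obtain ⟨k1, k2, k3, k4⟩ := ins hR hT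
    rw [k3, k4, superD_insert _ k1, superD_insert _ k2, superD_of_notMem _ k1,
      superD_of_notMem _ k2, inversions_insert_left _ _ k1, inversions_insert_right _ _ k1 k2,
      pow_add]
    have hd : ∀ m : ℕ, ∀ x : K, DiffAlg.der ((-1) ^ m * x) = (-1) ^ m * DiffAlg.der x := by
      intro m x
      rcases Nat.even_or_odd m with hm | hm <;> simp [hm.neg_one_pow]
    rw [mul_assoc, hd, Derivation.leibniz, smul_eq_mul, smul_eq_mul]
    have e1 : (-1 : K) ^ T.card * F T = (-1) ^ n * F T := by
      by_cases hF : F T = 0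
      · simp [hF]
      · rw [hsgn T hF]
    have e2 : (-1 : K) ^ T.card * F (insert 0 T) = -((-1) ^ n * F (insert 0 T)) := by
      by_cases hF : F (insert 0 T) = 0
      · simp [hF]
      · rw [← hsgn _ hF, Finset.card_insert_of_notMem k1, pow_succ]; ring
    linear_combination
      (-(-1) ^ inversions T (R \ T) * F T * DiffAlg.der (G (R \ T))) * hsq
      - (-1) ^ inversions T (R \ T) * G (insert 0 (R \ T)) * e2
      - (-1) ^ n * (-1) ^ inversions T (R \ T) * DiffAlg.der (G (R \ T)) * e1
  · rw [superD_of_notMem _ h0, mul_apply, mul_apply, mul_apply, Finset.sum_powerset_insert h0,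
      Finset.mul_sum, ← Finset.sum_add_distrib, ← Finset.sum_add_distrib]
    refine Finset.sum_congr rfl fun T hT => ?_
    obtain ⟨k1, k2, k3, k4⟩ := ins h0 hT
    rw [k3, k4, superD_of_notMem _ k1, superD_of_notMem _ k2, inversions_insert_left _ _ k1,
      inversions_insert_right _ _ k1 k2, pow_add]
    have e1 : (-1 : K) ^ T.card * F T = (-1) ^ n * F T := by
      by_cases hF : F T = 0
      · simp [hF]
      · rw [hsgn T hF]
    linear_combination (-1) ^ inversions T (S \ T) * G (insert 0 (S \ T)) * e1

lemma IsEven.superD_mul {F : Gr K} (h : IsEven F) (G : Gr K) :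
    superD (F * G) = superD F * G + F * superD G := by
  simpa using superD_mul_sign 0 (fun S hS => by
    simpa using Nat.not_odd_iff_even.mp (mt (h S) hS)) G

lemma IsOdd.superD_mul {F : Gr K} (h : IsOdd F) (G : Gr K) :
    superD (F * G) = superD F * G - F * superD G := by
  simpa [sub_eq_add_neg] using superD_mul_sign 1 (fun S hS => by
    simpa using Nat.not_even_iff_odd.mp (mt (h S) hS)) G

lemma IsEven.superD {F : Gr K} (h : IsEven F) : IsOdd (superD F) := fun S hS => by
  by_cases h0 : 0 ∈ S
  · rw [superD_apply, if_pos h0, h, map_zero]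
    rw [Finset.card_erase_of_mem h0]
    exact Nat.Even.sub_odd (Finset.card_pos.mpr ⟨0, h0⟩) hS odd_one
  · rw [superD_of_notMem _ h0, h]
    rw [Finset.card_insert_of_notMem h0]
    exact hS.add_one

lemma IsOdd.superD {F : Gr K} (h : IsOdd F) : IsEven (superD F) := fun S hS => by
  by_cases h0 : 0 ∈ S
  · rw [superD_apply, if_pos h0, h, map_zero]
    rw [Finset.card_erase_of_mem h0]
    exact Nat.Odd.sub_odd hS odd_one
  · rw [superD_of_notMem _ h0, h]
    rw [Finset.card_insert_of_notMem h0]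
    exact hS.add_one

instance : SuperDiff (Ev K) (Od K) where
  pr := LinearMap.mk₂ (Ev K) (fun x y => ⟨x * y, IsOdd.mul x.2 y.2⟩)
    (fun x y z => Subtype.ext (add_mul (x : Gr K) y z))
    (fun a x y => Subtype.ext (mul_assoc (a : Gr K) x y))
    (fun x y z => Subtype.ext (mul_add (x : Gr K) y z))
    (fun a x y => Subtype.ext (by
      change (x : Gr K) * (a * y) = a * (x * y)
      rw [← mul_assoc, ← a.2.mul_comm (x : Gr K), mul_assoc]))
  pr_swap x y := Subtype.ext (IsOdd.mul_comm x.2 y.2)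
  pr_smul x y z := Subtype.ext (by
    change (x : Gr K) * y * z = y * z * x
    rw [mul_assoc, ← (IsOdd.mul y.2 z.2).mul_comm])
  d := { toFun := fun a => ⟨superD a, IsEven.superD a.2⟩
         map_add' := fun a b => Subtype.ext (map_add superD (a : Gr K) b)
         map_smul' := fun c a => Subtype.ext (map_smul superD c (a : Gr K)) }
  δ := { toFun := fun a => ⟨superD a, IsOdd.superD a.2⟩
         map_add' := fun a b => Subtype.ext (map_add superD (a : Gr K) b)
         map_smul' := fun c a => Subtype.ext (map_smul superD c (a : Gr K)) }
  d_mul a b := Subtype.ext (by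
    change superD ((a : Gr K) * (b : Gr K)) =
      (a : Gr K) * superD (b : Gr K) + (b : Gr K) * superD (a : Gr K)
    rw [IsEven.superD_mul a.2, ← b.2.mul_comm, add_comm])
  δ_smul a x := Subtype.ext (IsEven.superD_mul a.2 x)
  d_pr x y := Subtype.ext (by
    change superD ((x : Gr K) * (y : Gr K)) =
      superD (x : Gr K) * (y : Gr K) - superD (y : Gr K) * (x : Gr K)
    rw [IsOdd.superD_mul x.2, (IsOdd.superD y.2).mul_comm])

@[simp] lemma coe_pr (x y : Od K) : (SuperDiff.pr x y : Ev K) = (x * y : Gr K) := rfl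
@[simp] lemma coe_d (a : Ev K) : ((SuperDiff.d a : Od K) : Gr K) = superD a := rfl
@[simp] lemma coe_δ (x : Od K) : ((SuperDiff.δ x : Ev K) : Gr K) = superD x := rfl

end SuperDerivation

end Gr

/-! ### Real powers -/

/-- The binomial coefficient with real upper argument. -/
def binom (s : ℝ) (k : ℕ) : ℝ := (∏ i ∈ Finset.range k, (s - i)) / (k.factorial : ℝ)

@[simp] lemma binom_zero_right (s : ℝ) : binom s 0 = 1 := by simp [binom]

lemma binom_eq_choose (s : ℝ) (k : ℕ) : binom s k = Ring.choose s k := by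
  have h : ∀ k : ℕ, (descPochhammer ℤ k).smeval s = ∏ i ∈ Finset.range k, (s - i) := by
    intro k
    induction k with
    | zero => simp
    | succ k ih =>
      rw [descPochhammer_succ_right, Polynomial.smeval_mul, ih, Finset.prod_range_succ,
        Polynomial.smeval_sub, Polynomial.smeval_X, pow_one, Polynomial.smeval_natCast]
      simp
  rw [Ring.choose_eq_smul, h, binom, smul_eq_mul, div_eq_inv_mul]

lemma binom_add (s t : ℝ) (n : ℕ) :
    binom (s + t) n = ∑ k ∈ Finset.range (n + 1), binom s k * binom t (n - k) := by
  simp only [binom_eq_choose]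
  rw [Ring.add_choose_eq n (Commute.all s t), Finset.Nat.sum_antidiagonal_eq_sum_range_succ_mk]

lemma binom_zero_succ (k : ℕ) : binom 0 (k + 1) = 0 := by
  rw [binom, Finset.prod_eq_zero (i := 0) (by simp) (by simp), zero_div]

lemma binom_one_succ_succ (k : ℕ) : binom 1 (k + 2) = 0 := by
  rw [binom, Finset.prod_eq_zero (i := 1) (by simp) (by simp), zero_div]

lemma binom_one_one : binom 1 1 = 1 := by simp [binom]

namespace Gr

variable {K : Type*} [CommRing K] [Algebra ℝ K]

instance : IsScalarTower ℝ K (Gr K) := ⟨fun c a F => by ext S; simp⟩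

instance : SMulCommClass K ℝ (Gr K) := ⟨fun a c F => by ext S; simp⟩

/-- The soul, the part without constant term. -/
def soulPart (F : Gr K) : Gr K := fun S => if S = ∅ then 0 else F S

lemma soulPart_empty (F : Gr K) : soulPart F ∅ = 0 := by simp [soulPart]

lemma pow_apply_eq_zero {N : Gr K} (hN : N ∅ = 0) (k : ℕ) :
    ∀ S : Finset ℕ, S.card < k → (N ^ k) S = 0 := by
  induction k with
  | zero => simp
  | succ k ih =>
    intro S hS
    rw [pow_succ, mul_apply]
    refine Finset.sum_eq_zero fun T hT => ?_
    rw [Finset.mem_powerset] at hT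
    by_cases h : T.card < k
    · simp [ih T h]
    · have : S \ T = ∅ := by
        rw [← Finset.card_eq_zero, Finset.card_sdiff_of_subset hT]; omega
      simp [this, hN]

/-- The real power by Taylor expansion in the soul `N`, given the powers `π s` of the body. Since
`N ^ k` has no coefficients at sets with fewer than `k` elements, each coefficient is a finite
sum. -/
def taylorPow (π : ℝ → K) (N : Gr K) (s : ℝ) : Gr K := fun S =>
  ∑ k ∈ Finset.range (S.card + 1), (binom s k • π (s - k)) * (N ^ k) S

/-- The Taylor expansion truncated after `n` terms; it agrees with `taylorPow` in the coefficients
at sets with fewer than `n` elements. -/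
def taylorTrunc (π : ℝ → K) (N : Gr K) (n : ℕ) (s : ℝ) : Gr K :=
  ∑ k ∈ Finset.range n, (binom s k • π (s - k)) • N ^ k

variable {π : ℝ → K} {N : Gr K}

lemma taylorPow_eq_trunc (hN : N ∅ = 0) (s : ℝ) {n : ℕ} {S : Finset ℕ} (h : S.card < n) :
    taylorPow π N s S = taylorTrunc π N n s S := by
  rw [taylorPow, taylorTrunc, sum_apply]
  simp only [smul_apply, smul_eq_mul]
  refine Finset.sum_subset (fun k hk => ?_) (fun k _ hk => ?_)
  · simp only [Finset.mem_range] at hk ⊢; omega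
  · rw [pow_apply_eq_zero hN k S (by simpa using hk), mul_zero]

lemma mul_congr {F F' G G' : Gr K} {S : Finset ℕ} (hF : ∀ T, T.card ≤ S.card → F T = F' T)
    (hG : ∀ T, T.card ≤ S.card → G T = G' T) : (F * G) S = (F' * G') S := by
  rw [mul_apply, mul_apply]
  refine Finset.sum_congr rfl fun T hT => ?_
  rw [Finset.mem_powerset] at hT
  rw [hF T (Finset.card_le_card hT), hG _ (Finset.card_le_card Finset.sdiff_subset)]

/-- Multiplicativity of powers is the Chu–Vandermonde identity `binom_add`. -/
lemma taylorPow_add (hN : N ∅ = 0) (hπ : ∀ s t, π (s + t) = π s * π t) (s t : ℝ) :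
    taylorPow π N (s + t) = taylorPow π N s * taylorPow π N t := by
  ext S
  rw [mul_congr (F' := taylorTrunc π N (S.card + 1) s) (G' := taylorTrunc π N (S.card + 1) t)
    (fun T hT => taylorPow_eq_trunc hN s (by omega))
    (fun T hT => taylorPow_eq_trunc hN t (by omega))]
  rw [taylorTrunc, taylorTrunc, Finset.sum_mul_sum, taylorPow]
  simp only [smul_mul_smul_comm, ← pow_add, sum_apply, smul_apply, smul_eq_mul]
  have e : ∀ k ∈ Finset.range (S.card + 1),
      ∑ l ∈ Finset.range (S.card + 1),
        (binom s k * binom t l) • (π (s - k) * π (t - l)) * (N ^ (k + l)) S =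
      ∑ l ∈ Finset.range (S.card + 1 - k),
        (binom s k * binom t l) • (π (s - k) * π (t - l)) * (N ^ (k + l)) S := by
    intro k _
    symm
    refine Finset.sum_subset (fun l hl => ?_) (fun l _ hl => ?_)
    · simp only [Finset.mem_range] at hl ⊢; omega
    · rw [pow_apply_eq_zero hN (k + l) S (by simp at hl; omega), mul_zero]
  rw [Finset.sum_congr rfl e, ← Finset.sum_range_diag_flip (S.card + 1)
    (fun k l => (binom s k * binom t l) • (π (s - k) * π (t - l)) * (N ^ (k + l)) S)]
  refine Finset.sum_congr rfl fun m _ => ?_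
  rw [binom_add, Finset.sum_smul, Finset.sum_mul]
  refine Finset.sum_congr rfl fun k hk => ?_
  have hk' : k ≤ m := by simpa [Nat.lt_succ_iff] using hk
  rw [Nat.add_sub_cancel' hk', ← hπ]
  congr 3
  push_cast [Nat.cast_sub hk']
  ring

lemma taylorPow_zero (hπ : π 0 = 1) : taylorPow π N 0 = 1 := by
  ext S
  rw [taylorPow, Finset.sum_range_succ']
  simp [binom_zero_succ, hπ]

lemma taylorPow_one {F : Gr K} (h0 : π 0 = 1) (h1 : π 1 = F ∅) :
    taylorPow π (soulPart F) 1 = F := by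
  ext S
  rw [taylorPow_eq_trunc (n := S.card + 2) (soulPart_empty F) 1 (by omega), taylorTrunc,
    Finset.sum_range_succ', Finset.sum_range_succ']
  simp [binom_one_succ_succ, binom_one_one, h0, h1, soulPart, one_apply]
  by_cases h : S = ∅ <;> simp [h]

lemma IsEven.pow {F : Gr K} (h : IsEven F) (k : ℕ) : IsEven (F ^ k) := (Ev K).pow_mem h k

lemma IsEven.soulPart {F : Gr K} (h : IsEven F) : IsEven (soulPart F) := fun S hS => by
  rw [Gr.soulPart, h S hS, ite_self]

lemma IsEven.taylorPow (hN : IsEven N) (s : ℝ) : IsEven (taylorPow π N s) := fun S hS =>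
  Finset.sum_eq_zero fun k _ => by rw [hN.pow k S hS, mul_zero]

end Gr

/-! ### Smooth functions with a parameter -/

section

open MeasureTheory Set

/-- The smooth functions of two variables. -/
def smoothFamilies : Subalgebra ℝ (ℝ × ℝ → ℝ) where
  carrier := {f | ContDiff ℝ ∞ f}
  mul_mem' := fun {f g} (hf : ContDiff ℝ ∞ f) (hg : ContDiff ℝ ∞ g) => hf.mul hg
  add_mem' := fun {f g} (hf : ContDiff ℝ ∞ f) (hg : ContDiff ℝ ∞ g) => hf.add hg
  algebraMap_mem' := fun r => (contDiff_const : ContDiff ℝ ∞ fun _ : ℝ × ℝ => r)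

/-- The algebra of smooth functions `f (ε, x)`, regarded as families of functions of `x` with
parameter `ε`. -/
def Sm : Type := smoothFamilies

instance : CommRing Sm := inferInstanceAs (CommRing smoothFamilies)
instance : Algebra ℝ Sm := inferInstanceAs (Algebra ℝ smoothFamilies)

namespace Sm

/-- The underlying function. -/
def toFun (f : Sm) : ℝ × ℝ → ℝ := f.1

instance : CoeFun Sm (fun _ => ℝ × ℝ → ℝ) := ⟨toFun⟩

lemma contDiff (f : Sm) : ContDiff ℝ ∞ f := f.2

lemma differentiable (f : Sm) : Differentiable ℝ f := f.contDiff.differentiable (by simp)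

@[ext] lemma ext {f g : Sm} (h : ∀ p, f p = g p) : f = g := Subtype.ext (funext h)

@[simp] lemma add_apply (f g : Sm) (p : ℝ × ℝ) : (f + g) p = f p + g p := rfl
@[simp] lemma mul_apply (f g : Sm) (p : ℝ × ℝ) : (f * g) p = f p * g p := rfl
@[simp] lemma zero_apply (p : ℝ × ℝ) : (0 : Sm) p = 0 := rfl
@[simp] lemma one_apply (p : ℝ × ℝ) : (1 : Sm) p = 1 := rfl
@[simp] lemma neg_apply (f : Sm) (p : ℝ × ℝ) : (-f) p = -f p := rfl
@[simp] lemma smul_apply (c : ℝ) (f : Sm) (p : ℝ × ℝ) : (c • f) p = c * f p := rfl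
@[simp] lemma pow_apply (f : Sm) (n : ℕ) (p : ℝ × ℝ) : (f ^ n) p = f p ^ n := rfl
@[simp] lemma sum_apply {ι : Type*} (s : Finset ι) (f : ι → Sm) (p : ℝ × ℝ) :
    (∑ i ∈ s, f i) p = ∑ i ∈ s, f i p := by
  induction s using Finset.cons_induction with
  | empty => simp
  | cons a s ha ih => rw [Finset.sum_cons, Finset.sum_cons, add_apply, ih]

/-- The derivative in the direction `v`. -/
def dirDeriv (v : ℝ × ℝ) : Derivation ℝ Sm Sm :=
  Derivation.mk'
    { toFun := fun f => ⟨fun p => fderiv ℝ f p v,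
        ((f.contDiff.fderiv_right (m := ∞) (by simp)).clm_apply contDiff_const)⟩
      map_add' := fun f g => by
        ext p
        change fderiv ℝ (fun q => f q + g q) p v = fderiv ℝ f p v + fderiv ℝ g p v
        rw [fderiv_fun_add (f.differentiable p) (g.differentiable p)]; rfl
      map_smul' := fun c f => by
        ext p
        change fderiv ℝ (fun q => c • f q) p v = c • fderiv ℝ f p v
        rw [fderiv_fun_const_smul (f.differentiable p)]; rfl }
    (fun f g => by
      ext p
      change fderiv ℝ (fun q => f q * g q) p v = f p * fderiv ℝ g p v + g p * fderiv ℝ f p v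
      rw [fderiv_fun_mul (f.differentiable p) (g.differentiable p)]; rfl)

lemma dirDeriv_apply (v : ℝ × ℝ) (f : Sm) (p : ℝ × ℝ) : dirDeriv v f p = fderiv ℝ f p v := rfl

lemma dirDeriv_comm (v w : ℝ × ℝ) (f : Sm) :
    dirDeriv v (dirDeriv w f) = dirDeriv w (dirDeriv v f) := by
  ext p
  have key : ∀ v w : ℝ × ℝ, dirDeriv v (dirDeriv w f) p = fderiv ℝ (fderiv ℝ f) p v w := by
    intro v w
    change fderiv ℝ (fun q => fderiv ℝ f q w) p v = _
    have h : DifferentiableAt ℝ (fderiv ℝ f) p :=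
      ((f.contDiff.fderiv_right (m := ∞) (by simp)).differentiable (by simp)) p
    rw [fderiv_clm_apply h (differentiableAt_const w)]
    simp
  rw [key, key]
  exact (f.contDiff.contDiffAt.isSymmSndFDerivAt (by
    simp only [minSmoothness_of_isRCLikeNormedField]
    exact (mod_cast le_top : ((2 : ℕ∞) : WithTop ℕ∞) ≤ ((⊤ : ℕ∞) : WithTop ℕ∞)))) v w

instance : DiffAlg Sm := ⟨dirDeriv (0, 1)⟩

lemma der_apply (f : Sm) (p : ℝ × ℝ) : DiffAlg.der f p = fderiv ℝ f p (0, 1) := rfl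

lemma hasDerivAt_snd (f : Sm) (ε x : ℝ) :
    HasDerivAt (fun t => f (ε, t)) (DiffAlg.der f (ε, x)) x :=
  (f.differentiable (ε, x)).hasFDerivAt.comp_hasDerivAt x
    ((hasDerivAt_const x ε).prodMk (hasDerivAt_id x))

lemma hasDerivAt_fst (f : Sm) (ε x : ℝ) :
    HasDerivAt (fun t => f (t, x)) (dirDeriv (1, 0) f (ε, x)) ε :=
  (f.differentiable (ε, x)).hasFDerivAt.comp_hasDerivAt ε
    ((hasDerivAt_id ε).prodMk (hasDerivAt_const ε x))

lemma continuous_snd (f : Sm) (ε : ℝ) : Continuous (fun t => f (ε, t)) :=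
  f.contDiff.continuous.comp (by fun_prop)

/-- The integral over `(-∞, x]`. -/
def primFun (f : Sm) (p : ℝ × ℝ) : ℝ := ∫ t in Iic p.2, f (p.1, t)

lemma integrableOn_Iic {f : Sm} {r : ℝ} (hf : ∀ p : ℝ × ℝ, p.2 < r → f p = 0) (ε x : ℝ) :
    IntegrableOn (fun t => f (ε, t)) (Iic x) := by
  have h1 : IntegrableOn (fun t => f (ε, t)) (Icc r x) :=
    (f.continuous_snd ε).integrableOn_Icc
  refine h1.of_forall_sdiff_eq_zero measurableSet_Iic ?_
  intro t ht
  simp only [mem_sdiff, mem_Iic, mem_Icc, not_and, not_le] at ht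
  exact hf _ (by by_contra h; exact absurd ht.1 (not_le.mpr (ht.2 (not_lt.mp h))))

/-- Locally the integral is the convolution of a cutoff of `f` with the indicator function of the
half line, so that it depends smoothly on both variables. -/
lemma contDiff_primFun {f : Sm} {r : ℝ} (hf : ∀ p : ℝ × ℝ, p.2 < r → f p = 0) :
    ContDiff ℝ ∞ f.primFun := by
  rw [contDiff_iff_contDiffAt]
  rintro ⟨ε₀, x₀⟩
  -- For `x < x₀ + 1` only the values of `f` on `[r, x]` matter, where the cutoff `η` equals `1`.
  let η : ContDiffBump (0 : ℝ) := ⟨|r| + |x₀| + 2, |r| + |x₀| + 3, by positivity, by linarith⟩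
  have hη : ∀ y, |y| ≤ |r| + |x₀| + 2 → η y = 1 := fun y hy =>
    η.one_of_mem_closedBall (by simpa [Metric.mem_closedBall] using hy)
  have key := contDiffOn_convolution_right_with_param (𝕜 := ℝ) (μ := volume) (n := ⊤)
    (f := (Ici (0 : ℝ)).indicator (fun _ => (1 : ℝ)))
    (ContinuousLinearMap.mul ℝ ℝ) (g := fun (ε : ℝ) (y : ℝ) => η y * f (ε, y))
    (s := univ) (k := Metric.closedBall 0 (|r| + |x₀| + 3)) isOpen_univ
    (isCompact_closedBall _ _)
    (fun p x _ hx => by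
      have : η x = 0 := η.zero_of_le_dist (by
        rw [Metric.mem_closedBall] at hx; exact le_of_lt (not_le.mp hx))
      simp [this])
    ((locallyIntegrable_const 1).indicator measurableSet_Ici)
    (by
      apply ContDiff.contDiffOn
      change ContDiff ℝ _ (fun p : ℝ × ℝ => η p.2 * f (p.1, p.2))
      exact ((η.contDiff (n := ⊤)).comp contDiff_snd).mul f.contDiff)
  rw [univ_prod_univ, contDiffOn_univ] at key
  refine (key.contDiffAt (x := (ε₀, x₀))).congr_of_eventuallyEq ?_
  have hnhds : {p : ℝ × ℝ | p.2 < x₀ + 1} ∈ nhds (ε₀, x₀) :=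
    (isOpen_lt _root_.continuous_snd continuous_const).mem_nhds (by simp)
  filter_upwards [hnhds] with p hp
  rw [convolution_def, primFun, ← integral_indicator measurableSet_Iic,
    ← integral_sub_left_eq_self _ volume p.2]
  refine integral_congr_ae (Filter.Eventually.of_forall fun t => ?_)
  simp only [ContinuousLinearMap.mul_apply']
  by_cases ht : 0 ≤ t
  · rw [indicator_of_mem (show p.2 - t ∈ Iic p.2 by simpa using ht),
      indicator_of_mem (show t ∈ Ici (0 : ℝ) from ht), one_mul]
    by_cases hr : p.2 - t < r
    · rw [hf (p.1, p.2 - t) hr, mul_zero]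
    · rw [hη, one_mul]
      have hp' : p.2 < x₀ + 1 := hp
      rw [abs_le]
      constructor
      · linarith [neg_abs_le r, abs_nonneg x₀]
      · linarith [le_abs_self x₀, abs_nonneg r]
  · rw [indicator_of_notMem (show p.2 - t ∉ Iic p.2 by simpa using ht),
      indicator_of_notMem (show t ∉ Ici (0 : ℝ) from ht), zero_mul]

/-- The function vanishes for `x < r`. -/
def LeftZero (f : Sm) (r : ℝ) : Prop := ∀ p : ℝ × ℝ, p.2 < r → f p = 0

open Classical in
/-- The antiderivative with respect to `x` that vanishes near `-∞`, for functions that vanish near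
`-∞` uniformly in the parameter; the value is `0` where the integral is not smooth. -/
def prim (f : Sm) : Sm := if h : ContDiff ℝ ∞ f.primFun then ⟨f.primFun, h⟩ else 0

lemma prim_apply {f : Sm} {r : ℝ} (hf : f.LeftZero r) (p : ℝ × ℝ) :
    f.prim p = ∫ t in Iic p.2, f (p.1, t) := by
  have : f.prim = (⟨f.primFun, contDiff_primFun hf⟩ : smoothFamilies) :=
    dif_pos (contDiff_primFun hf)
  rw [this]; rfl

lemma prim_zero : (0 : Sm).prim = 0 := by
  ext p
  rw [prim_apply (r := 0) (fun _ _ => rfl)]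
  simp

lemma LeftZero.prim {f : Sm} {r : ℝ} (hf : f.LeftZero r) : f.prim.LeftZero r := by
  intro p hp
  rw [prim_apply hf]
  apply setIntegral_eq_zero_of_forall_eq_zero
  intro t ht
  exact hf _ (lt_of_le_of_lt ht hp)

lemma LeftZero.dirDeriv {f : Sm} {r : ℝ} (hf : f.LeftZero r) (v : ℝ × ℝ) :
    (dirDeriv v f).LeftZero r := by
  intro p hp
  have h : (f : ℝ × ℝ → ℝ) =ᶠ[nhds p] fun _ => 0 := by
    filter_upwards [(isOpen_lt _root_.continuous_snd continuous_const).mem_nhds hp] with q hq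
    exact hf q hq
  rw [dirDeriv_apply, h.fderiv_eq]
  simp

lemma der_prim {f : Sm} {r : ℝ} (hf : f.LeftZero r) : DiffAlg.der f.prim = f := by
  ext ⟨ε, x⟩
  have h1 := f.prim.hasDerivAt_snd ε x
  have h2 : HasDerivAt (fun t => f.prim (ε, t)) (f (ε, x)) x := by
    have h3 : (fun t => f.prim (ε, t)) = fun t => ∫ y in (r - 1)..t, f (ε, y) := by
      funext t
      have h0 : f.prim (ε, r - 1) = 0 := hf.prim _ (by simp)
      rw [prim_apply hf] at h0 ⊢
      rw [← intervalIntegral.integral_Iic_sub_Iic (integrableOn_Iic hf ε (r - 1))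
        (integrableOn_Iic hf ε t)]
      simp only at h0
      rw [h0, sub_zero]
    rw [h3]
    exact intervalIntegral.integral_hasDerivAt_right
      ((f.continuous_snd ε).intervalIntegrable _ _)
      ((f.continuous_snd ε).stronglyMeasurableAtFilter _ _) (f.continuous_snd ε).continuousAt
  exact h1.unique h2

lemma eq_zero_of_der_eq_zero {f : Sm} {r : ℝ} (hf : f.LeftZero r) (h : DiffAlg.der f = 0) :
    f = 0 := by
  ext ⟨ε, x⟩
  have h1 : ∀ t, HasDerivAt (fun t => f (ε, t)) 0 t := fun t => by
    have := f.hasDerivAt_snd ε t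
    rwa [h] at this
  have h2 := is_const_of_deriv_eq_zero (fun t => (h1 t).differentiableAt) (fun t => (h1 t).deriv) x
    (min x (r - 1))
  rw [h2]
  exact hf _ (lt_of_le_of_lt (min_le_right _ _) (by linarith))

/-- Freezing the parameter at `0`: the function `f (0, x)`. -/
def freeze : Sm →ₐ[ℝ] Sm where
  toFun f := ⟨fun p => f (0, p.2), f.contDiff.comp (contDiff_const.prodMk contDiff_snd)⟩
  map_one' := rfl
  map_mul' _ _ := rfl
  map_zero' := rfl
  map_add' _ _ := rfl
  commutes' _ := rfl

@[simp] lemma freeze_apply (f : Sm) (p : ℝ × ℝ) : freeze f p = f (0, p.2) := rfl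

lemma freeze_der (f : Sm) : freeze (DiffAlg.der f) = DiffAlg.der (freeze f) := by
  ext ⟨ε, x⟩
  have h1 := (freeze f).hasDerivAt_snd ε x
  exact (f.hasDerivAt_snd 0 x).unique h1

/-- Real powers of a positive function. -/
def rpow (u : Sm) (hu : ∀ p, 0 < u p) (s : ℝ) : Sm :=
  ⟨fun p => u p ^ s, u.contDiff.rpow_const_of_ne fun p => (hu p).ne'⟩

@[simp] lemma rpow_apply (u : Sm) (hu : ∀ p, 0 < u p) (s : ℝ) (p : ℝ × ℝ) :
    u.rpow hu s p = u p ^ s := rfl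

lemma rpow_add (u : Sm) (hu : ∀ p, 0 < u p) (s t : ℝ) :
    u.rpow hu (s + t) = u.rpow hu s * u.rpow hu t := by
  ext p; simp [Real.rpow_add (hu p)]

lemma rpow_zero (u : Sm) (hu : ∀ p, 0 < u p) : u.rpow hu 0 = 1 := by ext p; simp

lemma rpow_one (u : Sm) (hu : ∀ p, 0 < u p) : u.rpow hu 1 = u := by ext p; simp

end Sm

end

/-! ### Families of superfields -/

namespace Gr

/-- All coefficients vanish for `x < r`, with `r` independent of the coefficient and of the
parameter. -/
def LeftBdd (F : Gr Sm) : Prop := ∃ r : ℝ, ∀ S, Sm.LeftZero (F S) r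

/-- All coefficients vanish for `r < |x|`, with `r` independent of the coefficient and of the
parameter. -/
def BddSupp (F : Gr Sm) : Prop := ∃ r : ℝ, ∀ S p, r < |p.2| → F S p = 0

lemma BddSupp.leftBdd {F : Gr Sm} (h : BddSupp F) : LeftBdd F := by
  obtain ⟨r, hr⟩ := h
  refine ⟨-r, fun S p hp => hr S p ?_⟩
  have := neg_le_abs p.2
  linarith

lemma LeftBdd.add {F G : Gr Sm} (hF : LeftBdd F) (hG : LeftBdd G) : LeftBdd (F + G) := by
  obtain ⟨r, hr⟩ := hF
  obtain ⟨t, ht⟩ := hG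
  refine ⟨min r t, fun S p hp => ?_⟩
  rw [add_apply, Sm.add_apply, hr S p (hp.trans_le (min_le_left _ _)),
    ht S p (hp.trans_le (min_le_right _ _)), add_zero]

lemma LeftBdd.smul {F : Gr Sm} (hF : LeftBdd F) (c : ℝ) : LeftBdd (c • F) := by
  obtain ⟨r, hr⟩ := hF
  refine ⟨r, fun S p hp => ?_⟩
  rw [smul_apply, Sm.smul_apply, hr S p hp, mul_zero]

lemma LeftBdd.sub {F G : Gr Sm} (hF : LeftBdd F) (hG : LeftBdd G) : LeftBdd (F - G) := by
  have := hF.add (hG.smul (-1))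
  rwa [neg_one_smul, ← sub_eq_add_neg] at this

lemma leftBdd_zero : LeftBdd 0 := ⟨0, fun _ _ _ => rfl⟩

lemma LeftBdd.mul_left {F : Gr Sm} (hF : LeftBdd F) (G : Gr Sm) : LeftBdd (G * F) := by
  obtain ⟨r, hr⟩ := hF
  refine ⟨r, fun S p hp => ?_⟩
  rw [mul_apply, Sm.sum_apply]
  refine Finset.sum_eq_zero fun T _ => ?_
  rw [Sm.mul_apply, hr _ p hp, mul_zero]

lemma LeftBdd.superD {F : Gr Sm} (hF : LeftBdd F) : LeftBdd (superD F) := by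
  obtain ⟨r, hr⟩ := hF
  refine ⟨r, fun S => ?_⟩
  rw [superD_apply]
  split_ifs
  · exact (hr _).dirDeriv _
  · exact hr _

lemma BddSupp.add {F G : Gr Sm} (hF : BddSupp F) (hG : BddSupp G) : BddSupp (F + G) := by
  obtain ⟨r, hr⟩ := hF
  obtain ⟨t, ht⟩ := hG
  refine ⟨max r t, fun S p hp => ?_⟩
  rw [add_apply, Sm.add_apply, hr S p ((le_max_left _ _).trans_lt hp),
    ht S p ((le_max_right _ _).trans_lt hp), add_zero]

lemma bddSupp_zero : BddSupp 0 := ⟨0, fun _ _ _ => rfl⟩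

lemma BddSupp.mul_left {F : Gr Sm} (hF : BddSupp F) (G : Gr Sm) : BddSupp (G * F) := by
  obtain ⟨r, hr⟩ := hF
  refine ⟨r, fun S p hp => ?_⟩
  rw [mul_apply, Sm.sum_apply]
  refine Finset.sum_eq_zero fun T _ => ?_
  rw [Sm.mul_apply, hr _ p hp, mul_zero]

lemma BddSupp.mul_right {F : Gr Sm} (hF : BddSupp F) (G : Gr Sm) : BddSupp (F * G) := by
  obtain ⟨r, hr⟩ := hF
  refine ⟨r, fun S p hp => ?_⟩
  rw [mul_apply, Sm.sum_apply]
  refine Finset.sum_eq_zero fun T _ => ?_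
  rw [Sm.mul_apply, Sm.mul_apply, hr _ p hp, mul_zero, zero_mul]

lemma BddSupp.smul {F : Gr Sm} (hF : BddSupp F) (c : ℝ) : BddSupp (c • F) := by
  obtain ⟨r, hr⟩ := hF
  refine ⟨r, fun S p hp => ?_⟩
  rw [smul_apply, Sm.smul_apply, hr S p hp, mul_zero]

lemma dirDeriv_eq_zero {f : Sm} {r : ℝ} (hf : ∀ p : ℝ × ℝ, r < |p.2| → f p = 0) (v : ℝ × ℝ)
    {p : ℝ × ℝ} (hp : r < |p.2|) : Sm.dirDeriv v f p = 0 := by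
  have h : (f : ℝ × ℝ → ℝ) =ᶠ[nhds p] fun _ => 0 := by
    have ho : IsOpen {q : ℝ × ℝ | r < |q.2|} :=
      isOpen_lt continuous_const (_root_.continuous_snd.abs)
    filter_upwards [ho.mem_nhds hp] with q hq
    exact hf q hq
  rw [Sm.dirDeriv_apply, h.fderiv_eq]
  simp

lemma BddSupp.superD {F : Gr Sm} (hF : BddSupp F) : BddSupp (superD F) := by
  obtain ⟨r, hr⟩ := hF
  refine ⟨r, fun S p hp => ?_⟩
  rw [superD_apply]
  split_ifs
  · exact dirDeriv_eq_zero (hr _) _ hp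
  · exact hr _ p hp

/-! ### The inverse of the superderivative -/

/-- The antiderivative `∂ₓ⁻¹` on families. -/
def dxPrim (F : Gr Sm) : Gr Sm := fun S => (F S).prim

/-- The operator `D⁻¹ = D ∂ₓ⁻¹` on families. -/
def superDInv (F : Gr Sm) : Gr Sm := superD (dxPrim F)

lemma LeftBdd.superDInv {F : Gr Sm} (hF : LeftBdd F) : LeftBdd (superDInv F) := by
  obtain ⟨r, hr⟩ := hF
  exact LeftBdd.superD ⟨r, fun S => (hr S).prim⟩

lemma superD_superDInv {F : Gr Sm} (hF : LeftBdd F) : superD (superDInv F) = F := by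
  obtain ⟨r, hr⟩ := hF
  ext1 S
  rw [superDInv, superD_superD]
  exact Sm.der_prim (hr S)

lemma eq_zero_of_superD_eq_zero {F : Gr Sm} (hF : LeftBdd F) (h : superD F = 0) : F = 0 := by
  obtain ⟨r, hr⟩ := hF
  ext1 S
  apply Sm.eq_zero_of_der_eq_zero (hr S)
  rw [← superD_superD, h, map_zero, zero_apply]

lemma eq_of_superD_eq {F G : Gr Sm} (hF : LeftBdd F) (hG : LeftBdd G)
    (h : superD F = superD G) : F = G := by
  rw [← sub_eq_zero]
  apply eq_zero_of_superD_eq_zero (hF.sub hG)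
  rw [map_sub, h, sub_self]

lemma superDInv_superD {F : Gr Sm} (hF : LeftBdd F) : superDInv (superD F) = F :=
  eq_of_superD_eq hF.superD.superDInv hF (superD_superDInv hF.superD)

lemma IsEven.superDInv {F : Gr Sm} (h : IsEven F) : IsOdd (superDInv F) :=
  IsEven.superD fun S hS => by rw [dxPrim, h S hS, Sm.prim_zero]

lemma IsOdd.superDInv {F : Gr Sm} (h : IsOdd F) : IsEven (superDInv F) :=
  IsOdd.superD fun S hS => by rw [dxPrim, h S hS, Sm.prim_zero]

lemma superDInv_add {F G : Gr Sm} (hF : LeftBdd F) (hG : LeftBdd G) :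
    superDInv (F + G) = superDInv F + superDInv G := by
  apply eq_of_superD_eq (hF.add hG).superDInv (hF.superDInv.add hG.superDInv)
  rw [map_add, superD_superDInv (hF.add hG), superD_superDInv hF, superD_superDInv hG]

/-! ### Maps acting on the coefficients -/

/-- The action of a linear map on all coefficients. -/
def coeffMap (T : Sm →ₗ[ℝ] Sm) : Gr Sm →ₗ[ℝ] Gr Sm where
  toFun F := fun S => T (F S)
  map_add' F G := funext fun S => map_add T (F S) (G S)
  map_smul' c F := funext fun S => map_smul T c (F S)

lemma coeffMap_apply (T : Sm →ₗ[ℝ] Sm) (F : Gr Sm) (S : Finset ℕ) :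
    coeffMap T F S = T (F S) := rfl

lemma IsEven.coeffMap (T : Sm →ₗ[ℝ] Sm) {F : Gr Sm} (h : IsEven F) : IsEven (coeffMap T F) :=
  fun S hS => by rw [coeffMap_apply, h S hS, map_zero]

lemma IsOdd.coeffMap (T : Sm →ₗ[ℝ] Sm) {F : Gr Sm} (h : IsOdd F) : IsOdd (coeffMap T F) :=
  fun S hS => by rw [coeffMap_apply, h S hS, map_zero]

lemma coeffMap_superD {T : Sm →ₗ[ℝ] Sm} (hT : ∀ f, T (DiffAlg.der f) = DiffAlg.der (T f))
    (F : Gr Sm) : coeffMap T (superD F) = superD (coeffMap T F) := by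
  ext1 S
  simp only [coeffMap_apply, superD_apply]
  split_ifs
  · exact hT _
  · rfl

lemma coeffMap_superDInv {T : Sm →ₗ[ℝ] Sm} (hT : ∀ f, T (DiffAlg.der f) = DiffAlg.der (T f))
    (hl : ∀ (f : Sm) r, f.LeftZero r → (T f).LeftZero r) {F : Gr Sm} (hF : LeftBdd F) :
    coeffMap T (superDInv F) = superDInv (coeffMap T F) := by
  have hl' : ∀ {G : Gr Sm}, LeftBdd G → LeftBdd (coeffMap T G) :=
    fun ⟨r, hr⟩ => ⟨r, fun S => hl _ _ (hr S)⟩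
  apply eq_of_superD_eq (hl' hF.superDInv) (hl' hF).superDInv
  rw [← coeffMap_superD hT, superD_superDInv hF, superD_superDInv (hl' hF)]

/-- The derivative with respect to the parameter. -/
def dEps : Gr Sm →ₗ[ℝ] Gr Sm := coeffMap (Sm.dirDeriv (1, 0)).toLinearMap

lemma dEps_apply (F : Gr Sm) (S : Finset ℕ) : dEps F S = Sm.dirDeriv (1, 0) (F S) := rfl

lemma dEps_mul (F G : Gr Sm) : dEps (F * G) = F * dEps G + dEps F * G := by
  ext1 S
  rw [add_apply, mul_apply, mul_apply, dEps_apply, mul_apply, map_sum, ← Finset.sum_add_distrib]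
  refine Finset.sum_congr rfl fun T _ => ?_
  have h1 : Sm.dirDeriv (1, 0) ((-1 : Sm) ^ inversions T (S \ T)) = 0 := by
    have h2 : Sm.dirDeriv (1, 0) (-1 : Sm) = 0 := by
      rw [Derivation.map_neg, Derivation.map_one_eq_zero, neg_zero]
    rw [Derivation.leibniz_pow, h2, smul_zero, smul_zero]
  rw [Derivation.leibniz, Derivation.leibniz, h1]
  simp only [smul_eq_mul, mul_zero, add_zero, dEps_apply]
  ring

lemma dEps_superD (F : Gr Sm) : dEps (superD F) = superD (dEps F) :=
  coeffMap_superD (fun f => Sm.dirDeriv_comm (1, 0) (0, 1) f) F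

lemma dEps_superDInv {F : Gr Sm} (hF : LeftBdd F) : dEps (superDInv F) = superDInv (dEps F) :=
  coeffMap_superDInv (fun f => Sm.dirDeriv_comm (1, 0) (0, 1) f)
    (fun _ _ h => h.dirDeriv _) hF

lemma LeftBdd.dEps {F : Gr Sm} (hF : LeftBdd F) : LeftBdd (dEps F) := by
  obtain ⟨r, hr⟩ := hF
  exact ⟨r, fun S => (hr S).dirDeriv _⟩

lemma BddSupp.dEps {F : Gr Sm} (hF : BddSupp F) : BddSupp (dEps F) := by
  obtain ⟨r, hr⟩ := hF
  exact ⟨r, fun S p hp => dirDeriv_eq_zero (hr S) _ hp⟩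

/-- The family frozen at the parameter value `0`. -/
def frz : Gr Sm →ₗ[ℝ] Gr Sm := coeffMap Sm.freeze.toLinearMap

lemma frz_apply (F : Gr Sm) (S : Finset ℕ) : frz F S = Sm.freeze (F S) := rfl

lemma frz_frz (F : Gr Sm) : frz (frz F) = frz F := rfl

lemma frz_mul (F G : Gr Sm) : frz (F * G) = frz F * frz G := by
  ext1 S
  simp only [frz_apply, mul_apply, map_sum, map_mul, map_pow, map_neg, map_one]

lemma frz_one : frz 1 = 1 := by
  ext1 S
  rw [frz_apply, one_apply]
  split_ifs <;> simp

lemma frz_pow (F : Gr Sm) (n : ℕ) : frz (F ^ n) = frz F ^ n := by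
  induction n with
  | zero => simp [frz_one]
  | succ n ih => rw [pow_succ, pow_succ, frz_mul, ih]

lemma frz_superD (F : Gr Sm) : frz (superD F) = superD (frz F) :=
  coeffMap_superD (fun f => Sm.freeze_der f) F

lemma frz_superDInv {F : Gr Sm} (hF : LeftBdd F) : frz (superDInv F) = superDInv (frz F) :=
  coeffMap_superDInv (fun f => Sm.freeze_der f) (fun _ _ h p hp => h (0, p.2) hp) hF

lemma LeftBdd.frz {F : Gr Sm} (hF : LeftBdd F) : LeftBdd (frz F) := by
  obtain ⟨r, hr⟩ := hF
  exact ⟨r, fun S p hp => hr S (0, p.2) hp⟩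

lemma dEps_frz (F : Gr Sm) : dEps (frz F) = 0 := by
  ext S p
  exact ((frz F S).hasDerivAt_fst p.1 p.2).unique (hasDerivAt_const p.1 (F S (0, p.2)))

end Gr

/-- The families with bounded support form a differential ideal. -/
def bddIdeal : Super.DIdeal (Gr.Ev Sm) (Gr.Od Sm) where
  I :=
    { carrier := {a | Gr.BddSupp (a : Gr Sm)}
      add_mem' := fun ha hb => ha.add hb
      zero_mem' := Gr.bddSupp_zero
      smul_mem' := fun c _ hx => hx.mul_left (c : Gr Sm) }
  J :=
    { carrier := {a | Gr.BddSupp (a : Gr Sm)}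
      add_mem' := fun ha hb => ha.add hb
      zero_mem' := Gr.bddSupp_zero
      smul_mem' := fun c _ hx => hx.mul_left (c : Gr Sm) }
  d_mem := fun h => Gr.BddSupp.superD h
  δ_mem := fun h => Gr.BddSupp.superD h
  pr_mem := fun y h => Gr.BddSupp.mul_right h (y : Gr Sm)
  smul_mem := fun x h => Gr.BddSupp.mul_right h (x : Gr Sm)

lemma mem_bddIdeal_I {a : Gr.Ev Sm} : a ∈ bddIdeal.I ↔ Gr.BddSupp (a : Gr Sm) := Iff.rfl
lemma mem_bddIdeal_J {a : Gr.Od Sm} : a ∈ bddIdeal.J ↔ Gr.BddSupp (a : Gr Sm) := Iff.rfl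

/-- The derivative with respect to the parameter, on even families. -/
def dEpsEv : Gr.Ev Sm →ₗ[ℝ] Gr.Ev Sm where
  toFun a := ⟨Gr.dEps a, Gr.IsEven.coeffMap _ a.2⟩
  map_add' a b := Subtype.ext (map_add Gr.dEps (a : Gr Sm) b)
  map_smul' c a := Subtype.ext (map_smul Gr.dEps c (a : Gr Sm))

/-- The derivative with respect to the parameter, on odd families. -/
def dEpsOd : Gr.Od Sm →ₗ[ℝ] Gr.Od Sm where
  toFun a := ⟨Gr.dEps a, Gr.IsOdd.coeffMap _ a.2⟩
  map_add' a b := Subtype.ext (map_add Gr.dEps (a : Gr Sm) b)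
  map_smul' c a := Subtype.ext (map_smul Gr.dEps c (a : Gr Sm))

@[simp] lemma coe_dEpsEv (a : Gr.Ev Sm) : (dEpsEv a : Gr Sm) = Gr.dEps a := rfl
@[simp] lemma coe_dEpsOd (a : Gr.Od Sm) : (dEpsOd a : Gr Sm) = Gr.dEps a := rfl

lemma variation_dEps : Super.Variation dEpsEv dEpsOd where
  mul a b := Subtype.ext (by
    change Gr.dEps ((a : Gr Sm) * b) = a * Gr.dEps b + b * Gr.dEps a
    rw [Gr.dEps_mul, ← b.2.mul_comm])
  smul a x := Subtype.ext (Gr.dEps_mul (a : Gr Sm) x)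
  map_d a := Subtype.ext (Gr.dEps_superD (a : Gr Sm))
  map_δ x := Subtype.ext (Gr.dEps_superD (x : Gr Sm))

/-- A family of bosonic fields with positive body. -/
structure PosField where
  /-- The family of fields. -/
  val : Gr.Ev Sm
  pos : ∀ p, 0 < (val : Gr Sm) ∅ p

namespace PosField

variable (U : PosField)

/-- The power `U ^ s`. -/
def pw (s : ℝ) : Gr.Ev Sm :=
  ⟨Gr.taylorPow (fun t => Sm.rpow ((U.val : Gr Sm) ∅) U.pos t) (Gr.soulPart (U.val : Gr Sm)) s,
    (Gr.IsEven.soulPart U.val.2).taylorPow s⟩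

lemma pw_add (s t : ℝ) : U.pw (s + t) = U.pw s * U.pw t :=
  Subtype.ext (Gr.taylorPow_add (Gr.soulPart_empty _) (fun s t => Sm.rpow_add _ U.pos s t) s t)

lemma pw_zero : U.pw 0 = 1 := Subtype.ext (Gr.taylorPow_zero (Sm.rpow_zero _ U.pos))

lemma pw_one : U.pw 1 = U.val :=
  Subtype.ext (Gr.taylorPow_one (Sm.rpow_zero _ U.pos) (Sm.rpow_one _ U.pos))

lemma pw_neg_mul (s : ℝ) : U.pw (-s) * U.pw s = 1 := by
  rw [← pw_add, neg_add_cancel, pw_zero]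

/-- The family frozen at the parameter value `0`. -/
def frz : PosField where
  val := ⟨Gr.frz U.val, Gr.IsEven.coeffMap _ U.val.2⟩
  pos := fun p => U.pos (0, p.2)

lemma frz_pw (s : ℝ) : Gr.frz (U.pw s : Gr Sm) = (U.frz.pw s : Gr Sm) := by
  have hs : Gr.frz (Gr.soulPart (U.val : Gr Sm)) = Gr.soulPart (U.frz.val : Gr Sm) := by
    ext1 S
    simp only [Gr.frz_apply, Gr.soulPart]
    split_ifs
    · exact map_zero _
    · rfl
  ext1 S
  change Sm.freeze (∑ k ∈ Finset.range (S.card + 1), _) = ∑ k ∈ Finset.range (S.card + 1), _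
  rw [map_sum]
  refine Finset.sum_congr rfl fun k _ => ?_
  rw [map_mul, ← Gr.frz_apply, Gr.frz_pow, hs]
  rfl

end PosField

/-! ### Members of a family -/

section

open MeasureTheory Set

/-- The member of a family at the parameter value `ε`. -/
def ev (ε : ℝ) (F : Gr Sm) : Superfield := fun S x => F S (ε, x)

lemma ev_apply (ε : ℝ) (F : Gr Sm) (S : Finset ℕ) (x : ℝ) : ev ε F S x = F S (ε, x) := rfl

lemma ev_add (ε : ℝ) (F G : Gr Sm) : ev ε (F + G) = ev ε F + ev ε G := rfl
lemma ev_sub (ε : ℝ) (F G : Gr Sm) : ev ε (F - G) = ev ε F - ev ε G := by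
  ext S x; simp [ev, sub_eq_add_neg]
lemma ev_smul (ε c : ℝ) (F : Gr Sm) : ev ε (c • F) = c • ev ε F := rfl

lemma smooth_ev (ε : ℝ) (F : Gr Sm) : Smooth (ev ε F) := fun S =>
  (F S).contDiff.comp (contDiff_const.prodMk contDiff_id)

lemma ev_mul (ε : ℝ) (F G : Gr Sm) : ev ε (F * G) = ev ε F ⋆ ev ε G := by
  ext S x
  rw [ev_apply, Gr.mul_apply, Sm.sum_apply, gmul]
  refine Finset.sum_congr rfl fun T _ => ?_
  rw [Sm.mul_apply, Sm.mul_apply, Sm.pow_apply]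
  rfl

lemma ev_one (ε : ℝ) : ev ε 1 = gunit := by
  ext S x
  rw [ev_apply, Gr.one_apply, gunit]
  split_ifs <;> rfl

lemma ev_pow (ε : ℝ) (F : Gr Sm) (k : ℕ) : ev ε (F ^ k) = npow (ev ε F) k := by
  induction k with
  | zero => rw [pow_zero, ev_one]; rfl
  | succ k ih => rw [pow_succ, ev_mul, ih]; rfl

lemma deriv_ev (ε : ℝ) (F : Gr Sm) (S : Finset ℕ) (x : ℝ) :
    deriv (ev ε F S) x = DiffAlg.der (F S) (ε, x) := ((F S).hasDerivAt_snd ε x).deriv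

lemma ev_superD (ε : ℝ) (F : Gr Sm) : ev ε (Gr.superD F) = D (ev ε F) := by
  ext S x
  rw [ev_apply, Gr.superD_apply, D]
  split_ifs
  · rw [deriv_ev]
  · rfl

lemma ev_superD_superD (ε : ℝ) (F : Gr Sm) :
    ev ε (Gr.superD (Gr.superD F)) = dx (ev ε F) := by
  ext S x
  rw [ev_apply, Gr.superD_superD, dx, deriv_ev]

lemma ev_superDInv (ε : ℝ) {F : Gr Sm} (hF : Gr.LeftBdd F) :
    ev ε (Gr.superDInv F) = DInv (ev ε F) := by
  obtain ⟨r, hr⟩ := hF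
  rw [Gr.superDInv, ev_superD, DInv]
  congr 1
  ext S x
  exact Sm.prim_apply (hr S) (ε, x)

lemma ev_pw (ε : ℝ) (U : PosField) (s : ℝ) :
    ev ε (U.pw s : Gr Sm) = fpow (ev ε (U.val : Gr Sm)) s := by
  have hs : ev ε (Gr.soulPart (U.val : Gr Sm)) = soul (ev ε (U.val : Gr Sm)) := by
    ext S x
    simp only [ev_apply, Gr.soulPart, soul]
    split_ifs <;> rfl
  ext S x
  change (∑ k ∈ Finset.range (S.card + 1), _ : Sm) (ε, x) = _
  rw [Sm.sum_apply, fpow]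
  refine Finset.sum_congr rfl fun k _ => ?_
  rw [← hs, ← ev_pow, Sm.mul_apply, Sm.smul_apply]
  rfl

/-- The constant family. -/
def lift (F : Superfield) (h : Smooth F) : Gr Sm := fun S =>
  ⟨fun p => F S p.2, (h S).comp contDiff_snd⟩

@[simp] lemma ev_lift (ε : ℝ) {F : Superfield} (h : Smooth F) : ev ε (lift F h) = F := rfl

lemma frz_lift {F : Superfield} (h : Smooth F) : Gr.frz (lift F h) = lift F h := rfl

lemma frz_eq_lift (F : Gr Sm) : Gr.frz F = lift (ev 0 F) (smooth_ev 0 F) := rfl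

lemma ev_frz (ε : ℝ) (F : Gr Sm) : ev ε (Gr.frz F) = ev 0 F := rfl

lemma Bosonic.lift {F : Superfield} (hF : Bosonic F) (h : Smooth F) : Gr.IsEven (lift F h) :=
  fun S hS => Sm.ext fun p => congrFun (hF S hS) p.2

lemma Fermionic.lift {F : Superfield} (hF : Fermionic F) (h : Smooth F) :
    Gr.IsOdd (SuperHD.lift F h) :=
  fun S hS => Sm.ext fun p => congrFun (hF S hS) p.2

lemma bosonic_ev (ε : ℝ) {F : Gr Sm} (hF : Gr.IsEven F) : Bosonic (ev ε F) :=
  fun S hS => by ext x; rw [ev_apply, hF S hS]; rfl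

lemma fermionic_ev (ε : ℝ) {F : Gr Sm} (hF : Gr.IsOdd F) : Fermionic (ev ε F) :=
  fun S hS => by ext x; rw [ev_apply, hF S hS]; rfl

lemma CompactSupp.lift {F : Superfield} (hF : CompactSupp F) (h : Smooth F) :
    Gr.BddSupp (lift F h) := by
  obtain ⟨r, hr⟩ := hF
  exact ⟨r, fun S p hp => hr S p.2 hp⟩

lemma compactSupp_ev (ε : ℝ) {F : Gr Sm} (hF : Gr.BddSupp F) : CompactSupp (ev ε F) := by
  obtain ⟨r, hr⟩ := hF
  exact ⟨r, fun S x hx => hr S (ε, x) hx⟩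

lemma LeftBounded.lift {F : Superfield} (hF : LeftBounded F) : Gr.LeftBdd (lift F hF.1) := by
  obtain ⟨h, r, hr⟩ := hF
  exact ⟨r, fun S p hp => hr S p.2 hp⟩

lemma leftBounded_ev (ε : ℝ) {F : Gr Sm} (hF : Gr.LeftBdd F) : LeftBounded (ev ε F) := by
  obtain ⟨r, hr⟩ := hF
  exact ⟨smooth_ev ε F, r, fun S x hx => hr S (ε, x) hx⟩

/-! ### Operators acting on families -/

/-- The action of a factor on families. -/
def actFam (U : PosField) : Factor → Gr Sm → Gr Sm
  | .pow s, F => U.pw s * F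
  | .der, F => Gr.superD F
  | .inv, F => Gr.superDInv F

/-- The action of a product of factors on families. -/
def opFam : List Factor → PosField → Gr Sm → Gr Sm
  | [], _, F => F
  | f :: w, U, F => actFam U f (opFam w U F)

lemma LeftBdd.actFam {F : Gr Sm} (hF : Gr.LeftBdd F) (U : PosField) (f : Factor) :
    Gr.LeftBdd (actFam U f F) := by
  cases f with
  | pow s => exact hF.mul_left _
  | der => exact hF.superD
  | inv => exact hF.superDInv

lemma leftBdd_opFam {F : Gr Sm} (hF : Gr.LeftBdd F) (U : PosField) (w : List Factor) :
    Gr.LeftBdd (opFam w U F) := by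
  induction w with
  | nil => exact hF
  | cons f w ih => exact LeftBdd.actFam ih U f

lemma ev_actFam (ε : ℝ) (U : PosField) (f : Factor) {F : Gr Sm} (hF : Gr.LeftBdd F) :
    ev ε (actFam U f F) = f.act (ev ε U.val) (ev ε F) := by
  cases f with
  | pow s => rw [actFam, ev_mul, ev_pw]; rfl
  | der => exact ev_superD ε F
  | inv => exact ev_superDInv ε hF

lemma ev_opFam (ε : ℝ) (w : List Factor) (U : PosField) {F : Gr Sm} (hF : Gr.LeftBdd F) :
    ev ε (opFam w U F) = op w (ev ε U.val) (ev ε F) := by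
  induction w with
  | nil => rfl
  | cons f w ih => rw [opFam, ev_actFam ε U f (leftBdd_opFam hF U w), ih]; rfl

lemma frz_opFam (w : List Factor) (U : PosField) {F : Gr Sm} (hF : Gr.LeftBdd F) :
    Gr.frz (opFam w U F) = opFam w U.frz (Gr.frz F) := by
  induction w with
  | nil => rfl
  | cons f w ih =>
    have h := leftBdd_opFam hF U w
    rw [opFam, opFam, ← ih]
    cases f with
    | pow s => rw [actFam, Gr.frz_mul, PosField.frz_pw]; rfl
    | der => exact Gr.frz_superD _
    | inv => exact Gr.frz_superDInv h

/-- Product rule: the derivative of `w(U) F` is the sum of the derivatives along `U` and `F`. -/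
lemma frz_dEps_opFam (w : List Factor) (U : PosField) {F : Gr Sm} (hF : Gr.LeftBdd F) :
    Gr.frz (Gr.dEps (opFam w U F)) =
      Gr.frz (Gr.dEps (opFam w U (Gr.frz F))) + opFam w U.frz (Gr.frz (Gr.dEps F)) := by
  induction w with
  | nil => simp [opFam, Gr.dEps_frz]
  | cons f w ih =>
    have h := leftBdd_opFam hF U w
    have h' := leftBdd_opFam hF.frz U w
    simp only [opFam]
    cases f with
    | pow s =>
      simp only [actFam, Gr.dEps_mul, map_add, Gr.frz_mul, ih, frz_opFam w U hF,
        frz_opFam w U hF.frz, Gr.frz_frz, mul_add, PosField.frz_pw]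
      abel
    | der =>
      simp only [actFam, Gr.dEps_superD, Gr.frz_superD, ih, map_add]
    | inv =>
      simp only [actFam]
      rw [Gr.dEps_superDInv h, Gr.dEps_superDInv h', Gr.frz_superDInv h.dEps,
        Gr.frz_superDInv h'.dEps, ih,
        Gr.superDInv_add h'.dEps.frz (leftBdd_opFam hF.dEps.frz _ _)]

/-! ### Berezin integrals -/

lemma superIntegral_apply_zero {S : Finset ℕ} (h : 0 ∈ S) (F : Superfield) :
    superIntegral F S = 0 := by simp [superIntegral, h]

lemma superIntegral_apply {S : Finset ℕ} (h : 0 ∉ S) (F : Superfield) :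
    superIntegral F S = ∫ x, F (insert 0 S) x := by simp [superIntegral, h]

lemma integral_eq_prim {f : Sm} {r : ℝ} (hf : ∀ p : ℝ × ℝ, r < |p.2| → f p = 0) (ε : ℝ) :
    ∫ x, f (ε, x) = f.prim (ε, r) := by
  have hl : f.LeftZero (-r) := fun p hp => hf p (by linarith [neg_le_abs p.2])
  rw [Sm.prim_apply hl]
  refine (setIntegral_eq_integral_of_forall_compl_eq_zero fun x hx => hf _ ?_).symm
  exact (not_le.mp hx).trans_le (le_abs_self x)

lemma integrable_ev (ε : ℝ) {F : Gr Sm} (hF : Gr.BddSupp F) (S : Finset ℕ) :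
    Integrable (ev ε F S) := by
  obtain ⟨r, hr⟩ := compactSupp_ev ε hF
  refine (smooth_ev ε F S).continuous.integrable_of_hasCompactSupport ?_
  refine HasCompactSupport.intro (isCompact_Icc (a := -r) (b := r)) fun x hx => hr S x ?_
  by_contra h
  exact hx (abs_le.mp (not_lt.mp h))

lemma superIntegral_ev_add (ε : ℝ) {F G : Gr Sm} (hF : Gr.BddSupp F) (hG : Gr.BddSupp G) :
    superIntegral (ev ε (F + G)) = superIntegral (ev ε F) + superIntegral (ev ε G) := by
  ext S
  by_cases h : 0 ∈ S
  · simp [superIntegral_apply_zero h]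
  · simp only [superIntegral_apply h, Pi.add_apply]
    exact integral_add (integrable_ev ε hF _) (integrable_ev ε hG _)

lemma superIntegral_ev_smul (ε c : ℝ) (F : Gr Sm) :
    superIntegral (ev ε (c • F)) = c • superIntegral (ev ε F) := by
  ext S
  by_cases h : 0 ∈ S
  · simp [superIntegral_apply_zero h]
  · simp only [superIntegral_apply h, Pi.smul_apply, smul_eq_mul]
    exact integral_const_mul c _

lemma superIntegral_ev_superD (ε : ℝ) {F : Gr Sm} (hF : Gr.BddSupp F) :
    superIntegral (ev ε (Gr.superD F)) = 0 := by
  ext S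
  by_cases h : 0 ∈ S
  · simp [superIntegral_apply_zero h]
  · obtain ⟨r, hr⟩ := hF
    rw [superIntegral_apply h]
    simp only [ev_apply, Gr.superD_insert _ h]
    have hl : (F S).LeftZero (-r) := fun p hp => hr S p (by linarith [neg_le_abs p.2])
    rw [integral_eq_prim (f := DiffAlg.der (F S)) (r := r + 1)
      (fun p hp => Gr.dirDeriv_eq_zero (hr S) _ ((lt_add_one r).trans hp))]
    have : (DiffAlg.der (F S)).prim = F S := by
      rw [← sub_eq_zero]
      have hl2 : (DiffAlg.der (F S)).LeftZero (-r) := hl.dirDeriv (0, 1)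
      apply Sm.eq_zero_of_der_eq_zero (r := -r)
      · intro p hp
        change (DiffAlg.der (F S)).prim p - F S p = 0
        rw [hl2.prim p hp, hl p hp, sub_zero]
      · rw [map_sub, Sm.der_prim hl2, sub_self]
    rw [this]
    exact hr S _ (by rw [lt_abs]; left; simp)

lemma superIntegral_total (ε : ℝ) {x : Gr.Od Sm} (hx : x ∈ bddIdeal.total) :
    superIntegral (ev ε (x : Gr Sm)) = 0 := by
  obtain ⟨a, ha, rfl⟩ := hx
  exact superIntegral_ev_superD ε ha

/-- Differentiation under the integral sign. -/
lemma hasDerivAt_superIntegral {F : Gr Sm} (hF : Gr.BddSupp F) (S : Finset ℕ) :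
    HasDerivAt (fun ε => superIntegral (ev ε F) S) (superIntegral (ev 0 (Gr.dEps F)) S) 0 := by
  by_cases h : 0 ∈ S
  · simp only [superIntegral_apply_zero h]
    exact hasDerivAt_const _ _
  · obtain ⟨r, hr⟩ := hF
    simp only [superIntegral_apply h, ev_apply, Gr.dEps_apply]
    have hl : (F (insert 0 S)).LeftZero (-r) := fun p hp => hr _ p (by linarith [neg_le_abs p.2])
    rw [integral_eq_prim (fun p hp => Gr.dirDeriv_eq_zero (hr _) _ hp)]
    simp only [integral_eq_prim (hr _)]
    have : (Sm.dirDeriv (1, 0) (F (insert 0 S))).prim =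
        Sm.dirDeriv (1, 0) (F (insert 0 S)).prim := by
      rw [← sub_eq_zero]
      have hl2 := hl.dirDeriv (1, 0)
      have hl3 := hl.prim.dirDeriv (1, 0)
      apply Sm.eq_zero_of_der_eq_zero (r := -r)
      · intro p hp
        change (Sm.dirDeriv (1, 0) (F (insert 0 S))).prim p -
          Sm.dirDeriv (1, 0) (F (insert 0 S)).prim p = 0
        rw [hl2.prim p hp, hl3 p hp, sub_zero]
      · rw [map_sub, Sm.der_prim hl2]
        change _ - Sm.dirDeriv (0, 1) (Sm.dirDeriv (1, 0) (F (insert 0 S)).prim) = 0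
        rw [Sm.dirDeriv_comm]
        change _ - Sm.dirDeriv (1, 0) (DiffAlg.der (F (insert 0 S)).prim) = 0
        rw [Sm.der_prim hl, sub_self]
    rw [this]
    exact Sm.hasDerivAt_fst _ 0 r

/-! ### Perturbed fields -/

lemma IsPositiveField.exists_delta {U : Superfield} (hU : IsPositiveField U) {W : Superfield}
    (hW : Smooth W) (hc : CompactSupp W) : ∃ η > 0, ∀ t x : ℝ, |t| ≤ η → 0 < U ∅ x + t * W ∅ x := by
  obtain ⟨r, hr⟩ := hc
  have hcont : Continuous fun x => U ∅ x / (|W ∅ x| + 1) :=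
    (hU.smooth ∅).continuous.div ((hW ∅).continuous.abs.add continuous_const)
      fun x => by positivity
  obtain ⟨m, hm, hmin⟩ : ∃ m > 0, ∀ x ∈ Icc (-r) r, m ≤ U ∅ x / (|W ∅ x| + 1) := by
    rcases (Icc (-r) r).eq_empty_or_nonempty with h | h
    · exact ⟨1, one_pos, fun x hx => by simp [h] at hx⟩
    · obtain ⟨x₀, _, h0⟩ := isCompact_Icc.exists_isMinOn h hcont.continuousOn
      exact ⟨_, div_pos (hU.pos x₀) (by positivity), fun x hx => h0 hx⟩
  refine ⟨m, hm, fun t x ht => ?_⟩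
  by_cases hx : x ∈ Icc (-r) r
  · have h1 := (le_div_iff₀ (by positivity)).mp (hmin x hx)
    have h2 : |t * W ∅ x| ≤ m * |W ∅ x| := by
      rw [abs_mul]; exact mul_le_mul_of_nonneg_right ht (abs_nonneg _)
    have h3 := neg_abs_le (t * W ∅ x)
    nlinarith
  · rw [hr ∅ x (by by_contra h; exact hx (abs_le.mp (not_lt.mp h))), mul_zero, add_zero]
    exact hU.pos x

/-- The constant family of fields. -/
def IsPositiveField.lift {U : Superfield} (hU : IsPositiveField U) : PosField where
  val := ⟨SuperHD.lift U hU.smooth, hU.bosonic.lift hU.smooth⟩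
  pos p := hU.pos p.2

lemma PosField.ext_val {U V : PosField} (h : (U.val : Gr Sm) = V.val) : U = V := by
  cases U; cases V; congr; exact Subtype.ext h

/-- The family `V` of positive fields is `U + ε W` for small `ε`. -/
structure IsPerturbation (V : PosField) (U W : Superfield) : Prop where
  eventually : ∀ᶠ ε in nhds 0, ev ε (V.val : Gr Sm) = U + ε • W

namespace IsPerturbation

variable {V : PosField} {U W : Superfield} (h : IsPerturbation V U W)

include h

lemma frz_eq (hU : IsPositiveField U) : V.frz = hU.lift := by
  apply PosField.ext_val
  have h0 : ev 0 (V.val : Gr Sm) = U := by simpa using h.eventually.self_of_nhds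
  ext S p
  exact congrFun (congrFun h0 S) p.2

lemma frz_dEps (hW : Smooth W) : Gr.frz (Gr.dEps V.val) = lift W hW := by
  ext S p
  have h1 := ((V.val : Gr Sm) S).hasDerivAt_fst 0 p.2
  have h2 : HasDerivAt (fun ε : ℝ => U S p.2 + ε * W S p.2) (W S p.2) 0 := by
    simpa using ((hasDerivAt_id (0 : ℝ)).mul_const (W S p.2)).const_add (U S p.2)
  refine h1.unique (h2.congr_of_eventuallyEq ?_)
  filter_upwards [h.eventually] with ε hε
  exact congrFun (congrFun hε S) p.2

/-- The derivative of an operator exists, and is given by the derivative of the family. -/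
lemma hasFrechetDeriv {F : Superfield} (hF : LeftBounded F) (w : List Factor) :
    HasFrechetDeriv w U W F (ev 0 (Gr.dEps (opFam w V (lift F hF.1)))) := by
  refine ⟨smooth_ev _ _, fun S x => ?_⟩
  refine ((opFam w V (lift F hF.1) S).hasDerivAt_fst 0 x).congr_of_eventuallyEq ?_
  filter_upwards [h.eventually] with ε hε
  rw [← hε]
  exact (congrFun (congrFun (ev_opFam ε w V hF.lift) S) x).symm

end IsPerturbation

/-- There is a smooth family of positive fields that is `U + ε W` for small `ε`. -/
lemma IsPositiveField.exists_family {U : Superfield} (hU : IsPositiveField U) {W : Superfield}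
    (hW : Smooth W) (hb : Bosonic W) (hc : CompactSupp W) :
    ∃ V : PosField, IsPerturbation V U W ∧
      Gr.BddSupp ((V.val : Gr Sm) - hU.lift.val) := by
  obtain ⟨η, hη, hpos⟩ := hU.exists_delta hW hc
  -- `U + ε W` has positive body only for small `ε`; the cutoff `β` extends the family to all `ε`.
  let β : ContDiffBump (0 : ℝ) := ⟨η / 2, η, by positivity, by linarith⟩
  have hβ : ContDiff ℝ ∞ fun t : ℝ => β t * t := (β.contDiff (n := ⊤)).mul contDiff_id
  have hle : ∀ t, |β t * t| ≤ η := fun t => by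
    by_cases ht : |t| ≤ η
    · rw [abs_mul, abs_of_nonneg β.nonneg]
      exact (mul_le_of_le_one_left (abs_nonneg t) β.le_one).trans ht
    · rw [β.zero_of_le_dist (by simpa using (not_le.mp ht).le)]
      simpa using hη.le
  refine ⟨⟨⟨fun S => ⟨fun p => U S p.2 + (β p.1 * p.1) * W S p.2, ?_⟩, ?_⟩, ?_⟩, ⟨?_⟩, ?_⟩
  · exact ((hU.smooth S).comp contDiff_snd).add
      ((hβ.comp contDiff_fst).mul ((hW S).comp contDiff_snd))
  · intro S hS
    ext p
    change U S p.2 + (β p.1 * p.1) * W S p.2 = 0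
    rw [hU.bosonic S hS, hb S hS]
    simp
  · intro p
    exact hpos _ _ (hle p.1)
  · filter_upwards [Metric.closedBall_mem_nhds (0 : ℝ) (show 0 < η / 2 by positivity)] with ε hε
    ext S x
    change U S x + (β ε * ε) * W S x = _
    rw [β.one_of_mem_closedBall hε]
    simp
  · obtain ⟨r, hr⟩ := hc
    refine ⟨r, fun S p hp => ?_⟩
    change U S p.2 + (β p.1 * p.1) * W S p.2 - U S p.2 = 0
    rw [hr S p.2 hp]
    ring

end

/-! ### The potentials of `J` -/

section

/-- Freezing the parameter at `0`, on even families. -/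
def frzEv : Gr.Ev Sm →ₐ[ℝ] Gr.Ev Sm where
  toFun a := ⟨Gr.frz a, Gr.IsEven.coeffMap _ a.2⟩
  map_one' := Subtype.ext Gr.frz_one
  map_mul' a b := Subtype.ext (Gr.frz_mul (a : Gr Sm) b)
  map_zero' := Subtype.ext (map_zero Gr.frz)
  map_add' a b := Subtype.ext (map_add Gr.frz (a : Gr Sm) b)
  commutes' c := Subtype.ext (by
    change Gr.frz (algebraMap ℝ (Gr Sm) c) = algebraMap ℝ (Gr Sm) c
    rw [Algebra.algebraMap_eq_smul_one, map_smul, Gr.frz_one])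

/-- Freezing the parameter at `0`, on odd families. -/
def frzOd : Gr.Od Sm →ₗ[ℝ] Gr.Od Sm where
  toFun a := ⟨Gr.frz a, Gr.IsOdd.coeffMap _ a.2⟩
  map_add' a b := Subtype.ext (map_add Gr.frz (a : Gr Sm) b)
  map_smul' c a := Subtype.ext (map_smul Gr.frz c (a : Gr Sm))

@[simp] lemma coe_frzEv (a : Gr.Ev Sm) : (frzEv a : Gr Sm) = Gr.frz a := rfl
@[simp] lemma coe_frzOd (a : Gr.Od Sm) : (frzOd a : Gr Sm) = Gr.frz a := rfl

lemma endo_frz : Super.Endo frzEv frzOd where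
  smul a x := Subtype.ext (Gr.frz_mul (a : Gr Sm) x)
  map_d a := Subtype.ext (Gr.frz_superD (a : Gr Sm))
  map_δ x := Subtype.ext (Gr.frz_superD (x : Gr Sm))

lemma frzEv_pw (U : PosField) (s : ℝ) : frzEv (U.pw s) = U.frz.pw s :=
  Subtype.ext (U.frz_pw s)

/-- `D⁻¹` on even families. -/
def dInv (a : Gr.Ev Sm) : Gr.Od Sm := ⟨Gr.superDInv a, a.2.superDInv⟩

/-- `D⁻¹` on odd families. -/
def δInv (a : Gr.Od Sm) : Gr.Ev Sm := ⟨Gr.superDInv a, a.2.superDInv⟩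

lemma δ_dInv {a : Gr.Ev Sm} (h : Gr.LeftBdd (a : Gr Sm)) : SuperDiff.δ (dInv a) = a :=
  Subtype.ext (Gr.superD_superDInv h)

lemma d_δInv {a : Gr.Od Sm} (h : Gr.LeftBdd (a : Gr Sm)) : SuperDiff.d (δInv a) = a :=
  Subtype.ext (Gr.superD_superDInv h)

lemma eq_zero_of_d_eq_zero {a : Gr.Ev Sm} (h : Gr.LeftBdd (a : Gr Sm))
    (h0 : SuperDiff.d (M := Gr.Od Sm) a = 0) : a = 0 :=
  Subtype.ext (Gr.eq_zero_of_superD_eq_zero h (congrArg Subtype.val h0))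

lemma eq_zero_of_δ_eq_zero {a : Gr.Od Sm} (h : Gr.LeftBdd (a : Gr Sm))
    (h0 : SuperDiff.δ (A := Gr.Ev Sm) a = 0) : a = 0 :=
  Subtype.ext (Gr.eq_zero_of_superD_eq_zero h (congrArg Subtype.val h0))

open SuperDiff

section Potentials

variable (U : PosField) (V : Gr.Ev Sm)

/-- The potential `a = D⁻¹ U^{-3/2} V`. -/
def potA : Gr.Od Sm := dInv (U.pw (-1 / 2) ^ 3 * V)

/-- The potential `b = D⁻¹ U^{-1/2} a`. -/
def potB : Gr.Ev Sm := δInv (U.pw (-1 / 2) • potA U V)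

/-- The potential `p = D⁻¹ U D⁵ U b`. -/
def potP : Gr.Ev Sm :=
  δInv (U.pw (1 / 2) ^ 2 • d (δ (d (δ (d (U.pw (1 / 2) ^ 2 * potB U V) : Gr.Od Sm) : Gr.Ev Sm)
    : Gr.Od Sm) : Gr.Ev Sm))

/-- The potential `q = D⁻¹ U^{-1/2} p`. -/
def potQ : Gr.Od Sm := dInv (U.pw (-1 / 2) * potP U V)

/-- The value `J V = U^{-3/2} q`. -/
def valJ : Gr.Od Sm := U.pw (-1 / 2) ^ 3 • potQ U V

lemma PosField.pw_three_halves : U.pw (-3 / 2) = U.pw (-1 / 2) ^ 3 := by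
  rw [pow_succ, pow_two, ← U.pw_add, ← U.pw_add]; norm_num

lemma PosField.pw_half_sq : U.pw (1 / 2) ^ 2 = U.pw 1 := by
  rw [pow_two, ← U.pw_add]; norm_num

lemma PosField.pw_half_mul : U.pw (1 / 2) * U.pw (-1 / 2) = 1 := by
  rw [← U.pw_add, ← U.pw_zero]; norm_num

lemma coe_valJ : (valJ U V : Gr Sm) = opFam opJ U V := by
  simp only [opJ, opFam, actFam, PosField.pw_three_halves]
  rw [← U.pw_half_sq]
  rfl

variable {V} (hV : Gr.LeftBdd (V : Gr Sm))

include hV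

lemma leftBdd_potA : Gr.LeftBdd (potA U V : Gr Sm) := (hV.mul_left _).superDInv

lemma leftBdd_potB : Gr.LeftBdd (potB U V : Gr Sm) := ((leftBdd_potA U hV).mul_left _).superDInv

lemma leftBdd_potP : Gr.LeftBdd (potP U V : Gr Sm) :=
  ((leftBdd_potB U hV).mul_left _).superD.superD.superD.superD.superD.mul_left _ |>.superDInv

lemma chain_pot : Super.Chain (U.pw (1 / 2)) (U.pw (-1 / 2)) V (potA U V) (potB U V) (potP U V)
    (potQ U V) where
  ha := δ_dInv (hV.mul_left _)
  hb := d_δInv ((leftBdd_potA U hV).mul_left _)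
  hp := d_δInv (((leftBdd_potB U hV).mul_left _).superD.superD.superD.superD.superD.mul_left _)
  hq := δ_dInv ((leftBdd_potP U hV).mul_left _)

lemma frz_pot : frzOd (potA U V) = potA U.frz (frzEv V) ∧ frzEv (potB U V) = potB U.frz (frzEv V) ∧
    frzEv (potP U V) = potP U.frz (frzEv V) ∧ frzOd (potQ U V) = potQ U.frz (frzEv V) := by
  have e1 : ∀ {a : Gr.Ev Sm}, Gr.LeftBdd (a : Gr Sm) → frzOd (dInv a) = dInv (frzEv a) :=
    fun h => Subtype.ext (Gr.frz_superDInv h)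
  have e2 : ∀ {a : Gr.Od Sm}, Gr.LeftBdd (a : Gr Sm) → frzEv (δInv a) = δInv (frzOd a) :=
    fun h => Subtype.ext (Gr.frz_superDInv h)
  have hA : frzOd (potA U V) = potA U.frz (frzEv V) := by
    rw [potA, e1 (hV.mul_left _)]; simp only [map_mul, map_pow, frzEv_pw]; rfl
  have hB : frzEv (potB U V) = potB U.frz (frzEv V) := by
    rw [potB, e2 ((leftBdd_potA U hV).mul_left _)]
    simp only [endo_frz.smul, frzEv_pw, hA]; rfl
  have hP : frzEv (potP U V) = potP U.frz (frzEv V) := by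
    rw [potP, e2 (((leftBdd_potB U hV).mul_left _).superD.superD.superD.superD.superD.mul_left _)]
    simp only [endo_frz.smul, endo_frz.map_d, endo_frz.map_δ, map_mul, map_pow, frzEv_pw, hB]; rfl
  refine ⟨hA, hB, hP, ?_⟩
  rw [potQ, e1 ((leftBdd_potP U hV).mul_left _)]; simp only [map_mul, frzEv_pw, hP]; rfl

end Potentials

/-- All intermediate results in the evaluation of `w(U) F` have bounded support. -/
def AdmissibleFam : List Factor → PosField → Gr Sm → Prop
  | [], _, F => Gr.BddSupp F
  | f :: w, U, F => AdmissibleFam w U F ∧ Gr.BddSupp (opFam (f :: w) U F)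

lemma AdmissibleFam.bddSupp_opFam {w : List Factor} {U : PosField} {F : Gr Sm}
    (h : AdmissibleFam w U F) : Gr.BddSupp (opFam w U F) := by
  cases w with
  | nil => exact h
  | cons f w => exact h.2

lemma AdmissibleFam.bddSupp {w : List Factor} {U : PosField} {F : Gr Sm}
    (h : AdmissibleFam w U F) : Gr.BddSupp F := by
  induction w with
  | nil => exact h
  | cons f w ih => exact ih h.1

/-- The intermediate results in the evaluation of `J` that are given by the potentials. -/
lemma AdmissibleFam.potentials {U : PosField} {V : Gr.Ev Sm} (h : AdmissibleFam opJ U V) :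
    potA U V ∈ bddIdeal.J ∧ potB U V ∈ bddIdeal.I ∧ potP U V ∈ bddIdeal.I ∧
      potQ U V ∈ bddIdeal.J := by
  simp only [mem_bddIdeal_I, mem_bddIdeal_J]
  simp only [AdmissibleFam, opJ, opFam, actFam, U.pw_three_halves] at h
  rw [← U.pw_half_sq] at h
  obtain ⟨⟨⟨⟨⟨⟨⟨⟨⟨⟨⟨⟨⟨⟨⟨-, -⟩, hA⟩, -⟩, hB⟩, -⟩, -⟩, -⟩, -⟩, -⟩, -⟩, -⟩, hP⟩, -⟩, hQ⟩, -⟩ := h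
  exact ⟨hA, hB, hP, hQ⟩

/-- Skew-symmetry of `J`, where only one argument needs to be a testing function. -/
lemma valJ_skew (U : PosField) {V₁ V₂ : Gr.Ev Sm} (h₁ : AdmissibleFam opJ U V₁)
    (h₂ : Gr.LeftBdd (V₂ : Gr Sm)) : V₁ • valJ U V₂ + V₂ • valJ U V₁ ∈ bddIdeal.total := by
  obtain ⟨hA, hB, hP, hQ⟩ := h₁.potentials
  exact Super.DIdeal.skew_mem (chain_pot U h₁.bddSupp.leftBdd) (chain_pot U h₂) hA hB hP hQ

/-- The family `Ũ` of positive fields passes through `U` in the direction `V`. -/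
structure PosField.Tangent (U Ũ : PosField) (V : Gr.Ev Sm) : Prop where
  frz : Ũ.frz = U
  dEps : frzEv (dEpsEv Ũ.val) = V

section Closed

variable {U : PosField}

lemma PosField.Tangent.direction {Ũ : PosField} {V : Gr.Ev Sm} (h : U.Tangent Ũ V) :
    V = 2 * U.pw (1 / 2) * frzEv (dEpsEv (Ũ.pw (1 / 2))) := by
  rw [← h.dEps, ← Ũ.pw_one, ← Ũ.pw_half_sq, variation_dEps.sq]
  simp only [map_mul, map_ofNat, frzEv_pw, h.frz]

lemma PosField.Tangent.dotChain {Ũ : PosField} {W : Gr.Ev Sm} (h : U.Tangent Ũ W)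
    {V : Gr.Ev Sm} (hV : Gr.LeftBdd (V : Gr Sm)) (hf : frzEv V = V) :
    Super.DotChain (U.pw (1 / 2)) (U.pw (-1 / 2)) V (potA U V) (potB U V) (potP U V) (potQ U V)
      (frzEv (dEpsEv (Ũ.pw (1 / 2)))) (frzOd (dEpsOd (potA Ũ V))) (frzEv (dEpsEv (potB Ũ V)))
      (frzEv (dEpsEv (potP Ũ V))) (frzOd (dEpsOd (potQ Ũ V))) := by
  have hV0 : dEpsEv V = 0 := by
    rw [← hf]; exact Subtype.ext (Gr.dEps_frz _)
  have k := ((chain_pot Ũ hV).dot variation_dEps Ũ.pw_half_mul hV0).map endo_frz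
  obtain ⟨e1, e2, e3, e4⟩ := frz_pot Ũ hV
  rwa [e1, e2, e3, e4, frzEv_pw, frzEv_pw, hf, h.frz] at k

lemma PosField.Tangent.dEps_valJ {Ũ : PosField} {W : Gr.Ev Sm} (h : U.Tangent Ũ W)
    {V : Gr.Ev Sm} (hV : Gr.LeftBdd (V : Gr Sm)) (hf : frzEv V = V) :
    frzOd (dEpsOd (valJ Ũ V)) = U.pw (-1 / 2) ^ 3 • frzOd (dEpsOd (potQ Ũ V))
      - (3 * U.pw (-1 / 2) ^ 4 * frzEv (dEpsEv (Ũ.pw (1 / 2)))) • potQ U V := by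
  obtain ⟨-, -, -, e4⟩ := frz_pot Ũ hV
  rw [valJ, variation_dEps.smul, variation_dEps.cube, variation_dEps.inv Ũ.pw_half_mul]
  simp only [map_add, endo_frz.smul, map_mul, map_pow, map_neg, map_ofNat, frzEv_pw, e4, hf, h.frz]
  module

/-- The antisymmetrized variation of `c = U b` is the super Witt bracket: the constants of
integration left open by `Super.dot_first_symm` and `Super.dot_second_symm` vanish, because the
potentials vanish near `-∞`. -/
lemma PosField.Tangent.bracket {V₁ V₃ : Gr.Ev Sm} {U₁ U₃ : PosField} (t₁ : U.Tangent U₁ V₁)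
    (t₃ : U.Tangent U₃ V₃) (l₁ : Gr.LeftBdd (V₁ : Gr Sm)) (l₃ : Gr.LeftBdd (V₃ : Gr Sm))
    (f₁ : frzEv V₁ = V₁) (f₃ : frzEv V₃ = V₃) :
    2 * ((2 * U.pw (1 / 2) * frzEv (dEpsEv (U₃.pw (1 / 2))) * potB U V₁
        + U.pw (1 / 2) ^ 2 * frzEv (dEpsEv (potB U₃ V₁)))
      - (2 * U.pw (1 / 2) * frzEv (dEpsEv (U₁.pw (1 / 2))) * potB U V₃
        + U.pw (1 / 2) ^ 2 * frzEv (dEpsEv (potB U₁ V₃)))) =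
      2 * ((U.pw (1 / 2) ^ 2 * potB U V₁) * δ (d (U.pw (1 / 2) ^ 2 * potB U V₃) : Gr.Od Sm)
        - (U.pw (1 / 2) ^ 2 * potB U V₃) * δ (d (U.pw (1 / 2) ^ 2 * potB U V₁) : Gr.Od Sm))
        - pr (d (U.pw (1 / 2) ^ 2 * potB U V₃) : Gr.Od Sm) (d (U.pw (1 / 2) ^ 2 * potB U V₁)) := by
  have c₁ := chain_pot U l₁
  have c₃ := chain_pot U l₃
  have d₁₃ := t₃.dotChain l₁ f₁
  have d₃₁ := t₁.dotChain l₃ f₃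
  have ha := eq_zero_of_δ_eq_zero
    ((leftBdd_potA U₃ l₁).dEps.frz.sub (leftBdd_potA U₁ l₃).dEps.frz)
    (Super.dot_first_symm U.pw_half_mul t₁.direction t₃.direction d₁₃ d₃₁)
  rw [sub_eq_zero] at ha
  rw [← ha] at d₃₁
  have hlb := (((leftBdd_potB U₃ l₁).dEps.frz.sub (leftBdd_potB U₁ l₃).dEps.frz).mul_left
    ((2 : Gr.Ev Sm) : Gr Sm)).add ((leftBdd_potA U l₁).mul_left (potA U V₃ : Gr Sm))
  have hb := eq_zero_of_d_eq_zero (a := 2 * (frzEv (dEpsEv (potB U₃ V₁)) -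
    frzEv (dEpsEv (potB U₁ V₃))) + pr (potA U V₃) (potA U V₁)) hlb
    (Super.dot_second_symm U.pw_half_mul t₁.direction t₃.direction c₁ c₃ d₁₃ d₃₁)
  exact Super.dot_bracket U.pw_half_mul t₁.direction t₃.direction c₁ c₃ hb

/-- The 2-form `⟨V₁, J V₂⟩` is closed. -/
lemma valJ_closed {V₁ V₂ V₃ : Gr.Ev Sm} {U₁ U₂ U₃ : PosField} (t₁ : U.Tangent U₁ V₁)
    (t₂ : U.Tangent U₂ V₂) (t₃ : U.Tangent U₃ V₃) (f₁ : frzEv V₁ = V₁) (f₂ : frzEv V₂ = V₂)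
    (f₃ : frzEv V₃ = V₃) (a₁ : AdmissibleFam opJ U V₁) (a₂ : AdmissibleFam opJ U V₂)
    (a₃ : AdmissibleFam opJ U V₃) :
    V₁ • frzOd (dEpsOd (valJ U₂ V₃)) + V₂ • frzOd (dEpsOd (valJ U₃ V₁))
      + V₃ • frzOd (dEpsOd (valJ U₁ V₂)) ∈ bddIdeal.total := by
  obtain ⟨A₁, B₁, P₁, Q₁⟩ := a₁.potentials
  obtain ⟨A₂, B₂, P₂, Q₂⟩ := a₂.potentials
  obtain ⟨A₃, B₃, P₃, Q₃⟩ := a₃.potentials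
  have l₁ := a₁.bddSupp.leftBdd
  have l₂ := a₂.bddSupp.leftBdd
  have l₃ := a₃.bddSupp.leftBdd
  have c₁ := chain_pot U l₁
  have c₂ := chain_pot U l₂
  have c₃ := chain_pot U l₃
  rw [t₂.dEps_valJ l₃ f₃, t₃.dEps_valJ l₁ f₁, t₁.dEps_valJ l₂ f₂]
  exact Super.DIdeal.closed_sum_mem (bddIdeal.I.mul_mem_left _ B₁) (bddIdeal.I.mul_mem_left _ B₂)
    (bddIdeal.I.mul_mem_left _ B₃)
    (Super.DIdeal.dot_pair_mem c₁ c₃ (t₂.dotChain l₁ f₁) (t₂.dotChain l₃ f₃) A₁ B₁ P₃ Q₃)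
    (Super.DIdeal.dot_pair_mem c₂ c₁ (t₃.dotChain l₂ f₂) (t₃.dotChain l₁ f₁) A₂ B₂ P₁ Q₁)
    (Super.DIdeal.dot_pair_mem c₃ c₂ (t₁.dotChain l₃ f₃) (t₁.dotChain l₂ f₂) A₃ B₃ P₂ Q₂)
    (t₁.bracket t₃ l₁ l₃ f₁ f₃) (t₂.bracket t₁ l₂ l₁ f₂ f₁) (t₃.bracket t₂ l₃ l₂ f₃ f₂)

end Closed

end

section

open SuperDiff

/-! ### From superfields to constant families -/

lemma CompactSupp.leftBounded {F : Superfield} (hc : CompactSupp F) (h : Smooth F) :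
    LeftBounded F := by
  obtain ⟨r, hr⟩ := hc
  exact ⟨h, -r, fun S x hx => hr S x (by linarith [neg_le_abs x])⟩

lemma bddSupp_of_frz {F : Gr Sm} (h : Gr.frz F = F) (hc : CompactSupp (ev 0 F)) :
    Gr.BddSupp F := by
  rw [← h]
  exact hc.lift (smooth_ev 0 F)

lemma Admissible.compactSupp {w : List Factor} {U F : Superfield} (h : Admissible w U F) :
    CompactSupp F := by
  induction w with
  | nil => exact h
  | cons f w ih => exact ih h.1

lemma Admissible.lift {w : List Factor} {U F : Superfield} (h : Admissible w U F)
    (hU : IsPositiveField U) (hF : Smooth F) : AdmissibleFam w hU.lift (lift F hF) := by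
  induction w with
  | nil => exact CompactSupp.lift h hF
  | cons f w ih =>
    have hl := (h.compactSupp.leftBounded hF).lift
    refine ⟨ih h.1, bddSupp_of_frz (frz_opFam (f :: w) hU.lift hl) ?_⟩
    rw [ev_opFam 0 _ _ hl]
    exact h.2

lemma op_eq_ev {U : Superfield} (hU : IsPositiveField U) {F : Superfield} (hF : LeftBounded F)
    (w : List Factor) : op w U F = ev 0 (opFam w hU.lift (lift F hF.1)) :=
  (ev_opFam 0 w hU.lift hF.lift).symm

lemma pairing_ev (F G : Gr Sm) : pairing (ev 0 F) (ev 0 G) = superIntegral (ev 0 (F * G)) := by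
  rw [pairing, ev_mul]

/-- The constant family of even elements. -/
def evLift {F : Superfield} (h : Smooth F) (hb : Bosonic F) : Gr.Ev Sm := ⟨lift F h, hb.lift h⟩

/-- The constant family of odd elements. -/
def odLift {F : Superfield} (h : Smooth F) (hb : Fermionic F) : Gr.Od Sm := ⟨lift F h, hb.lift h⟩

lemma IsPerturbation.tangent {V : PosField} {U W : Superfield} (h : IsPerturbation V U W)
    (hU : IsPositiveField U) (hW : Smooth W) (hb : Bosonic W) :
    hU.lift.Tangent V (evLift hW hb) :=
  ⟨h.frz_eq hU, Subtype.ext (h.frz_dEps hW)⟩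

lemma pairing_ev_Ev (a : Gr.Ev Sm) (x : Gr.Od Sm) :
    pairing (ev 0 (a : Gr Sm)) (ev 0 (x : Gr Sm)) =
      superIntegral (ev 0 ((a • x : Gr.Od Sm) : Gr Sm)) :=
  pairing_ev _ _

lemma pairing_ev_Od (a : Gr.Ev Sm) (x : Gr.Od Sm) :
    pairing (ev 0 (x : Gr Sm)) (ev 0 (a : Gr Sm)) =
      superIntegral (ev 0 ((a • x : Gr.Od Sm) : Gr Sm)) := by
  rw [pairing_ev, Gr.coe_smul, a.2.mul_comm]

lemma superIntegral_add_of_total {x y : Gr.Od Sm} (hx : Gr.BddSupp (x : Gr Sm))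
    (hy : Gr.BddSupp (y : Gr Sm)) (h : x + y ∈ bddIdeal.total) :
    superIntegral (ev 0 (x : Gr Sm)) = -superIntegral (ev 0 (y : Gr Sm)) := by
  rw [eq_neg_iff_add_eq_zero, ← superIntegral_ev_add 0 hx hy]
  exact superIntegral_total 0 h

lemma superIntegral_add_add_of_total {x y z : Gr.Od Sm} (hx : Gr.BddSupp (x : Gr Sm))
    (hy : Gr.BddSupp (y : Gr Sm)) (hz : Gr.BddSupp (z : Gr Sm))
    (h : x + y + z ∈ bddIdeal.total) :
    superIntegral (ev 0 (x : Gr Sm)) + superIntegral (ev 0 (y : Gr Sm)) +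
      superIntegral (ev 0 (z : Gr Sm)) = 0 := by
  rw [← superIntegral_ev_add 0 hx hy, ← superIntegral_ev_add 0 (hx.add hy) hz]
  exact superIntegral_total 0 h

/-! ### `J` is symplectic -/

theorem isSymplectic_opJ : IsSymplectic opJ where
  skew U hU V₁ V₂ h₁ h₂ := by
    have a₁ : AdmissibleFam opJ hU.lift (evLift h₁.smooth h₁.bosonic) :=
      h₁.admissible.lift hU h₁.smooth
    have a₂ : AdmissibleFam opJ hU.lift (evLift h₂.smooth h₂.bosonic) :=
      h₂.admissible.lift hU h₂.smooth
    have e : ∀ {V : Superfield} (h : BosonicTest opJ U V), op opJ U V =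
        ev 0 (valJ hU.lift (evLift h.smooth h.bosonic) : Gr Sm) := fun h => by
      rw [coe_valJ]
      exact op_eq_ev hU (h.admissible.compactSupp.leftBounded h.smooth) opJ
    rw [e h₁, e h₂]
    exact (pairing_ev_Ev _ _).trans ((superIntegral_add_of_total (a₁.bddSupp.mul_right _)
      (a₂.bddSupp.mul_right _) (valJ_skew hU.lift a₁ a₂.bddSupp.leftBdd)).trans
        (congrArg _ (pairing_ev_Ev _ _).symm))
  closed U hU V₁ V₂ V₃ h₁ h₂ h₃ := by
    have a₁ : AdmissibleFam opJ hU.lift (evLift h₁.smooth h₁.bosonic) :=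
      h₁.admissible.lift hU h₁.smooth
    have a₂ : AdmissibleFam opJ hU.lift (evLift h₂.smooth h₂.bosonic) :=
      h₂.admissible.lift hU h₂.smooth
    have a₃ : AdmissibleFam opJ hU.lift (evLift h₃.smooth h₃.bosonic) :=
      h₃.admissible.lift hU h₃.smooth
    obtain ⟨U₁, p₁, -⟩ := hU.exists_family h₁.smooth h₁.bosonic h₁.admissible.compactSupp
    obtain ⟨U₂, p₂, -⟩ := hU.exists_family h₂.smooth h₂.bosonic h₂.admissible.compactSupp
    obtain ⟨U₃, p₃, -⟩ := hU.exists_family h₃.smooth h₃.bosonic h₃.admissible.compactSupp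
    have k := valJ_closed (p₁.tangent hU h₁.smooth h₁.bosonic)
      (p₂.tangent hU h₂.smooth h₂.bosonic) (p₃.tangent hU h₃.smooth h₃.bosonic) rfl rfl rfl a₁ a₂ a₃
    refine ⟨_, _, _,
      p₂.hasFrechetDeriv (h₃.admissible.compactSupp.leftBounded h₃.smooth) opJ,
      p₃.hasFrechetDeriv (h₁.admissible.compactSupp.leftBounded h₁.smooth) opJ,
      p₁.hasFrechetDeriv (h₂.admissible.compactSupp.leftBounded h₂.smooth) opJ, ?_⟩
    have e : ∀ {V W : Superfield} (hV : BosonicTest opJ U V) (hW : BosonicTest opJ U W)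
        (Ũ : PosField), pairing V (ev 0 (Gr.dEps (opFam opJ Ũ (lift W hW.smooth)))) =
          superIntegral (ev 0 ((evLift hV.smooth hV.bosonic •
            frzOd (dEpsOd (valJ Ũ (evLift hW.smooth hW.bosonic))) : Gr.Od Sm) : Gr Sm)) := by
      intro V W hV hW Ũ
      rw [← pairing_ev_Ev, coe_frzOd, coe_dEpsOd, coe_valJ]
      rfl
    rw [e h₁ h₃, e h₂ h₁, e h₃ h₂]
    exact superIntegral_add_add_of_total (a₁.bddSupp.mul_right _) (a₂.bddSupp.mul_right _)
      (a₃.bddSupp.mul_right _) k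

/-! ### Inverse words -/

/-- The inverse factor. -/
def invFactor : Factor → Factor
  | .pow s => .pow (-s)
  | .der => .inv
  | .inv => .der

/-- The product of the inverse factors, in reverse order. -/
def invWord : List Factor → List Factor
  | [] => []
  | f :: w => invWord w ++ [invFactor f]

lemma invWord_opQ : invWord opQ = opJ := by
  simp only [invWord, opQ, opJ, invFactor, List.nil_append, List.cons_append]
  norm_num

lemma invWord_opJ : invWord opJ = opQ := by
  simp only [invWord, opQ, opJ, invFactor, List.nil_append, List.cons_append]
  norm_num

lemma invWord_opP : invWord opP = opPInv := by
  simp only [invWord, opP, opPInv, invFactor, List.nil_append, List.cons_append]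

lemma invWord_opPInv : invWord opPInv = opP := by
  simp only [invWord, opP, opPInv, invFactor, List.nil_append, List.cons_append, neg_neg]

lemma opFam_append (w₁ w₂ : List Factor) (U : PosField) (F : Gr Sm) :
    opFam (w₁ ++ w₂) U F = opFam w₁ U (opFam w₂ U F) := by
  induction w₁ with
  | nil => rfl
  | cons f w ih => rw [List.cons_append, opFam, ih]; rfl

lemma actFam_invFactor (U : PosField) (f : Factor) {F : Gr Sm} (hF : Gr.LeftBdd F) :
    actFam U (invFactor f) (actFam U f F) = F := by
  cases f with
  | pow s =>
    change (U.pw (-s) : Gr Sm) * ((U.pw s : Gr Sm) * F) = F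
    rw [← mul_assoc]
    have := congrArg Subtype.val (U.pw_neg_mul s)
    change (U.pw (-s) : Gr Sm) * (U.pw s : Gr Sm) = 1 at this
    rw [this, one_mul]
  | der => exact Gr.superDInv_superD hF
  | inv => exact Gr.superD_superDInv hF

lemma opFam_invWord (w : List Factor) (U : PosField) {F : Gr Sm} (hF : Gr.LeftBdd F) :
    opFam (invWord w) U (opFam w U F) = F := by
  induction w with
  | nil => rfl
  | cons f w ih =>
    rw [invWord, opFam_append]
    change opFam (invWord w) U (actFam U (invFactor f) (actFam U f (opFam w U F))) = F
    rw [actFam_invFactor U f (leftBdd_opFam hF U w), ih]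

lemma AdmissibleFam.append {w₁ w₂ : List Factor} {U : PosField} {F : Gr Sm}
    (h₂ : AdmissibleFam w₂ U F) (h₁ : AdmissibleFam w₁ U (opFam w₂ U F)) :
    AdmissibleFam (w₁ ++ w₂) U F := by
  induction w₁ with
  | nil => exact h₂
  | cons f w ih =>
    refine ⟨ih h₁.1, ?_⟩
    have := h₁.2
    rwa [← opFam_append] at this

lemma AdmissibleFam.invWord {w : List Factor} {U : PosField} {F : Gr Sm}
    (h : AdmissibleFam w U F) : AdmissibleFam (invWord w) U (opFam w U F) := by
  induction w with
  | nil => exact h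
  | cons f w ih =>
    have e := actFam_invFactor U f (leftBdd_opFam h.bddSupp.leftBdd U w)
    refine AdmissibleFam.append ⟨h.2, ?_⟩ ?_
    · change Gr.BddSupp (actFam U (invFactor f) (actFam U f (opFam w U F)))
      rw [e]
      exact h.1.bddSupp_opFam
    · change AdmissibleFam _ U (actFam U (invFactor f) (actFam U f (opFam w U F)))
      rw [e]
      exact ih h.1

lemma op_op_eq_ev {U : Superfield} (hU : IsPositiveField U) {F : Superfield} (hF : LeftBounded F)
    (w₁ w₂ : List Factor) :
    op w₁ U (op w₂ U F) = ev 0 (opFam w₁ hU.lift (opFam w₂ hU.lift (lift F hF.1))) := by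
  rw [ev_opFam 0 w₁ _ (leftBdd_opFam hF.lift _ _), ← op_eq_ev hU hF]
  rfl

lemma areInverse_of_invWord {w₁ w₂ : List Factor} (h₁₂ : invWord w₁ = w₂)
    (h₂₁ : invWord w₂ = w₁) : AreInverse w₁ w₂ := by
  intro U hU F hF
  rw [op_op_eq_ev hU hF, op_op_eq_ev hU hF]
  constructor
  · rw [← h₂₁, opFam_invWord w₂ hU.lift hF.lift]; rfl
  · rw [← h₁₂, opFam_invWord w₁ hU.lift hF.lift]; rfl

/-! ### `Q` is Hamiltonian -/

/-- The value `Q α`. -/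
def valQ (U : PosField) (α : Gr.Od Sm) : Gr.Ev Sm :=
  U.pw (3 / 2) * δ (U.pw (1 / 2) • (d (U.pw (-1) * δInv (dInv (δInv (dInv (δInv (U.pw (-1) •
    (d (U.pw (1 / 2) * δ (U.pw (3 / 2) • α)) : Gr.Od Sm))))))) : Gr.Od Sm))

lemma coe_valQ (U : PosField) (α : Gr.Od Sm) : (valQ U α : Gr Sm) = opFam opQ U α := rfl

lemma valJ_valQ (U : PosField) {α : Gr.Od Sm} (hα : Gr.LeftBdd (α : Gr Sm)) :
    valJ U (valQ U α) = α := Subtype.ext (by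
  rw [coe_valJ, coe_valQ, ← invWord_opQ, opFam_invWord opQ U hα])

lemma leftBdd_valQ (U : PosField) {α : Gr.Od Sm} (hα : Gr.LeftBdd (α : Gr Sm)) :
    Gr.LeftBdd (valQ U α : Gr Sm) := leftBdd_opFam hα U opQ

lemma AdmissibleFam.valQ {U : PosField} {α : Gr.Od Sm} (h : AdmissibleFam opQ U α) :
    AdmissibleFam opJ U (valQ U α) := by
  have := h.invWord
  rwa [invWord_opQ] at this

lemma frz_valQ (U : PosField) {α : Gr.Od Sm} (hα : Gr.LeftBdd (α : Gr Sm)) :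
    frzEv (valQ U α) = valQ U.frz (frzOd α) := Subtype.ext (frz_opFam opQ U hα)

/-- Skew-symmetry of `Q`, from that of its inverse. -/
lemma valQ_skew {U : PosField} {α β : Gr.Od Sm} (hα : AdmissibleFam opQ U α)
    (hβ : Gr.LeftBdd (β : Gr Sm)) : valQ U β • α + valQ U α • β ∈ bddIdeal.total := by
  have := valJ_skew U hα.valQ (leftBdd_valQ U hβ)
  rwa [valJ_valQ U hβ, valJ_valQ U hα.bddSupp.leftBdd, add_comm] at this

/-- Differentiating `J Q γ = γ` gives `J (Q' γ) = -J' (Q γ)`; by skew-symmetry of `J`,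
`⟨Q' γ, α⟩ = ⟨Q' γ, J Q α⟩ = ⟨Q α, J' (Q γ)⟩`. -/
lemma dEps_valQ {U Ũ : PosField} (hŨ : Ũ.frz = U) {α γ : Gr.Od Sm} (hα : AdmissibleFam opQ U α)
    (hγ : Gr.LeftBdd (γ : Gr Sm)) (fγ : frzOd γ = γ) :
    frzEv (dEpsEv (valQ Ũ γ)) • α - valQ U α • frzOd (dEpsOd (valJ Ũ (valQ U γ)))
      ∈ bddIdeal.total := by
  have hl := leftBdd_valQ Ũ hγ
  have h1 : frzOd (dEpsOd (valJ Ũ (valQ U γ))) + valJ U (frzEv (dEpsEv (valQ Ũ γ))) = 0 := by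
    apply Subtype.ext
    have h2 := frz_dEps_opFam opJ Ũ hl
    have h3 : opFam opJ Ũ (valQ Ũ γ) = γ := by
      rw [← coe_valJ, valJ_valQ Ũ hγ]
    have h4 : Gr.frz (valQ Ũ γ : Gr Sm) = (valQ U γ : Gr Sm) := by
      have := congrArg Subtype.val (frz_valQ Ũ hγ)
      rwa [fγ, hŨ] at this
    have h5 : Gr.dEps (γ : Gr Sm) = 0 := by
      have := Gr.dEps_frz (γ : Gr Sm)
      rwa [← coe_frzOd, fγ] at this
    rw [h3, h4, h5, map_zero, hŨ, ← coe_valJ] at h2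
    have h6 := coe_valJ U (frzEv (dEpsEv (valQ Ũ γ)))
    rw [coe_frzEv, coe_dEpsEv] at h6
    rw [← h6] at h2
    exact h2.symm
  have h7 := valJ_skew U hα.valQ (V₂ := frzEv (dEpsEv (valQ Ũ γ))) hl.dEps.frz
  rw [valJ_valQ U hα.bddSupp.leftBdd, eq_neg_of_add_eq_zero_right h1] at h7
  convert h7 using 1
  module

/-- The Jacobi identity of `Q` is the closedness of the 2-form of its inverse. -/
lemma valQ_jacobi {U U₁ U₂ U₃ : PosField} {α₁ α₂ α₃ : Gr.Od Sm}
    (t₁ : U.Tangent U₁ (valQ U α₁)) (t₂ : U.Tangent U₂ (valQ U α₂))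
    (t₃ : U.Tangent U₃ (valQ U α₃)) (f₁ : frzOd α₁ = α₁) (f₂ : frzOd α₂ = α₂)
    (f₃ : frzOd α₃ = α₃) (a₁ : AdmissibleFam opQ U α₁) (a₂ : AdmissibleFam opQ U α₂)
    (a₃ : AdmissibleFam opQ U α₃) :
    frzEv (dEpsEv (valQ U₂ α₃)) • α₁ + frzEv (dEpsEv (valQ U₃ α₁)) • α₂
      + frzEv (dEpsEv (valQ U₁ α₂)) • α₃ ∈ bddIdeal.total := by
  have hUU : U.frz = U := by rw [← t₁.frz]; rfl
  have fv : ∀ {α : Gr.Od Sm}, frzOd α = α → AdmissibleFam opQ U α →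
      frzEv (valQ U α) = valQ U α := fun f a => by
    rw [frz_valQ U a.bddSupp.leftBdd, f, hUU]
  have k := valJ_closed t₁ t₂ t₃ (fv f₁ a₁) (fv f₂ a₂) (fv f₃ a₃) a₁.valQ a₂.valQ a₃.valQ
  have k₁ := dEps_valQ t₂.frz a₁ a₃.bddSupp.leftBdd f₃
  have k₂ := dEps_valQ t₃.frz a₂ a₁.bddSupp.leftBdd f₁
  have k₃ := dEps_valQ t₁.frz a₃ a₂.bddSupp.leftBdd f₂
  convert add_mem (add_mem (add_mem k k₁) k₂) k₃ using 1
  abel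

/-- An operator from odd to even families, given by a product `w`, whose bilinear form and the
Jacobi expression are total derivatives, is Hamiltonian. -/
lemma isHamiltonian_of_total {w : List Factor} (val : PosField → Gr.Od Sm → Gr.Ev Sm)
    (hval : ∀ U α, (val U α : Gr Sm) = opFam w U α)
    (skew : ∀ {U : PosField} {α β : Gr.Od Sm}, AdmissibleFam w U α → AdmissibleFam w U β →
      val U β • α + val U α • β ∈ bddIdeal.total)
    (jacobi : ∀ {U U₁ U₂ U₃ : PosField} {α₁ α₂ α₃ : Gr.Od Sm},
      U.Tangent U₁ (val U α₁) → U.Tangent U₂ (val U α₂) → U.Tangent U₃ (val U α₃) →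
      frzOd α₁ = α₁ → frzOd α₂ = α₂ → frzOd α₃ = α₃ →
      AdmissibleFam w U α₁ → AdmissibleFam w U α₂ → AdmissibleFam w U α₃ →
      frzEv (dEpsEv (val U₂ α₃)) • α₁ + frzEv (dEpsEv (val U₃ α₁)) • α₂
        + frzEv (dEpsEv (val U₁ α₂)) • α₃ ∈ bddIdeal.total) : IsHamiltonian w where
  skew U hU α β hα hβ := by
    have a₁ : AdmissibleFam w hU.lift (odLift hα.smooth hα.fermionic) :=
      hα.admissible.lift hU hα.smooth
    have a₂ : AdmissibleFam w hU.lift (odLift hβ.smooth hβ.fermionic) :=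
      hβ.admissible.lift hU hβ.smooth
    have e : ∀ {α : Superfield} (h : FermionicTest w U α), op w U α =
        ev 0 (val hU.lift (odLift h.smooth h.fermionic) : Gr Sm) := fun h => by
      rw [hval]
      exact op_eq_ev hU (h.admissible.compactSupp.leftBounded h.smooth) w
    rw [e hα, e hβ]
    exact (pairing_ev_Od _ _).trans ((superIntegral_add_of_total (a₁.bddSupp.mul_left _)
      (a₂.bddSupp.mul_left _) (skew a₁ a₂)).trans
        (congrArg _ (pairing_ev_Od _ _).symm))
  jacobi U hU α β γ hα hβ hγ := by
    have a : ∀ {α : Superfield} (h : FermionicTest w U α),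
      AdmissibleFam w hU.lift (odLift h.smooth h.fermionic) :=
    fun h => h.admissible.lift hU h.smooth
    have e : ∀ {α : Superfield} (h : FermionicTest w U α), op w U α =
        ev 0 (val hU.lift (odLift h.smooth h.fermionic) : Gr Sm) := fun h => by
      rw [hval]
      exact op_eq_ev hU (h.admissible.compactSupp.leftBounded h.smooth) w
    have fz : ∀ {α : Superfield} (h : FermionicTest w U α),
        Gr.frz (val hU.lift (odLift h.smooth h.fermionic) : Gr Sm) =
          val hU.lift (odLift h.smooth h.fermionic) := fun h => by
      rw [hval, frz_opFam _ _ (a h).bddSupp.leftBdd]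
      rfl
    have key : ∀ {α : Superfield} (h : FermionicTest w U α), ∃ V : PosField,
        IsPerturbation V U (op w U α) ∧
          hU.lift.Tangent V (val hU.lift (odLift h.smooth h.fermionic)) := fun {α} h => by
      have hs : Smooth (op w U α) := by rw [e h]; exact smooth_ev 0 _
      have hb : Bosonic (op w U α) := by rw [e h]; exact bosonic_ev 0 (Subtype.property _)
      have hc : CompactSupp (op w U α) := by
        rw [e h]
        apply compactSupp_ev
        rw [hval]
        exact (a h).bddSupp_opFam
      obtain ⟨V, hV, -⟩ := hU.exists_family hs hb hc
      refine ⟨V, hV, hV.frz_eq hU, Subtype.ext ?_⟩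
      rw [← fz h]
      refine (hV.frz_dEps hs).trans ?_
      rw [frz_eq_lift]
      congr 1
      exact e h
    obtain ⟨U₁, p₁, t₁⟩ := key hα
    obtain ⟨U₂, p₂, t₂⟩ := key hβ
    obtain ⟨U₃, p₃, t₃⟩ := key hγ
    refine ⟨_, _, _,
      p₂.hasFrechetDeriv (hγ.admissible.compactSupp.leftBounded hγ.smooth) w,
      p₃.hasFrechetDeriv (hα.admissible.compactSupp.leftBounded hα.smooth) w,
      p₁.hasFrechetDeriv (hβ.admissible.compactSupp.leftBounded hβ.smooth) w, ?_⟩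
    have ep : ∀ {α γ : Superfield} (h : FermionicTest w U α) (hγ : FermionicTest w U γ)
        (Ũ : PosField), pairing α (ev 0 (Gr.dEps (opFam w Ũ (lift γ hγ.smooth)))) =
          superIntegral (ev 0 ((frzEv (dEpsEv (val Ũ (odLift hγ.smooth hγ.fermionic))) •
            odLift h.smooth h.fermionic : Gr.Od Sm) : Gr Sm)) := by
      intro α γ h hγ Ũ
      rw [← pairing_ev_Od, coe_frzEv, coe_dEpsEv, hval]
      rfl
    rw [ep hα hγ, ep hβ hα, ep hγ hβ]
    exact superIntegral_add_add_of_total ((a hα).bddSupp.mul_left _) ((a hβ).bddSupp.mul_left _)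
      ((a hγ).bddSupp.mul_left _) (jacobi t₁ t₂ t₃ rfl rfl rfl (a hα) (a hβ) (a hγ))

theorem isHamiltonian_opQ : IsHamiltonian opQ :=
  isHamiltonian_of_total valQ coe_valQ (fun h₁ h₂ => valQ_skew h₁ h₂.bddSupp.leftBdd) valQ_jacobi

/-! ### `P` is Hamiltonian -/

/-- The value `P α`. -/
def valP (U : PosField) (α : Gr.Od Sm) : Gr.Ev Sm :=
  U.val ^ 2 * δ (d (δ (U.val ^ 2 • α) : Gr.Ev Sm) : Gr.Od Sm)

lemma PosField.pw_two (U : PosField) : U.pw 2 = U.val ^ 2 := by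
  rw [pow_two, ← U.pw_one, ← U.pw_add]; norm_num

lemma coe_valP (U : PosField) (α : Gr.Od Sm) : (valP U α : Gr Sm) = opFam opP U α := by
  rw [valP, ← U.pw_two]
  rfl

lemma valP_skew {U : PosField} {α β : Gr.Od Sm} (hα : AdmissibleFam opP U α) :
    valP U β • α + valP U α • β ∈ bddIdeal.total := by
  have := Super.DIdeal.cubic_mem (S := bddIdeal) (bddIdeal.J.smul_mem (U.val ^ 2) hα.bddSupp)
    (U.val ^ 2 • β)
  convert this using 1
  rw [valP, valP]
  module

lemma valP_jacobi {U U₁ U₂ U₃ : PosField} {α₁ α₂ α₃ : Gr.Od Sm}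
    (t₁ : U.Tangent U₁ (valP U α₁)) (t₂ : U.Tangent U₂ (valP U α₂))
    (t₃ : U.Tangent U₃ (valP U α₃)) (f₁ : frzOd α₁ = α₁) (f₂ : frzOd α₂ = α₂)
    (f₃ : frzOd α₃ = α₃) (a₁ : AdmissibleFam opP U α₁) (a₂ : AdmissibleFam opP U α₂)
    (a₃ : AdmissibleFam opP U α₃) :
    frzEv (dEpsEv (valP U₂ α₃)) • α₁ + frzEv (dEpsEv (valP U₃ α₁)) • α₂
      + frzEv (dEpsEv (valP U₁ α₂)) • α₃ ∈ bddIdeal.total := by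
  have e : ∀ {Ũ : PosField} {V : Gr.Ev Sm} {γ : Gr.Od Sm}, U.Tangent Ũ V → frzOd γ = γ →
      frzEv (dEpsEv (valP Ũ γ)) = 2 * U.val * V * δ (d (δ (U.val ^ 2 • γ) : Gr.Ev Sm) : Gr.Od Sm)
        + U.val ^ 2 * δ (d (δ ((2 * U.val * V) • γ) : Gr.Ev Sm) : Gr.Od Sm) := by
    intro Ũ V γ t f
    have hγ : dEpsOd γ = 0 := by rw [← f]; exact Subtype.ext (Gr.dEps_frz _)
    have hU : frzEv Ũ.val = U.val := by rw [← t.frz]; rfl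
    have hT := variation_dEps
    simp only [valP, hT.mul, hT.map_δ, hT.map_d, hT.smul, hT.sq, hγ, smul_zero, zero_add, map_add,
      map_mul, map_pow, endo_frz.map_d, endo_frz.map_δ, endo_frz.smul, hU, f, t.dEps, map_ofNat]
    ring
  rw [e t₂ f₃, e t₃ f₁, e t₁ f₂]
  exact Super.DIdeal.jacobi_cubic_mem (S := bddIdeal) a₁.bddSupp a₂.bddSupp a₃.bddSupp rfl rfl rfl

theorem isHamiltonian_opP : IsHamiltonian opP :=
  isHamiltonian_of_total valP coe_valP (fun h₁ _ => valP_skew h₁) valP_jacobi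

end

/-! ### The recursion operator -/

section Ring

variable {E : Type*} [Ring E]

/-- With `𝔇ₖ = e + k h` and `i = e⁻¹`, the product `𝔇₁ 𝔇₂ e⁻² 𝔇₋₁ 𝔇₀ 𝔇₁ e⁻² 𝔇₋₂ 𝔇₋₁` is even
in `h`. -/
lemma even_product {e i h : E} (hei : e * i = 1) (hie : i * e = 1) (hh : h * h = 0) :
    (e + h) * ((e + h + h) * (i * (i * ((e - h) * (e * ((e + h) * (i * (i * ((e - h - h) *
      (e - h)))))))))) =
    (e - h) * ((e - h - h) * (i * (i * ((e + h) * (e * ((e - h) * (i * (i * ((e + h + h) *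
      (e + h)))))))))) := by
  have r1 : ∀ x, e * (i * x) = x := fun x => by rw [← mul_assoc, hei, one_mul]
  have r2 : ∀ x, i * (e * x) = x := fun x => by rw [← mul_assoc, hie, one_mul]
  have r3 : ∀ x, h * (h * x) = 0 := fun x => by rw [← mul_assoc, hh, zero_mul]
  simp only [add_mul, sub_mul, mul_add, mul_sub, hei, hie, hh, r1, r2, r3, mul_zero, zero_add,
    add_zero, sub_zero, mul_one]
  abel

/-- The factorization `J = P⁻¹ R` in a ring with an invertible element `φ` (the multiplication by
`U^{1/2}`) and an invertible element `D` such that `[D, φ]` has square zero and commutes with `φ`.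
Conjugation of `φ D` by `φ` adds `[D, φ]`, which turns the claim into the symmetry of
`even_product`. -/
lemma recursion_identity {φ ψ D I : E} (hφψ : φ * ψ = 1) (hψφ : ψ * φ = 1) (hDI : D * I = 1)
    (hID : I * D = 1) (hsq : (D * φ - φ * D) * (D * φ - φ * D) = 0)
    (hcomm : (D * φ - φ * D) * φ = φ * (D * φ - φ * D)) :
    ψ ^ 3 * I * ψ * I * φ ^ 2 * D * D * D * D * D * φ ^ 2 * I * ψ * I * ψ ^ 3 =
    ψ ^ 4 * I * I * I * ψ ^ 4 *
    (φ ^ 3 * D * φ * D * ψ ^ 2 * I * I * φ ^ 2 * D * φ ^ 2 * D * ψ ^ 2 * I * ψ * I * ψ * D *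
      φ ^ 2 * D * φ ^ 2 * D * ψ * I * ψ * I * ψ ^ 2 * D * φ ^ 2 * D * φ ^ 2 * D * D * D *
      φ ^ 2 * I * ψ * I * ψ ^ 3) := by
  have c1 : ∀ x, φ * (ψ * x) = x := fun x => by rw [← mul_assoc, hφψ, one_mul]
  have c2 : ∀ x, ψ * (φ * x) = x := fun x => by rw [← mul_assoc, hψφ, one_mul]
  have c3 : ∀ x, D * (I * x) = x := fun x => by rw [← mul_assoc, hDI, one_mul]
  have c4 : ∀ x, I * (D * x) = x := fun x => by rw [← mul_assoc, hID, one_mul]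
  obtain ⟨h, hh⟩ : ∃ h, h = D * φ - φ * D := ⟨_, rfl⟩
  rw [← hh] at hsq hcomm
  have hψ : h * ψ = ψ * h := by
    have := congrArg (fun x => ψ * (x * ψ)) hcomm
    simpa only [mul_assoc, hφψ, mul_one, c2] using this.symm
  -- the conjugates of `φ D` by powers of `φ`
  have g1 : D * φ = φ * D + h := by rw [hh]; abel
  have g2 : ψ * (D * (φ * φ)) = φ * D + h + h := by
    rw [← mul_assoc D, g1, add_mul, mul_add, mul_assoc, g1, hcomm, c2, c2]
  have g3 : φ * (φ * (D * ψ)) = φ * D - h := by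
    have : φ * (D * ψ) = D - ψ * h := by
      have h1 : φ * D = D * φ - h := by rw [hh]; abel
      rw [← mul_assoc, h1, sub_mul, mul_assoc, hφψ, mul_one, hψ]
    rw [this, mul_sub, c1]
  have g4 : φ * (φ * (φ * (D * (ψ * ψ)))) = φ * D - h - h := by
    have := congrArg (fun x => φ * (x * ψ)) g3
    simp only [mul_assoc, sub_mul, mul_sub, hψ, c1] at this
    rw [this, g3]
  have key := even_product (e := φ * D) (i := I * ψ) (h := h) (by simp only [mul_assoc, c3, hφψ])
    (by simp only [mul_assoc, c2, hID]) hsq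
  rw [← g4, ← g3, ← g2, ← g1] at key
  -- Both sides of the claim are obtained from those of `key` by the same outer factors.
  have key2 := congrArg (fun x => ψ ^ 4 * I ^ 3 * ψ ^ 4 * (φ ^ 3 * D * φ * D * (ψ ^ 2 * I * φ) *
    (ψ * I) * x * φ * D ^ 3 * φ ^ 2 * I * ψ * I * ψ ^ 3)) key
  simp only [pow_succ, pow_zero, one_mul, mul_assoc, c1, c2, c3, c4] at key2 ⊢
  exact key2

end Ring

/-- The module of left-bounded families. -/
def leftBddModule : Submodule ℝ (Gr Sm) where
  carrier := {F | Gr.LeftBdd F}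
  zero_mem' := Gr.leftBdd_zero
  add_mem' := fun ha hb => ha.add hb
  smul_mem' := fun c _ h => h.smul c

/-- Left multiplication on left-bounded families. -/
def mulEnd (F : Gr Sm) : Module.End ℝ leftBddModule where
  toFun G := ⟨F * G, Gr.LeftBdd.mul_left G.2 F⟩
  map_add' G H := Subtype.ext (mul_add F (G : Gr Sm) H)
  map_smul' c G := Subtype.ext (mul_smul_comm c F (G : Gr Sm))

lemma mulEnd_mul (F G : Gr Sm) : mulEnd (F * G) = mulEnd F * mulEnd G :=
  LinearMap.ext fun H => Subtype.ext (mul_assoc F G (H : Gr Sm))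

lemma mulEnd_one : mulEnd 1 = 1 := LinearMap.ext fun H => Subtype.ext (one_mul (H : Gr Sm))

lemma mulEnd_zero : mulEnd 0 = 0 := LinearMap.ext fun H => Subtype.ext (zero_mul (H : Gr Sm))

/-- The superderivative on left-bounded families. -/
def derEnd : Module.End ℝ leftBddModule where
  toFun G := ⟨Gr.superD G, Gr.LeftBdd.superD G.2⟩
  map_add' G H := Subtype.ext (map_add Gr.superD (G : Gr Sm) H)
  map_smul' c G := Subtype.ext (map_smul Gr.superD c (G : Gr Sm))

/-- The inverse of the superderivative on left-bounded families. -/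
def invEnd : Module.End ℝ leftBddModule where
  toFun G := ⟨Gr.superDInv G, Gr.LeftBdd.superDInv G.2⟩
  map_add' G H := Subtype.ext (Gr.superDInv_add G.2 H.2)
  map_smul' c G := Subtype.ext (Gr.eq_of_superD_eq (G.2.smul c).superDInv (G.2.superDInv.smul c)
    ((Gr.superD_superDInv (G.2.smul c)).trans ((map_smul Gr.superD c _).trans
      (congrArg (c • ·) (Gr.superD_superDInv G.2))).symm))

lemma derEnd_mul_invEnd : derEnd * invEnd = 1 :=
  LinearMap.ext fun G => Subtype.ext (Gr.superD_superDInv G.2)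

lemma invEnd_mul_derEnd : invEnd * derEnd = 1 :=
  LinearMap.ext fun G => Subtype.ext (Gr.superDInv_superD G.2)

lemma derEnd_commutator {F : Gr Sm} (hF : Gr.IsEven F) :
    derEnd * mulEnd F - mulEnd F * derEnd = mulEnd (Gr.superD F) := by
  refine LinearMap.ext fun G => Subtype.ext ?_
  change Gr.superD (F * (G : Gr Sm)) - F * Gr.superD (G : Gr Sm) = Gr.superD F * (G : Gr Sm)
  rw [hF.superD_mul, add_sub_cancel_right]

/-- A factor as an endomorphism. -/
def factorEnd (U : PosField) : Factor → Module.End ℝ leftBddModule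
  | .pow s => mulEnd (U.pw s)
  | .der => derEnd
  | .inv => invEnd

/-- A product of factors as an endomorphism. -/
def wordEnd (U : PosField) : List Factor → Module.End ℝ leftBddModule
  | [] => 1
  | f :: w => factorEnd U f * wordEnd U w

lemma coe_wordEnd (U : PosField) (w : List Factor) (F : leftBddModule) :
    (wordEnd U w F : Gr Sm) = opFam w U F := by
  induction w with
  | nil => rfl
  | cons f w ih =>
    rw [opFam, ← ih]
    cases f <;> rfl

lemma wordEnd_opJ (U : PosField) : wordEnd U opJ = wordEnd U opPInv * wordEnd U opR := by
  have hm : ∀ a b : Gr.Ev Sm, mulEnd ((a * b : Gr.Ev Sm) : Gr Sm) = mulEnd a * mulEnd b :=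
    fun a b => mulEnd_mul a b
  have hpow : ∀ (a : Gr.Ev Sm) (n : ℕ), mulEnd ((a ^ n : Gr.Ev Sm) : Gr Sm) = mulEnd a ^ n := by
    intro a n
    induction n with
    | zero => rw [pow_zero, pow_zero]; exact mulEnd_one
    | succ n ih => rw [pow_succ, pow_succ, hm, ih]
  have hφψ : mulEnd (U.pw (1 / 2)) * mulEnd (U.pw (-1 / 2)) = 1 := by
    rw [← hm, U.pw_half_mul]; exact mulEnd_one
  have hψφ : mulEnd (U.pw (-1 / 2)) * mulEnd (U.pw (1 / 2)) = 1 := by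
    rw [← hm, mul_comm, U.pw_half_mul]; exact mulEnd_one
  have pp : ∀ n : ℕ, U.pw (n * (1 / 2)) = U.pw (1 / 2) ^ n := fun n => by
    induction n with
    | zero => rw [pow_zero, Nat.cast_zero, zero_mul, U.pw_zero]
    | succ n ih => rw [pow_succ, ← ih, ← U.pw_add]; congr 1; push_cast; ring
  have pm : ∀ n : ℕ, U.pw (n * (-1 / 2)) = U.pw (-1 / 2) ^ n := fun n => by
    induction n with
    | zero => rw [pow_zero, Nat.cast_zero, zero_mul, U.pw_zero]
    | succ n ih => rw [pow_succ, ← ih, ← U.pw_add]; congr 1; push_cast; ring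
  have e1 : U.pw 1 = U.pw (1 / 2) ^ 2 := by rw [← pp]; norm_num
  have e2 : U.pw (3 / 2) = U.pw (1 / 2) ^ 3 := by rw [← pp]; norm_num
  have e3 : U.pw (-1) = U.pw (-1 / 2) ^ 2 := by rw [← pm]; norm_num
  have e4 : U.pw (-3 / 2) = U.pw (-1 / 2) ^ 3 := by rw [← pm]; norm_num
  have e5 : U.pw (-2) = U.pw (-1 / 2) ^ 4 := by rw [← pm]; norm_num
  have heven : Gr.IsEven (U.pw (1 / 2) : Gr Sm) := (U.pw (1 / 2)).2
  have hodd := heven.superD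
  have hodd2 : Gr.superD (U.pw (1 / 2) : Gr Sm) * Gr.superD (U.pw (1 / 2) : Gr Sm) = 0 := by
    have h := hodd.mul_comm hodd
    rw [eq_neg_iff_add_eq_zero, ← two_smul ℝ] at h
    exact (smul_eq_zero.mp h).resolve_left two_ne_zero
  have key := recursion_identity (φ := mulEnd (U.pw (1 / 2))) (ψ := mulEnd (U.pw (-1 / 2)))
    hφψ hψφ derEnd_mul_invEnd invEnd_mul_derEnd
    (by rw [derEnd_commutator heven, ← mulEnd_mul, hodd2, mulEnd_zero])
    (by rw [derEnd_commutator heven, ← mulEnd_mul, ← mulEnd_mul, heven.mul_comm])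
  simp only [opJ, opPInv, opR, wordEnd, factorEnd, e1, e2, e3, e4, e5, hpow, mul_one]
  simp only [mul_assoc] at key ⊢
  exact key

/-- `J = P⁻¹ R`. -/
theorem op_opJ_eq {U : Superfield} (hU : IsPositiveField U) {F : Superfield}
    (hF : LeftBounded F) : op opJ U F = op opPInv U (op opR U F) := by
  rw [op_eq_ev hU hF, op_op_eq_ev hU hF]
  congr 1
  have h := congrArg Subtype.val (LinearMap.congr_fun (wordEnd_opJ hU.lift) ⟨_, hF.lift⟩)
  rw [Module.End.mul_apply, coe_wordEnd, coe_wordEnd, coe_wordEnd] at h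
  exact h

/-! ### The local flow -/

section

open SuperDiff

lemma opFam_smul (w : List Factor) (U : PosField) (c : ℝ) {F : Gr Sm} (hF : Gr.LeftBdd F) :
    opFam w U (c • F) = c • opFam w U F := by
  have h := congrArg Subtype.val (map_smul (wordEnd U w) c ⟨F, hF⟩)
  rw [coe_wordEnd] at h
  refine h.trans ?_
  rw [← coe_wordEnd U w ⟨F, hF⟩]
  rfl

lemma δInv_d {a : Gr.Ev Sm} (h : Gr.LeftBdd (a : Gr Sm)) : δInv (d a) = a :=
  Subtype.ext (Gr.superDInv_superD h)

lemma dInv_δ {x : Gr.Od Sm} (h : Gr.LeftBdd (x : Gr Sm)) : dInv (δ x) = x :=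
  Subtype.ext (Gr.superDInv_superD h)

namespace PosField

variable (U : PosField)

/-- The superderivatives `D ∂ₓᵏ U`. -/
def odd : ℕ → Gr.Od Sm
  | 0 => d U.val
  | k + 1 => d (δ (odd k) : Gr.Ev Sm)

/-- The derivatives `∂ₓᵏ⁺¹ U`; the index is that of the `odd` element with this derivative. -/
def even (k : ℕ) : Gr.Ev Sm := δ (U.odd k)

lemma jet : Super.Jet U.val (U.even 0) (U.even 1) (U.even 2) (U.even 3)
    (U.odd 0) (U.odd 1) (U.odd 2) (U.odd 3) (U.odd 4) :=
  ⟨rfl, rfl, rfl, rfl, rfl, rfl, rfl, rfl, rfl⟩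

lemma val_mul_pw : U.val * U.pw (-1) = 1 := by
  rw [← U.pw_one, ← U.pw_add, ← U.pw_zero]; norm_num

lemma pw_nat (n : ℕ) : U.pw n = U.val ^ n := by
  induction n with
  | zero => rw [pow_zero, Nat.cast_zero, U.pw_zero]
  | succ n ih => rw [pow_succ, ← ih, ← U.pw_one, ← U.pw_add]; push_cast; rfl

lemma ev_even (ε : ℝ) : ev ε (U.even 0 : Gr Sm) = dx (ev ε (U.val : Gr Sm)) :=
  ev_superD_superD ε _

lemma ev_even_succ (ε : ℝ) (k : ℕ) :
    ev ε (U.even (k + 1) : Gr Sm) = dx (ev ε (U.even k : Gr Sm)) :=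
  ev_superD_superD ε _

lemma ev_odd (ε : ℝ) : ev ε (U.odd 0 : Gr Sm) = D (ev ε (U.val : Gr Sm)) := ev_superD ε _

lemma ev_odd_succ (ε : ℝ) (k : ℕ) :
    ev ε (U.odd (k + 1) : Gr Sm) = D (ev ε (U.even k : Gr Sm)) := ev_superD ε _

lemma frz_odd (k : ℕ) : frzOd (U.odd k) = U.frz.odd k := by
  induction k with
  | zero => exact endo_frz.map_d _
  | succ k ih =>
    change frzOd (d (δ (U.odd k) : Gr.Ev Sm)) = d (δ (U.frz.odd k) : Gr.Ev Sm)
    rw [endo_frz.map_d, endo_frz.map_δ, ih]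

lemma frz_even (k : ℕ) : frzEv (U.even k) = U.frz.even k := by
  change frzEv (δ (U.odd k)) = δ (U.frz.odd k)
  rw [endo_frz.map_δ, frz_odd]

/-- Eight times the variational derivative of the first Hamiltonian. -/
def grad₁ : Gr.Od Sm :=
  (2 * U.pw (-1)) • U.odd 1 - (U.pw (-1) ^ 2 * U.even 0) • U.odd 0

/-- `-8` times the density of the first Hamiltonian. -/
def dens₁ : Gr.Od Sm := (U.pw (-1) * U.even 0) • U.odd 0

/-- `32` times the variational derivative of the second Hamiltonian. -/
def grad₂ : Gr.Od Sm :=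
  (3 * U.pw (-1) ^ 2 * U.even 0 ^ 3) • U.odd 0 - (6 * U.pw (-1) * U.even 0 * U.even 1) • U.odd 0
    - (6 * U.pw (-1) * U.even 0 ^ 2) • U.odd 1 + (4 * U.even 2) • U.odd 0
    + (12 * U.even 1) • U.odd 1 + (12 * U.even 0) • U.odd 2 + (8 * U.val) • U.odd 3

/-- `96` times the density of the second Hamiltonian. -/
def dens₂ : Gr.Od Sm :=
  -((6 * U.even 0 * U.even 0) • U.odd 1) - (6 * U.even 1 * U.even 0) • U.odd 0
    + (8 * (U.val * U.val)) • U.odd 3 + (12 * U.even 0 * U.val) • U.odd 2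
    + (12 * U.even 1 * U.val) • U.odd 1 + (4 * U.even 2 * U.val) • U.odd 0
    + (3 * U.even 0 * U.even 0 * U.even 0 * U.pw (-1)) • U.odd 0

/-- The right-hand side of the supersymmetric Harry Dym equation, times `8`. -/
def flow : Gr.Ev Sm :=
  2 * (U.even 2 * U.val ^ 3) - 3 * (pr (U.odd 2) (U.odd 0) * U.val ^ 2)

lemma frz_grad₁ : frzOd U.grad₁ = U.frz.grad₁ := by
  simp only [grad₁, map_sub, endo_frz.smul, map_mul, map_pow, map_ofNat, frzEv_pw, frz_odd,
    frz_even]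

lemma frz_val : frzEv U.val = U.frz.val := rfl

lemma frz_grad₂ : frzOd U.grad₂ = U.frz.grad₂ := by
  simp only [grad₂, map_sub, map_add, endo_frz.smul, map_mul, map_pow, map_ofNat, frzEv_pw,
    frz_odd, frz_even, frz_val]

/-- `X = P E₁` -/
lemma valP_grad₁ : valP U U.grad₁ = U.flow := Super.flow_cubic U.jet U.val_mul_pw

section Bounded

variable {U} (h : Gr.BddSupp (U.odd 0 : Gr Sm))

include h

lemma odd_mem (k : ℕ) : U.odd k ∈ bddIdeal.J := by
  induction k with
  | zero => exact h
  | succ k ih => exact bddIdeal.d_mem (bddIdeal.δ_mem ih)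

lemma even_mem (k : ℕ) : U.even k ∈ bddIdeal.I := bddIdeal.δ_mem (odd_mem h k)

lemma smul_odd_mem (a : Gr.Ev Sm) (k : ℕ) : a • U.odd k ∈ bddIdeal.J :=
  bddIdeal.J.smul_mem a (odd_mem h k)

lemma grad₁_mem : U.grad₁ ∈ bddIdeal.J := by
  unfold grad₁
  exact sub_mem (smul_odd_mem h _ _) (smul_odd_mem h _ _)

lemma grad₂_mem : U.grad₂ ∈ bddIdeal.J := by
  have k := smul_odd_mem h
  unfold grad₂
  exact add_mem (add_mem (add_mem (add_mem (sub_mem (sub_mem (k _ _) (k _ _)) (k _ _)) (k _ _))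
    (k _ _)) (k _ _)) (k _ _)

lemma dens₁_mem : U.dens₁ ∈ bddIdeal.J := smul_odd_mem h _ _

lemma dens₂_mem : U.dens₂ ∈ bddIdeal.J := by
  have k := smul_odd_mem h
  unfold dens₂
  exact add_mem (add_mem (add_mem (add_mem (add_mem (sub_mem (neg_mem (k _ _)) (k _ _)) (k _ _))
    (k _ _)) (k _ _)) (k _ _)) (k _ _)

lemma flow_mem : U.flow ∈ bddIdeal.I := by
  unfold flow
  exact sub_mem (Ideal.mul_mem_left _ _ (Ideal.mul_mem_right _ _ (even_mem h 2)))
    (Ideal.mul_mem_left _ _ (Ideal.mul_mem_right _ _ (bddIdeal.pr_mem _ (odd_mem h 2))))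

/-- `X = Q E₂`: the potential `D⁻⁵ U⁻¹ D U^{1/2} D U^{3/2} E₂` is local. -/
lemma valQ_grad₂ : valQ U U.grad₂ = 4 * U.flow := by
  -- Every term of `g` contains a derivative of `U`, so that `g` has bounded support and `D⁻⁵`
  -- undoes `D⁵` on `U g`.
  obtain ⟨g, hg⟩ : ∃ g, g = 2 * U.val * U.even 1 - U.even 0 ^ 2 + 2 * pr (U.odd 0) (U.odd 1) :=
    ⟨_, rfl⟩
  have hgm : g ∈ bddIdeal.I := by
    rw [hg]
    exact add_mem (sub_mem (Ideal.mul_mem_left _ _ (even_mem h 1))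
      (Ideal.pow_mem_of_mem _ (even_mem h 0) _ two_pos))
      (Ideal.mul_mem_left _ _ (bddIdeal.pr_mem _ (odd_mem h 0)))
  have hum : 4 * (U.val * g) ∈ bddIdeal.I := Ideal.mul_mem_left _ _ (Ideal.mul_mem_left _ _ hgm)
  have hφ : U.val = U.pw (1 / 2) ^ 2 := by rw [U.pw_half_sq, U.pw_one]
  have h32 : U.pw (3 / 2) = U.pw (1 / 2) ^ 3 := by
    rw [pow_succ, pow_two, ← U.pw_add, ← U.pw_add]; norm_num
  have two : ∀ {a b : Gr.Ev Sm}, 2 * a = 2 * b → a = b := fun {a b} hab => by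
    rw [two_mul, two_mul, ← two_smul ℝ a, ← two_smul ℝ b] at hab
    exact smul_right_injective _ (two_ne_zero' ℝ) hab
  have inner : U.pw (-1) • (d (U.pw (1 / 2) * δ (U.pw (3 / 2) • U.grad₂)) : Gr.Od Sm) =
      d (δ (d (δ (d (4 * (U.val * g)) : Gr.Od Sm) : Gr.Ev Sm) : Gr.Od Sm) : Gr.Ev Sm) := by
    have e1 := Super.flow_inner hφ U.grad₂
    rw [← h32] at e1
    have e2 := Super.flow_inner_explicit U.jet U.val_mul_pw U.grad₂ rfl
    rw [show U.odd 0 = d U.val from rfl] at e2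
    rw [← e1] at e2
    have e3 := Super.flow_quint_eq U.jet
    rw [show U.odd 0 = d U.val from rfl, ← e2, ← show U.odd 0 = d U.val from rfl,
      ← Super.flow_quint U.jet, ← hg] at e3
    have hr := U.val_mul_pw
    have d4 : ∀ a : Gr.Ev Sm, (d (4 * a) : Gr.Od Sm) = (4 : Gr.Ev Sm) • d a := fun a => by
      rw [d_mul, Super.d_ofNat, smul_zero, add_zero]
    have δ4 : ∀ x : Gr.Od Sm, (δ ((4 : Gr.Ev Sm) • x) : Gr.Ev Sm) = 4 * δ x := fun x => by
      rw [δ_smul, Super.d_ofNat, map_zero, LinearMap.zero_apply, zero_add]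
    have d2 : ∀ a : Gr.Ev Sm, (d (2 * a) : Gr.Od Sm) = (2 : Gr.Ev Sm) • d a := fun a => by
      rw [d_mul, Super.d_ofNat, smul_zero, add_zero]
    rw [d4, δ4, d4, δ4, d4]
    rw [d2] at e3
    have half : ∀ {x y : Gr.Od Sm}, (2 : Gr.Ev Sm) • x = (2 : Gr.Ev Sm) • y → x = y :=
      fun {x y} hxy => by
        rw [two_smul, two_smul, ← two_smul ℝ x, ← two_smul ℝ y] at hxy
        exact smul_right_injective _ (two_ne_zero' ℝ) hxy
    apply half
    linear_combination (norm := module) U.pw (-1) • e3 + (8 : Gr.Ev Sm) • hr •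
      (d (δ (d (δ (d (U.val * g) : Gr.Od Sm) : Gr.Ev Sm) : Gr.Od Sm) : Gr.Ev Sm) : Gr.Od Sm)
  have k0 := bddIdeal.d_mem hum
  have k1 := bddIdeal.δ_mem k0
  have k2 := bddIdeal.d_mem k1
  have k3 := bddIdeal.δ_mem k2
  rw [valQ, inner, δInv_d (Gr.BddSupp.leftBdd k3), dInv_δ (Gr.BddSupp.leftBdd k2),
    δInv_d (Gr.BddSupp.leftBdd k1), dInv_δ (Gr.BddSupp.leftBdd k0),
    δInv_d (Gr.BddSupp.leftBdd hum), h32]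
  have e5 : U.pw (-1) * (4 * (U.val * g)) = 4 * g := by
    linear_combination 4 * g * U.val_mul_pw
  rw [e5]
  apply two
  rw [Super.flow_outer hφ]
  have e6 := Super.flow_potential U.jet
  rw [← hg, show U.odd 0 = d U.val from rfl] at e6
  have d4 : (d (4 * g) : Gr.Od Sm) = (4 : Gr.Ev Sm) • d g := by
    rw [d_mul, Super.d_ofNat, smul_zero, add_zero]
  rw [d4, δ_smul, Super.d_ofNat, map_zero, LinearMap.zero_apply, zero_add, map_smul, smul_eq_mul]
  rw [flow, show U.odd 0 = d U.val from rfl]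
  linear_combination 4 * e6

end Bounded

end PosField

section Densities

lemma ofNat_mul_smul (n : ℕ) [n.AtLeastTwo] (a : Gr.Ev Sm) (x : Gr.Od Sm) :
    ((ofNat(n) : Gr.Ev Sm) * a) • x = (ofNat(n) : ℝ) • a • x := by
  rw [mul_smul, ofNat_smul_eq_nsmul (Gr.Ev Sm), ofNat_smul_eq_nsmul ℝ]

lemma ofNat_mul_eq_smul (n : ℕ) [n.AtLeastTwo] (a : Gr.Ev Sm) :
    (ofNat(n) : Gr.Ev Sm) * a = (ofNat(n) : ℝ) • a := by
  rw [← smul_eq_mul, ofNat_smul_eq_nsmul (Gr.Ev Sm), ofNat_smul_eq_nsmul ℝ]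

lemma ev_smul_Od (ε : ℝ) (a : Gr.Ev Sm) (x : Gr.Od Sm) :
    ev ε ((a • x : Gr.Od Sm) : Gr Sm) = ev ε (x : Gr Sm) ⋆ ev ε (a : Gr Sm) := by
  rw [Gr.coe_smul, a.2.mul_comm, ev_mul]

lemma ev_mul_smul_Od (ε : ℝ) (a b : Gr.Ev Sm) (x : Gr.Od Sm) :
    ev ε (((a * b) • x : Gr.Od Sm) : Gr Sm) =
      ev ε ((a • x : Gr.Od Sm) : Gr Sm) ⋆ ev ε (b : Gr Sm) := by
  rw [mul_comm a b, mul_smul, ev_smul_Od]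

lemma ev_mul_Ev (ε : ℝ) (a b : Gr.Ev Sm) :
    ev ε ((a * b : Gr.Ev Sm) : Gr Sm) = ev ε (a : Gr Sm) ⋆ ev ε (b : Gr Sm) := ev_mul ε _ _

namespace PosField

variable (U : PosField)

lemma ev_dens₁ (ε : ℝ) :
    ev ε (((-1 / 8 : ℝ) • U.dens₁ : Gr.Od Sm) : Gr Sm) = density₁ (ev ε (U.val : Gr Sm)) := by
  change (-1 / 8 : ℝ) • ev ε ((U.pw (-1) * U.even 0 : Gr.Ev Sm) * (U.odd 0 : Gr Sm)) = _
  rw [ev_mul, ev_mul_Ev, ev_pw, ev_even, ev_odd]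
  rfl

lemma ev_dens₂ (ε : ℝ) :
    ev ε (((1 / 96 : ℝ) • U.dens₂ : Gr.Od Sm) : Gr Sm) = density₂ (ev ε (U.val : Gr Sm)) := by
  have e : (1 / 96 : ℝ) • U.dens₂ =
      (-1 / 16 : ℝ) • ((U.even 0 * U.even 0) • U.odd 1)
      - (1 / 16 : ℝ) • ((U.even 1 * U.even 0) • U.odd 0)
      + (1 / 12 : ℝ) • ((U.val ^ 2) • U.odd 3)
      + (1 / 8 : ℝ) • ((U.even 0 * U.val) • U.odd 2)
      + (1 / 8 : ℝ) • ((U.even 1 * U.val) • U.odd 1)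
      + (1 / 24 : ℝ) • ((U.even 2 * U.val) • U.odd 0)
      + (1 / 32 : ℝ) • ((U.even 0 * U.even 0 * U.even 0 * U.pw (-1)) • U.odd 0) := by
    simp only [dens₂, mul_assoc, ofNat_mul_smul, ← pow_two U.val]
    generalize (U.even 0 * U.even 0) • U.odd 1 = y₁, (U.even 1 * U.even 0) • U.odd 0 = y₂,
      (U.val ^ 2) • U.odd 3 = y₃, (U.even 0 * U.val) • U.odd 2 = y₄,
      (U.even 1 * U.val) • U.odd 1 = y₅, (U.even 2 * U.val) • U.odd 0 = y₆,
      (U.even 0 * (U.even 0 * (U.even 0 * U.pw (-1)))) • U.odd 0 = y₇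
    module
  rw [e, ← U.pw_two]
  have c : ∀ (c : ℝ) (x : Gr.Od Sm), ev ε ((c • x : Gr.Od Sm) : Gr Sm) = c • ev ε (x : Gr Sm) :=
    fun _ _ => rfl
  have ca : ∀ x y : Gr.Od Sm, ev ε ((x + y : Gr.Od Sm) : Gr Sm) =
      ev ε (x : Gr Sm) + ev ε (y : Gr Sm) :=
    fun _ _ => rfl
  have cs : ∀ x y : Gr.Od Sm, ev ε ((x - y : Gr.Od Sm) : Gr Sm) =
      ev ε (x : Gr Sm) - ev ε (y : Gr Sm) :=
    fun _ _ => ev_sub ε _ _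
  rw [ca, ca, ca, ca, ca, cs]
  simp only [c, ev_mul_smul_Od]
  simp only [ev_smul_Od, ev_pw, ev_even, ev_even_succ, ev_odd, ev_odd_succ]
  rfl

lemma ev_flow (ε : ℝ) :
    ev ε (((1 / 8 : ℝ) • U.flow : Gr.Ev Sm) : Gr Sm) = shd (ev ε (U.val : Gr Sm)) := by
  have e : (1 / 8 : ℝ) • U.flow = (1 / 4 : ℝ) • (U.even 2 * U.pw 3)
      - (3 / 8 : ℝ) • (pr (U.odd 2) (U.odd 0) * U.pw 2) := by
    have h3 : U.pw 3 = U.val ^ 3 := by exact_mod_cast U.pw_nat 3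
    rw [flow, ofNat_mul_eq_smul, ofNat_mul_eq_smul, U.pw_two, h3, smul_sub, smul_smul, smul_smul]
    norm_num
  rw [e]
  change ev ε ((1 / 4 : ℝ) • ((U.even 2 : Gr Sm) * (U.pw 3 : Gr Sm))
    - (3 / 8 : ℝ) • ((U.odd 2 : Gr Sm) * (U.odd 0 : Gr Sm) * (U.pw 2 : Gr Sm))) = _
  rw [ev_sub, ev_smul, ev_smul, ev_mul, ev_mul, ev_mul]
  simp only [ev_pw, ev_even, ev_even_succ, ev_odd, ev_odd_succ]
  rfl

end PosField

end Densities

end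

/-! ### Variational derivatives -/

section

open SuperDiff

/-- A functional whose density changes, along any family of fields, by the pairing with `grad` and
a total derivative, has the variational derivative `grad`. -/
lemma hasVariationalDeriv_of_total {h : Superfield → Superfield} (dens grad : PosField → Gr.Od Sm)
    (hdens : ∀ ε (V : PosField), ev ε (dens V : Gr Sm) = h (ev ε (V.val : Gr Sm)))
    (hmem : ∀ V : PosField, Gr.BddSupp (V.odd 0 : Gr Sm) → dens V ∈ bddIdeal.J)
    (hfrz : ∀ V, frzOd (grad V) = grad V.frz)
    (hvar : ∀ V : PosField, dEpsEv V.val ∈ bddIdeal.I →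
      dEpsOd (dens V) - dEpsEv V.val • grad V ∈ bddIdeal.total)
    {U : Superfield} (hU : IsPositiveField U) (hc : CompactSupp (D U)) :
    HasVariationalDeriv h U (ev 0 (grad hU.lift : Gr Sm)) := by
  refine ⟨smooth_ev 0 _, fermionic_ev 0 (Subtype.property _), fun W hW hb hcW S => ?_⟩
  obtain ⟨V, hV, hVb⟩ := hU.exists_family hW hb hcW
  have hx : Gr.BddSupp (V.odd 0 : Gr Sm) := by
    have h1 : Gr.BddSupp (Gr.superD (hU.lift.val : Gr Sm)) :=
      bddSupp_of_frz (Gr.frz_superD _) (by rw [ev_superD]; exact hc)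
    have h2 := hVb.superD.add h1
    rwa [← map_add, sub_add_cancel] at h2
  have hw : dEpsEv V.val ∈ bddIdeal.I := by
    have h1 := hVb.dEps
    rwa [map_sub, show Gr.dEps (hU.lift.val : Gr Sm) = 0 from Gr.dEps_frz (hU.lift.val : Gr Sm),
      sub_zero] at h1
  have hd := hmem V hx
  have key := hasDerivAt_superIntegral hd S
  have e1 : superIntegral (ev 0 (Gr.dEps (dens V : Gr Sm))) =
      pairing W (ev 0 (grad hU.lift : Gr Sm)) := by
    have h1 : ev 0 (grad hU.lift : Gr Sm) = ev 0 (grad V : Gr Sm) := by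
      rw [← hV.frz_eq hU, ← hfrz]
      rfl
    have h2 : W = ev 0 (dEpsEv V.val : Gr Sm) := by
      have := congrArg (ev 0) (hV.frz_dEps hW)
      exact this.symm
    rw [h1, h2, pairing_ev_Ev]
    have h3 := superIntegral_add_of_total (Gr.BddSupp.dEps hd) (y := -(dEpsEv V.val • grad V))
      (neg_mem (s := bddIdeal.J) (bddIdeal.smul_mem _ hw)) (x := dEpsOd (dens V))
      (by rw [← sub_eq_add_neg]; exact hvar V hw)
    refine h3.trans ?_
    have h4 : -(dEpsEv V.val • grad V) = (-1 : ℝ) • (dEpsEv V.val • grad V) :=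
      (neg_one_smul ℝ _).symm
    rw [h4]
    refine (congrArg Neg.neg (superIntegral_ev_smul 0 (-1) _)).trans ?_
    rw [neg_one_smul, neg_neg]
  rw [e1] at key
  refine key.congr_of_eventuallyEq ?_
  filter_upwards [hV.eventually] with ε hε
  rw [hdens, hε]

variable {U : Superfield} (hU : IsPositiveField U) (hc : CompactSupp (D U))

include hc in
lemma hasVariationalDeriv_density₁ :
    HasVariationalDeriv density₁ U (ev 0 (((1 / 8 : ℝ) • hU.lift.grad₁ : Gr.Od Sm) : Gr Sm)) := by
  refine hasVariationalDeriv_of_total (fun V => (-1 / 8 : ℝ) • V.dens₁)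
    (fun V => (1 / 8 : ℝ) • V.grad₁) (fun ε V => V.ev_dens₁ ε)
    (fun V hV => Submodule.smul_of_tower_mem _ _ (PosField.dens₁_mem hV))
    (fun V => by rw [map_smul, V.frz_grad₁]) (fun V hV => ?_) hU hc
  have h := Super.variation_density₁ V.jet variation_dEps V.val_mul_pw hV
  have h2 := Submodule.smul_mem _ (-1 / 8 : ℝ) h
  convert h2 using 1
  change _ = (-1 / 8 : ℝ) • (dEpsOd V.dens₁ + dEpsEv V.val • V.grad₁)
  rw [map_smul, smul_comm (dEpsEv V.val) (1 / 8 : ℝ)]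
  generalize dEpsEv V.val • V.grad₁ = y
  module

include hc in
lemma hasVariationalDeriv_density₂ :
    HasVariationalDeriv density₂ U (ev 0 (((1 / 32 : ℝ) • hU.lift.grad₂ : Gr.Od Sm) : Gr Sm)) := by
  refine hasVariationalDeriv_of_total (fun V => (1 / 96 : ℝ) • V.dens₂)
    (fun V => (1 / 32 : ℝ) • V.grad₂) (fun ε V => V.ev_dens₂ ε)
    (fun V hV => Submodule.smul_of_tower_mem _ _ (PosField.dens₂_mem hV))
    (fun V => by rw [map_smul, V.frz_grad₂]) (fun V hV => ?_) hU hc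
  have h := Super.variation_density₂ V.jet variation_dEps V.val_mul_pw hV
  have h2 := Submodule.smul_mem _ (1 / 96 : ℝ) h
  convert h2 using 1
  change _ = (1 / 96 : ℝ) • (dEpsOd V.dens₂ - dEpsEv V.val • (3 : Gr.Ev Sm) • V.grad₂)
  rw [map_smul, ofNat_smul_eq_nsmul (Gr.Ev Sm), ← ofNat_smul_eq_nsmul ℝ,
    smul_comm (dEpsEv V.val) (1 / 32 : ℝ), smul_comm (dEpsEv V.val) (3 : ℝ), smul_sub, smul_smul]
  norm_num

include hc in
lemma bddSupp_odd : Gr.BddSupp (hU.lift.odd 0 : Gr Sm) :=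
  bddSupp_of_frz (Gr.frz_superD _) (by rw [hU.lift.ev_odd]; exact hc)

include hU in
lemma shd_eq_ev : shd U = ev 0 (((1 / 8 : ℝ) • hU.lift.flow : Gr.Ev Sm) : Gr Sm) :=
  (hU.lift.ev_flow 0).symm

include hc in
lemma leftBdd_flow : Gr.LeftBdd (((1 / 8 : ℝ) • hU.lift.flow : Gr.Ev Sm) : Gr Sm) :=
  (Gr.BddSupp.smul (PosField.flow_mem (bddSupp_odd hU hc)) (1 / 8)).leftBdd

include hc in
lemma shd_eq_op_opP :
    shd U = op opP U (ev 0 (((1 / 8 : ℝ) • hU.lift.grad₁ : Gr.Od Sm) : Gr Sm)) := by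
  have hb : Gr.LeftBdd (hU.lift.grad₁ : Gr Sm) :=
    Gr.BddSupp.leftBdd (PosField.grad₁_mem (bddSupp_odd hU hc))
  have h := ev_opFam 0 opP hU.lift (F := (((1 / 8 : ℝ) • hU.lift.grad₁ : Gr.Od Sm) : Gr Sm))
    (hb.smul (1 / 8))
  refine Eq.trans ?_ h
  have h2 := opFam_smul opP hU.lift (1 / 8) hb
  rw [← coe_valP, hU.lift.valP_grad₁] at h2
  rw [shd_eq_ev hU]
  exact congrArg (ev 0) h2.symm

include hc in
lemma shd_eq_op_opQ :
    shd U = op opQ U (ev 0 (((1 / 32 : ℝ) • hU.lift.grad₂ : Gr.Od Sm) : Gr Sm)) := by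
  have hb : Gr.LeftBdd (hU.lift.grad₂ : Gr Sm) :=
    Gr.BddSupp.leftBdd (PosField.grad₂_mem (bddSupp_odd hU hc))
  have h := ev_opFam 0 opQ hU.lift (F := (((1 / 32 : ℝ) • hU.lift.grad₂ : Gr.Od Sm) : Gr Sm))
    (hb.smul (1 / 32))
  refine Eq.trans ?_ h
  have h2 := opFam_smul opQ hU.lift (1 / 32) hb
  rw [← coe_valQ, PosField.valQ_grad₂ (bddSupp_odd hU hc), ofNat_mul_eq_smul] at h2
  rw [shd_eq_ev hU]
  refine congrArg (ev 0) (Eq.trans ?_ h2.symm)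
  change (1 / 8 : ℝ) • (hU.lift.flow : Gr Sm) = (1 / 32 : ℝ) • (4 : ℝ) • (hU.lift.flow : Gr Sm)
  rw [smul_smul]
  norm_num

include hU hc in
lemma leftBounded_shd : LeftBounded (shd U) := by
  rw [shd_eq_ev hU]
  exact leftBounded_ev 0 (leftBdd_flow hU hc)

theorem isBiHamiltonian_shd : IsBiHamiltonian shd opP opJ density₁ density₂ where
  hamiltonian := isHamiltonian_opP
  symplectic := isSymplectic_opJ
  flow U hU hc := by
    refine ⟨leftBounded_shd hU hc, ⟨_, hasVariationalDeriv_density₁ hU hc, shd_eq_op_opP hU hc⟩,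
      _, hasVariationalDeriv_density₂ hU hc, ?_⟩
    rw [shd_eq_op_opQ hU hc]
    have hb : Gr.LeftBdd (hU.lift.grad₂ : Gr Sm) :=
      Gr.BddSupp.leftBdd (PosField.grad₂_mem (bddSupp_odd hU hc))
    exact (areInverse_of_invWord invWord_opQ invWord_opJ U hU _
      (leftBounded_ev 0 (hb.smul (1 / 32)))).2

end

end SuperHD

end

theorem proposition2 :
    -- the Jacobi identity for `Q`
    (∀ U : Superfield, IsPositiveField U → JacobiIdentity opQ U) ∧
    -- `Q` is a Hamiltonian operator, and the equation is Hamiltonian with respect to it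
    IsHamiltonian opQ ∧
    (∀ U : Superfield, IsPositiveField U → CompactSupp (D U) →
      ∃ E : Superfield, HasVariationalDeriv density₂ U E ∧ shd U = op opQ U E) ∧
    -- `Q` is the inverse of `J`
    AreInverse opQ opJ ∧
    -- `J = P⁻¹ R`
    AreInverse opP opPInv ∧
    (∀ U : Superfield, IsPositiveField U → ∀ F : Superfield, LeftBounded F →
      op opJ U F = op opPInv U (op opR U F)) ∧
    -- `J` is a symplectic operator
    IsSymplectic opJ ∧
    -- `P` and `J` give a bi-Hamiltonian structure of the equation
    IsBiHamiltonian shd opP opJ density₁ density₂ := by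
  exact ⟨isHamiltonian_opQ.jacobi, isHamiltonian_opQ,
    fun _ hU hc => ⟨_, hasVariationalDeriv_density₂ hU hc, shd_eq_op_opQ hU hc⟩,
    areInverse_of_invWord invWord_opQ invWord_opJ,
    areInverse_of_invWord invWord_opP invWord_opPInv,
    fun _ hU _ hF => op_opJ_eq hU hF, isSymplectic_opJ, isBiHamiltonian_shd⟩
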